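/- **Definitions.** A \emph{SAS$^+$ instance} $\mathbb{P}=\langle V,D,A,I,G\rangle$ consists of a finite set $V$ of variables, a finite domain $D$, a finite set $A$ of actions, an initial state $I\in D^V$ and a goal $G\in (D\cup\{\mathbf u\})^V$, where $\mathbf u\notin D$ means ``undefined''. Each action $a$ has a precondition $\mathrm{pre}(a)$ and an effect $\mathrm{eff}(a)$ in $(D\cup\{\mathbf u\})^V$. The action $a$ is \emph{valid} in a state $s\in D^V$ if for all $v$, $\mathrm{pre}(a)[v]\in\{s[v],\mathbf u\}$; its \emph{result} in $s$ is the state $t$ with $t[v]=\mathrm{eff}(a)[v]$ if $\mathrm{eff}(a)[v]\ne\mathbf u$, and $t[v]=s[v]$ otherwise. A \emph{plan} for $\mathbb{P}$ is a finite sequence of actions that, applied successively from $I$, are each valid in the current state and lead to a state $s$ with $G[v]\in\{s[v],\mathbf u\}$ for all $v$. A plan is \emph{minimal} if none of its proper subsequences is a plan. The instance is \emph{post-unique} (P) if for each $v\in V$ and $x\in D$ there is at most one $a\in A$ with $\mathrm{eff}(a)[v]=x$. \{P\}-\textsc{Bounded SAS$^+$ Planning} is the parameterized problem whose instances are the pairs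 $\langle\mathbb{P},k\rangle$ with $\mathbb{P}$ a post-unique SAS$^+$ instance and $k$ a positive integer, the parameter; the question is whether $\mathbb{P}$ has a plan of length at most $k$. It is identified with the set of those $(x,k)\in\Sigma^*\times\mathbb{N}$ such that $k\geq 1$ and $x$ is the encoding of a post-unique SAS$^+$ instance that has a plan of length at most $k$. Here $\mathbb{P}$ is written over a fixed finite alphabet as $|D|$ followed by the tuples $I$, $G$, and $\mathrm{pre}(a),\mathrm{eff}(a)$ for all $a\in A$, with numbers and values in binary; $(x,k)$ is given to a (multi-stack) Turing machine as $1^k\#x$, and $n=|x|+k+1$ is the input length. A parameterized problem $L\subseteq\Sigma^*\times\mathbb{N}$ is \emph{fixed-parameter tractable} if there are a computable function $f:\mathbb{N}\to\mathbb{N}$, a constant $c$ and a Turing machine that decides for every $(x,k)\in\Sigma^*\times\mathbb{N}$ whether $(x,k)\in L$ in at most $f(k)\,n^c$ steps. **Theorem.** 1. \{P\}-\textsc{Bounded SAS$^+$ Planning} is fixed-parameter tractable (with parameter $k$). 2. More precisely, there are constants $C,c$ and a Turing machine that decides it in at most $C\,k^k\,n^c$ steps (with $0^0=1$). 3. There are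 a computable function $f:\mathbb{N}\to\mathbb{N}$, a constant $c$ and a Turing machine that, given any post-unique SAS$^+$ instance $\mathbb{P}$ and any $k\geq 1$, outputs in at most $f(k)\,n^c$ steps a list of action sequences whose members are exactly the minimal plans for $\mathbb{P}$ of length at most $k$. -/

import Mathlib

/-! ### SAS⁺ planning -/

/-- A SAS⁺ instance. The variables, the domain values and the actions are enumerated, so that the
set of variables is `Fin numVars`, the domain is `Fin numVals`, and the set of actions is
`Fin numActs`. The undefined value is `none`. Actions are names: two different actions may have
the same precondition and the same effect. -/
structure SASInstance where
  numVars : ℕ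
  numVals : ℕ
  numActs : ℕ
  /-- the initial state, a total state -/
  init : Fin numVars → Fin numVals
  /-- the goal state, a partial state -/
  goal : Fin numVars → Option (Fin numVals)
  /-- the preconditions of the actions -/
  pre : Fin numActs → Fin numVars → Option (Fin numVals)
  /-- the effects of the actions -/
  eff : Fin numActs → Fin numVars → Option (Fin numVals)

namespace SASInstance

variable (P : SASInstance)

/-- Total states. -/
abbrev State : Type := Fin P.numVars → Fin P.numVals

/-- The actions (by name). -/
abbrev Action : Type := Fin P.numActs

/-- The action `a` is valid in the total state `s`. -/
def Valid (a : P.Action) (s : P.State) : Prop :=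
  ∀ v, P.pre a v = some (s v) ∨ P.pre a v = none

/-- The result of the action `a` in the total state `s`. -/
def result (a : P.Action) (s : P.State) : P.State :=
  fun v => (P.eff a v).getD (s v)

/-- `P.IsPlanFromTo s ω t`: the action sequence `ω` is a plan from `s` to `t`. -/
def IsPlanFromTo : P.State → List P.Action → P.State → Prop
  | s, [], t => s = t
  | s, a :: ω, t => P.Valid a s ∧ IsPlanFromTo (P.result a s) ω t

/-- The total state `s` is a goal state. -/
def IsGoalState (s : P.State) : Prop :=
  ∀ v, P.goal v = some (s v) ∨ P.goal v = none

/-- The action sequence `ω` is a plan for the instance. -/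
def IsPlan (ω : List P.Action) : Prop :=
  ∃ t, P.IsGoalState t ∧ P.IsPlanFromTo P.init ω t

/-- A plan is minimal if none of its proper subsequences is a plan. -/
def IsMinimalPlan (ω : List P.Action) : Prop :=
  P.IsPlan ω ∧ ∀ ω' : List P.Action, ω'.Sublist ω → ω' ≠ ω → ¬ P.IsPlan ω'

/-- Restriction P: every value of every variable is set by at most one action. -/
def PostUnique : Prop :=
  ∀ (v : Fin P.numVars) (x : Fin P.numVals) (a b : P.Action),
    P.eff a v = some x → P.eff b v = some x → a = b

end SASInstance

/-! ### Instances and plans as strings over the finite alphabet `Γ'`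

The symbols of `Γ'` are the two bits, a blank, two brackets and a comma. -/

open Computability (Γ')

/-- A number, in binary with the least significant bit first (and `0` as the empty numeral),
closed by a comma. -/
def encodeNumeral (m : ℕ) : List Γ' :=
  (Nat.bits m).map Γ'.bit ++ [Γ'.comma]

/-- A value, or the blank symbol if it is undefined; closed by a comma. -/
def encodeValue {d : ℕ} : Option (Fin d) → List Γ'
  | none => [Γ'.blank, Γ'.comma]
  | some x => encodeNumeral x

/-- A partial state, as the bracketed tuple of its values. -/
def encodePartialState {n d : ℕ} (s : Fin n → Option (Fin d)) : List Γ' :=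
  Γ'.bra :: (List.ofFn s).flatMap encodeValue ++ [Γ'.ket]

/-- A SAS⁺ instance: the size of the domain in binary, the initial state, the goal state, and for
each action its precondition followed by its effect. The numbers of variables and of actions can
be read off from the lengths of these lists. -/
def SASInstance.encode (P : SASInstance) : List Γ' :=
  encodeNumeral P.numVals
    ++ encodePartialState (fun v => some (P.init v))
    ++ encodePartialState P.goal
    ++ (List.finRange P.numActs).flatMap
        (fun a => encodePartialState (P.pre a) ++ encodePartialState (P.eff a))

/-- A list of action sequences: each sequence is the bracketed tuple of the indices of its
actions. -/
def SASInstance.encodePlans (P : SASInstance) (plans : List (List P.Action)) : List Γ' :=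
  plans.flatMap fun ω => Γ'.bra :: ω.flatMap (fun a => encodeNumeral a) ++ [Γ'.ket]

/-! ### Parameterized problems -/

/-- A parameterized problem over the alphabet `S`: a subset of `S* × ℕ`. -/
abbrev ParameterizedProblem (S : Type) : Type := Set (List S × ℕ)

/-- The pair of a string `x` and a parameter `k` as one string: `k` in unary (with the
digit `Sum.inr true`), the separator `Sum.inr false`, and `x`. -/
def encodePair {S : Type} (x : List S) (k : ℕ) : List (S ⊕ Bool) :=
  List.replicate k (Sum.inr true) ++ Sum.inr false :: x.map Sum.inl

/-- The Turing machine `M` (with finitely many states and stacks), started on `input`, halts with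
`output` after at most `t` steps. -/
def RunsInTime {A B : Type} (M : Turing.TM2ComputableAux A B) (input : List A) (output : List B)
    (t : ℕ) : Prop :=
  Nonempty (Turing.TM2OutputsInTime M.tm (input.map M.inputAlphabet.symm)
    (some (output.map M.outputAlphabet.symm)) t)

/-- Some Turing machine decides, for every `(x, k)`, whether `(x, k) ∈ L` in at most `f k * n ^ c`
steps, where `n` is the length of the input. -/
def SolvableInTime {S : Type} (L : ParameterizedProblem S) (f : ℕ → ℕ) (c : ℕ) : Prop :=
  ∃ M : Turing.TM2ComputableAux (S ⊕ Bool) Bool, ∀ (x : List S) (k : ℕ),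
    ∃ b : Bool, (b = true ↔ (x, k) ∈ L) ∧
      RunsInTime M (encodePair x k) [b] (f k * (encodePair x k).length ^ c)

/-- The parameterized problem `L` is fixed-parameter tractable. -/
def IsFPT {S : Type} (L : ParameterizedProblem S) : Prop :=
  ∃ (f : ℕ → ℕ) (c : ℕ), Computable f ∧ SolvableInTime L f c

/-- Bounded SAS⁺ planning, restricted to the instances that satisfy `R`: given a SAS⁺ instance and a
positive integer `k`, the parameter, is there a plan of length at most `k`? -/
def BoundedSASPlanning (R : SASInstance → Prop) : ParameterizedProblem Γ' :=
  {p | ∃ P : SASInstance, R P ∧ P.encode = p.1 ∧ 0 < p.2 ∧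
    ∃ ω : List P.Action, P.IsPlan ω ∧ ω.length ≤ p.2}

/-- Some Turing machine, given a SAS⁺ instance that satisfies `R` and a positive integer `k`,
outputs a list of exactly the minimal plans of length at most `k`, in at most `f k * n ^ c` steps,
where `n` is the length of the input. -/
def MinimalPlansListableInTime (R : SASInstance → Prop) (f : ℕ → ℕ) (c : ℕ) : Prop :=
  ∃ M : Turing.TM2ComputableAux (Γ' ⊕ Bool) Γ', ∀ (P : SASInstance) (k : ℕ), R P → 0 < k →
    ∃ plans : List (List P.Action),
      (∀ ω : List P.Action, ω ∈ plans ↔ P.IsMinimalPlan ω ∧ ω.length ≤ k) ∧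
      RunsInTime M (encodePair P.encode k) (P.encodePlans plans)
        (f k * (encodePair P.encode k).length ^ c)

/-! The algorithm is a bounded search tree. Let `ω` be a subsequence of a plan `σ`, and suppose that
`ω` is not itself a plan. Execute `ω` up to the first point where it fails: an invalid action, or
the unmet goal at the end. Some variable `v` should have a value `x` there and does not. At the
matching point of `σ` the variable does have the value `x`, so `σ` contains an earlier action with
effect `x` on `v` that can be inserted into `ω` before the failure without leaving `σ`
(`SASInstance.exists_insertion`). Post-uniqueness makes this action unique, so only its position has
to be guessed, and a sequence of length `j` has `j + 1` positions (`SASInstance.exists_child`).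

Starting from the empty sequence and stopping at length `k`, the tree has depth at most `k` and
branching at most `k`, hence at most `(k + 1) * k ^ k` nodes (`nodes_le`). If `σ` is minimal, then a
descent inside `σ` can only end in `σ`, so every minimal plan of length at most `k` is found
(`SASInstance.mem_found`). Everything found is a plan of length at most `k`. Since every plan
contains a minimal one, the answer is "yes" iff something is found, and the minimal plans are the
found sequences that have no other found sequence as a subsequence (`SASInstance.exists_plans`).

For the machine model, structured programs on stacks are compiled to Turing machines with exact step
counts (`Exec.machineSteps`). On top of them stands a calculus of polynomial time functions between
types of trees (`PolyTime`), closed under composition, case distinction and folds with polynomially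
bounded intermediate results. All of parsing, checking, a single search step and printing fall under
this calculus. The search alone is a loop outside of it, with one step for each node.

The size of the search state governs the cost of a step. Depth-first order keeps at most `k ^ 2 + 1`
sequences pending. For the decision problem only the last plan found is remembered, so a step costs
polynomial time; the factor `k + 1` of the node bound is absorbed by the input length, and `k ^ k`
remains. For the listing all plans found are kept, at most one for each node, and the bound becomes
a power of `(k + 1) * k ^ k` times a power of `n`. Strings that encode no post-unique instance are
rejected by parsing leniently, rendering the result, comparing it with the input, and checking the
tokens. -/

/-! ### Structured stack programs and their compilation to Turing machines -/

/-- The letters that occur at the leaves of trees, which are also the input letters. -/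
abbrev Letter : Type := Γ' ⊕ Bool

/-- The symbols on the work stacks. -/
inductive Cell
  | mark
  | node
  | leaf (x : Letter)
  deriving DecidableEq, Fintype

/-- The names of the work stacks. -/
inductive Work
  | main
  | save
  | count
  | copy
  deriving DecidableEq

instance : Fintype Work := ⟨{.main, .save, .count, .copy}, by rintro (_ | _ | _ | _) <;> decide⟩

/-- The memory of a stack program with output alphabet `O`. -/
structure Store (O : Type) where
  reg : Option Cell
  inp : List Letter
  main : List Cell
  save : List Cell
  count : List Cell
  copy : List Cell
  out : List O

/-- The instructions of stack programs. -/
inductive Instr (O : Type)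
  | push (k : Work) (f : Option Cell → Cell)
  | pop (k : Work)
  | read
  | write (f : Option Cell → O)
  | clear

/-- The effect of an instruction. -/
def Instr.run {O : Type} : Instr O → Store O → Store O
  | push .main f, s => { s with main := f s.reg :: s.main }
  | push .save f, s => { s with save := f s.reg :: s.save }
  | push .count f, s => { s with count := f s.reg :: s.count }
  | push .copy f, s => { s with copy := f s.reg :: s.copy }
  | pop .main, s => { s with reg := s.main.head?, main := s.main.tail }
  | pop .save, s => { s with reg := s.save.head?, save := s.save.tail }
  | pop .count, s => { s with reg := s.count.head?, count := s.count.tail }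
  | pop .copy, s => { s with reg := s.copy.head?, copy := s.copy.tail }
  | read, s => { s with reg := s.inp.head?.map Cell.leaf, inp := s.inp.tail }
  | write f, s => { s with out := f s.reg :: s.out }
  | clear, s => { s with reg := none }

/-- Structured stack programs. -/
inductive Prog (O : Type)
  | op (i : Instr O)
  | seq (p q : Prog O)
  | ite (c : Option Cell → Bool) (p q : Prog O)
  | loop (pre : Prog O) (c : Option Cell → Bool) (body : Prog O)

/-- `Exec p s s' n`: the program `p`, started in the store `s`, ends in the store `s'` after `n`
steps. -/
inductive Exec {O : Type} : Prog O → Store O → Store O → ℕ → Prop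
  | op (i : Instr O) (s : Store O) : Exec (.op i) s (i.run s) 1
  | seq {p q : Prog O} {s₁ s₂ s₃ : Store O} {m n : ℕ} :
      Exec p s₁ s₂ m → Exec q s₂ s₃ n → Exec (.seq p q) s₁ s₃ (m + n)
  | ite_true {c : Option Cell → Bool} {p q : Prog O} {s₁ s₂ : Store O} {m : ℕ} :
      c s₁.reg = true → Exec p s₁ s₂ m → Exec (.ite c p q) s₁ s₂ (1 + m)
  | ite_false {c : Option Cell → Bool} {p q : Prog O} {s₁ s₂ : Store O} {m : ℕ} :
      c s₁.reg = false → Exec q s₁ s₂ m → Exec (.ite c p q) s₁ s₂ (1 + m)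
  | loop_done {pre : Prog O} {c : Option Cell → Bool} {body : Prog O} {s₁ s₂ : Store O} {m : ℕ} :
      Exec pre s₁ s₂ m → c s₂.reg = false → Exec (.loop pre c body) s₁ s₂ (m + 1)
  | loop_next {pre : Prog O} {c : Option Cell → Bool} {body : Prog O}
      {s₁ s₂ s₃ s₄ : Store O} {m n l : ℕ} :
      Exec pre s₁ s₂ m → c s₂.reg = true → Exec body s₂ s₃ n → Exec (.loop pre c body) s₃ s₄ l →
      Exec (.loop pre c body) s₁ s₄ (m + 1 + n + l)

/-- The stacks of the Turing machine. -/
inductive Tape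
  | inp
  | work (k : Work)
  | out
  deriving DecidableEq, Fintype

/-- The stack alphabets of the Turing machine. -/
abbrev Tape.Alphabet (O : Type) : Tape → Type
  | .inp => Letter
  | .work _ => Cell
  | .out => O

/-- The stacks of the Turing machine in a given store. -/
def Store.stk {O : Type} (s : Store O) : ∀ k : Tape, List (k.Alphabet O)
  | .inp => s.inp
  | .work .main => s.main
  | .work .save => s.save
  | .work .count => s.count
  | .work .copy => s.copy
  | .out => s.out

/-- The statements of the Turing machine. -/
abbrev MachineStmt (O Λ : Type) : Type := Turing.TM2.Stmt (Tape.Alphabet O) Λ (Option Cell)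

/-- An instruction followed by a statement. -/
def Instr.stmt {O Λ : Type} : Instr O → MachineStmt O Λ → MachineStmt O Λ
  | push k f, q => .push (Tape.work k) f q
  | pop k, q => .pop (Tape.work k) (fun _ x => x) q
  | read, q => .pop Tape.inp (fun _ x => x.map Cell.leaf) q
  | write f, q => .push Tape.out f q
  | clear, q => .load (fun _ => none) q

theorem Instr.stepAux_stmt {O Λ : Type} (i : Instr O) (q : MachineStmt O Λ) (s : Store O) :
    Turing.TM2.stepAux (i.stmt q) s.reg s.stk =
      Turing.TM2.stepAux q (i.run s).reg (i.run s).stk := by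
  rcases i with ⟨k, f⟩ | k | _ | f | _ <;> try cases k
  all_goals
    refine congrArg (Turing.TM2.stepAux q _) (funext fun t => ?_)
    rcases t with _ | k | _ <;> try cases k
    all_goals simp [Function.update, Store.stk, Instr.run]

/-- The labels of a compiled program. -/
def Prog.Label {O : Type} : Prog O → Type
  | op _ => Unit
  | seq p q => p.Label ⊕ q.Label
  | ite _ p q => Option (p.Label ⊕ q.Label)
  | loop pre _ body => Option (pre.Label ⊕ body.Label)

/-- A compiled program has finitely many labels. -/
@[reducible]
def Prog.labelFintype {O : Type} : ∀ p : Prog O, Fintype p.Label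
  | op _ => inferInstanceAs (Fintype Unit)
  | seq p q =>
    letI := p.labelFintype
    letI := q.labelFintype
    inferInstanceAs (Fintype (p.Label ⊕ q.Label))
  | ite _ p q =>
    letI := p.labelFintype
    letI := q.labelFintype
    inferInstanceAs (Fintype (Option (p.Label ⊕ q.Label)))
  | loop pre _ body =>
    letI := pre.labelFintype
    letI := body.labelFintype
    inferInstanceAs (Fintype (Option (pre.Label ⊕ body.Label)))

/-- The label at which a compiled program starts. -/
def Prog.entry {O : Type} : ∀ p : Prog O, p.Label
  | op _ => ()
  | seq p _ => Sum.inl p.entry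
  | ite _ _ _ => none
  | loop pre _ _ => some (Sum.inl pre.entry)

/-- The code of a program inside a machine with labels `Λ`, where `emb` gives the places of the
labels of the program and `exit` is the label at which to continue. -/
def Prog.code {O Λ : Type} : ∀ (p : Prog O) (_ : p.Label → Λ) (_ : Λ), p.Label → MachineStmt O Λ
  | op i, _, exit, _ => i.stmt (.goto fun _ => exit)
  | seq p q, emb, exit, l =>
    match l with
    | .inl l => p.code (fun l => emb (.inl l)) (emb (.inr q.entry)) l
    | .inr l => q.code (fun l => emb (.inr l)) exit l
  | ite c p q, emb, exit, l =>
    match l with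
    | none => .branch c (.goto fun _ => emb (some (.inl p.entry)))
        (.goto fun _ => emb (some (.inr q.entry)))
    | some (.inl l) => p.code (fun l => emb (some (.inl l))) exit l
    | some (.inr l) => q.code (fun l => emb (some (.inr l))) exit l
  | loop pre c body, emb, exit, l =>
    match l with
    | none => .branch c (.goto fun _ => emb (some (.inr body.entry))) (.goto fun _ => exit)
    | some (.inl l) => pre.code (fun l => emb (some (.inl l))) (emb none) l
    | some (.inr l) =>
      body.code (fun l => emb (some (.inr l))) (emb (some (.inl pre.entry))) l

/-- The machine `M` goes from one configuration to the other in exactly `n` steps. -/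
def MachineSteps {O Λ : Type} (M : Λ → MachineStmt O Λ)
    (c c' : Turing.TM2.Cfg (Tape.Alphabet O) Λ (Option Cell)) (n : ℕ) : Prop :=
  (flip bind (Turing.TM2.step M))^[n] (some c) = some c'

theorem MachineSteps.trans {O Λ : Type} {M : Λ → MachineStmt O Λ}
    {c₁ c₂ c₃ : Turing.TM2.Cfg (Tape.Alphabet O) Λ (Option Cell)} {m n : ℕ}
    (h₁ : MachineSteps M c₁ c₂ m) (h₂ : MachineSteps M c₂ c₃ n) :
    MachineSteps M c₁ c₃ (m + n) := by
  unfold MachineSteps at *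
  rw [add_comm, Function.iterate_add_apply, h₁, h₂]

theorem MachineSteps.one {O Λ : Type} {M : Λ → MachineStmt O Λ} {l : Λ} {v : Option Cell}
    {S : ∀ k : Tape, List (k.Alphabet O)} {q : MachineStmt O Λ}
    {c : Turing.TM2.Cfg (Tape.Alphabet O) Λ (Option Cell)} (hq : M l = q)
    (h : Turing.TM2.stepAux q v S = c) : MachineSteps M ⟨some l, v, S⟩ c 1 := by
  subst hq h
  rfl

theorem MachineSteps.branch_true {O Λ : Type} {M : Λ → MachineStmt O Λ} {l l' : Λ}
    {v : Option Cell} {S : ∀ k : Tape, List (k.Alphabet O)} {c : Option Cell → Bool}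
    {q : MachineStmt O Λ} (hq : M l = .branch c (.goto fun _ => l') q) (hc : c v = true) :
    MachineSteps M ⟨some l, v, S⟩ ⟨some l', v, S⟩ 1 :=
  .one hq (by simp [hc])

theorem MachineSteps.branch_false {O Λ : Type} {M : Λ → MachineStmt O Λ} {l l' : Λ}
    {v : Option Cell} {S : ∀ k : Tape, List (k.Alphabet O)} {c : Option Cell → Bool}
    {q : MachineStmt O Λ} (hq : M l = .branch c q (.goto fun _ => l')) (hc : c v = false) :
    MachineSteps M ⟨some l, v, S⟩ ⟨some l', v, S⟩ 1 :=
  .one hq (by simp [hc])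

/-- Induction on the execution. The statement quantifies over all machines that contain the code of
the program at the places `emb`, so that the induction hypotheses for subprograms apply inside the
larger machine. Every instruction and every test has its own label and thus takes exactly one
machine step. -/
theorem Exec.machineSteps {O : Type} {p : Prog O} {s s' : Store O} {n : ℕ} (h : Exec p s s' n) :
    ∀ {Λ : Type} (M : Λ → MachineStmt O Λ) (emb : p.Label → Λ) (exit : Λ),
      (∀ l, M (emb l) = p.code emb exit l) →
      MachineSteps M ⟨some (emb p.entry), s.reg, s.stk⟩ ⟨some exit, s'.reg, s'.stk⟩ n := by
  induction h with
  | op i s =>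
    intro Λ M emb exit hM
    exact .one (hM ()) (i.stepAux_stmt _ s)
  | seq h₁ h₂ ih₁ ih₂ =>
    intro Λ M emb exit hM
    exact (ih₁ M _ _ fun l => hM (.inl l)).trans (ih₂ M _ _ fun l => hM (.inr l))
  | ite_true hc h ih =>
    intro Λ M emb exit hM
    exact (MachineSteps.branch_true (hM none) hc).trans
      (ih M _ _ fun l => hM (some (.inl l)))
  | ite_false hc h ih =>
    intro Λ M emb exit hM
    exact (MachineSteps.branch_false (hM none) hc).trans
      (ih M _ _ fun l => hM (some (.inr l)))
  | loop_done h hc ih =>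
    intro Λ M emb exit hM
    exact (ih M _ _ fun l => hM (some (.inl l))).trans (.branch_false (hM none) hc)
  | loop_next h hc h₁ h₂ ih ih₁ ih₂ =>
    intro Λ M emb exit hM
    exact (((ih M _ _ fun l => hM (some (.inl l))).trans
      (.branch_true (hM none) hc)).trans (ih₁ M _ _ fun l => hM (some (.inr l)))).trans
      (ih₂ M emb exit hM)

/-- The initial store. -/
def Store.start {O : Type} (x : List Letter) : Store O := ⟨none, x, [], [], [], [], []⟩

/-- The final store. -/
def Store.finish {O : Type} (y : List O) : Store O := ⟨none, [], [], [], [], [], y⟩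

/-- The Turing machine of a program. -/
def Prog.machine {O : Type} (p : Prog O) : Turing.TM2ComputableAux Letter O where
  tm :=
    letI := p.labelFintype
    { K := Tape
      k₀ := .inp
      k₁ := .out
      Γ := Tape.Alphabet O
      Λ := Option p.Label
      main := some p.entry
      σ := Option Cell
      initialState := none
      Γk₀Fin := inferInstanceAs (Fintype Letter)
      -- The label `none` is the exit of the whole program; halting there costs one extra step.
      m := fun l => match l with
        | none => .halt
        | some l => p.code some none l }
  inputAlphabet := Equiv.refl _
  outputAlphabet := Equiv.refl _

/-- The output convention for Turing machines requires the register to be in its initial state and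
every stack but the output to be empty at the end. This is `Store.finish`, and the reason why
programs clean up after themselves. -/
theorem Exec.runsInTime {O : Type} {p : Prog O} {x : List Letter} {y : List O} {n t : ℕ}
    (h : Exec p (.start x) (.finish y) n) (ht : n + 1 ≤ t) : RunsInTime p.machine x y t := by
  have key := h.machineSteps p.machine.tm.m some none fun l => rfl
  have last : MachineSteps p.machine.tm.m
      ⟨some none, (Store.finish y).reg, (Store.finish y).stk⟩
      ⟨none, (Store.finish y).reg, (Store.finish y).stk⟩ 1 := rfl
  have hx : Turing.initList p.machine.tm (x.map p.machine.inputAlphabet.symm) =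
      ⟨some (some p.entry), (Store.start (O := O) x).reg, (Store.start x).stk⟩ := by
    have : x.map p.machine.inputAlphabet.symm = x := List.map_id x
    rw [this]
    refine congrArg (Turing.TM2.Cfg.mk _ _) (funext fun k => ?_)
    rcases k with _ | k | _ <;> try cases k
    all_goals rfl
  have hy : Turing.haltList p.machine.tm (y.map p.machine.outputAlphabet.symm) =
      ⟨none, (Store.finish y).reg, (Store.finish y).stk⟩ := by
    have : y.map p.machine.outputAlphabet.symm = y := List.map_id y
    rw [this]
    refine congrArg (Turing.TM2.Cfg.mk _ _) (funext fun k => ?_)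
    rcases k with _ | k | _ <;> try cases k
    all_goals rfl
  refine ⟨⟨⟨n + 1, ?_⟩, ht⟩⟩
  rw [hx, Option.map_some, hy]
  exact key.trans last

/-! ### Running times as upper bounds -/

/-- `Runs p s s' n`: the program `p`, started in the store `s`, ends in the store `s'` after at
most `n` steps. -/
def Runs {O : Type} (p : Prog O) (s s' : Store O) (n : ℕ) : Prop := ∃ m ≤ n, Exec p s s' m

namespace Runs

variable {O : Type} {p q pre body : Prog O} {s s₁ s₂ s₃ s₄ : Store O} {c : Option Cell → Bool}
  {l m n t : ℕ}

theorem mono (h : Runs p s s₁ m) (hn : m ≤ n) : Runs p s s₁ n :=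
  h.imp fun _ hk => ⟨hk.1.trans hn, hk.2⟩

theorem op (i : Instr O) (h : i.run s = s₁) (ht : 1 ≤ t) : Runs (.op i) s s₁ t :=
  h ▸ ⟨1, ht, .op i s⟩

theorem seq (h₁ : Runs p s₁ s₂ m) (h₂ : Runs q s₂ s₃ n) (ht : m + n ≤ t) :
    Runs (.seq p q) s₁ s₃ t := by
  obtain ⟨a, ha, h₁⟩ := h₁
  obtain ⟨b, hb, h₂⟩ := h₂
  exact ⟨_, by omega, h₁.seq h₂⟩

/-- An instruction followed by a program. -/
theorem cons (i : Instr O) (h : i.run s₁ = s₂) (h₂ : Runs q s₂ s₃ n) (ht : n + 1 ≤ t) :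
    Runs (.seq (.op i) q) s₁ s₃ t :=
  (op i h le_rfl).seq h₂ (by omega)

theorem ite_true (hc : c s₁.reg = true) (h : Runs p s₁ s₂ m) (ht : m + 1 ≤ t) :
    Runs (.ite c p q) s₁ s₂ t := by
  obtain ⟨a, ha, h⟩ := h
  exact ⟨_, by omega, .ite_true hc h⟩

theorem ite_false (hc : c s₁.reg = false) (h : Runs q s₁ s₂ m) (ht : m + 1 ≤ t) :
    Runs (.ite c p q) s₁ s₂ t := by
  obtain ⟨a, ha, h⟩ := h
  exact ⟨_, by omega, .ite_false hc h⟩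

theorem loop_done (h : Runs pre s₁ s₂ m) (hc : c s₂.reg = false) (ht : m + 1 ≤ t) :
    Runs (.loop pre c body) s₁ s₂ t := by
  obtain ⟨a, ha, h⟩ := h
  exact ⟨_, by omega, .loop_done h hc⟩

theorem loop_next (h : Runs pre s₁ s₂ m) (hc : c s₂.reg = true) (h₁ : Runs body s₂ s₃ n)
    (h₂ : Runs (.loop pre c body) s₃ s₄ l) (ht : m + n + l + 1 ≤ t) :
    Runs (.loop pre c body) s₁ s₄ t := by
  obtain ⟨a, ha, h⟩ := h
  obtain ⟨b, hb, h₁⟩ := h₁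
  obtain ⟨d, hd, h₂⟩ := h₂
  exact ⟨_, by omega, .loop_next h hc h₁ h₂⟩

end Runs

/-! ### Trees on stacks -/

/-- Binary trees with letters at the leaves. -/
inductive Sexp
  | atom (x : Letter)
  | cons (a b : Sexp)

/-- The code of a tree: its nodes in preorder. -/
def Sexp.code : Sexp → List Cell
  | atom x => [.leaf x]
  | cons a b => .node :: (a.code ++ b.code)

/-- The size of a tree: twice the number of its leaves. -/
def Sexp.size : Sexp → ℕ
  | atom _ => 2
  | cons a b => a.size + b.size

@[simp] theorem Sexp.size_atom (x : Letter) : (Sexp.atom x).size = 2 := rfl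

@[simp] theorem Sexp.size_cons (a b : Sexp) : (Sexp.cons a b).size = a.size + b.size := rfl

theorem Sexp.two_le_size : ∀ t : Sexp, 2 ≤ t.size
  | atom _ => le_rfl
  | cons a b => by have := a.two_le_size; have := b.two_le_size; simp; omega

/-- A binary tree has one more leaf than it has inner nodes. -/
theorem Sexp.length_code : ∀ t : Sexp, t.code.length + 1 = t.size
  | atom _ => rfl
  | cons a b => by have := a.length_code; have := b.length_code; simp [code]; omega

/-- The first symbol of the code of a tree. -/
def Sexp.top : Sexp → Cell
  | atom x => .leaf x
  | cons _ _ => .node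

theorem Sexp.code_eq_top_cons (t : Sexp) : ∃ l, t.code = t.top :: l := by
  cases t <;> simp [code, top]

namespace Prog

variable {O : Type}

/-- Moves a tree from the main stack to the stack `copy`, where its code is reversed. -/
def take : Prog O :=
  -- The stack `count` holds one mark for every subtree still to be read: a node exchanges its mark
  -- for two, a leaf just uses it up.
  seq (.op (.push .count fun _ => .mark)) <|
    .loop (.op (.pop .count)) (· = some .mark) <|
      seq (.op (.pop .main)) <| seq (.op (.push .copy (·.getD .mark))) <|
        .ite (· = some .node)
          (seq (.op (.push .count fun _ => .mark)) (.op (.push .count fun _ => .mark)))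
          (.op .clear)

/-- Empties the stack `copy`, with the program `e` executed for every symbol. -/
def drain (e : Prog O) : Prog O := .loop (.op (.pop .copy)) (·.isSome) e

/-- Removes a tree from the main stack. -/
def drop : Prog O := seq take (drain (.op .clear))

/-- Copies a tree from the main stack to the stack `save`. -/
def dup : Prog O :=
  seq take <| seq (.op (.push .save fun _ => .mark)) <|
    drain (seq (.op (.push .save (·.getD .mark))) (.op (.push .main (·.getD .mark))))

/-- Moves a tree from the main stack to the stack `save`. -/
def store : Prog O :=
  seq take <| seq (.op (.push .save fun _ => .mark)) <|
    drain (.op (.push .save (·.getD .mark)))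

/-- Moves a tree from the stack `save` to the main stack. -/
def restore : Prog O :=
  seq (.loop (.op (.pop .save)) (· ≠ some .mark) (.op (.push .copy (·.getD .mark)))) <|
    drain (.op (.push .main (·.getD .mark)))

end Prog

section

variable {O : Type} {inp : List Letter} {ma sv ct cp : List Cell} {out : List O}

theorem runs_take (t : Sexp) :
    Runs Prog.take ⟨none, inp, t.code ++ ma, sv, [], cp, out⟩
      ⟨none, inp, ma, sv, [], t.code.reverse ++ cp, out⟩ (7 * t.size + 3) := by
  refine Runs.cons (n := 2 + 7 * t.size) _ rfl ?_ (by omega)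
  -- In continuation style: whatever the loop does after `t` within `n` steps, it does from before
  -- `t` with at most `7` more steps per symbol. This lets the two subtrees of a node be chained in
  -- the induction.
  have key : ∀ (t : Sexp) (ma ct cp : List Cell) (s' : Store O) (n : ℕ),
      (∀ r, Runs (.loop (.op (.pop .count)) (· = some .mark) <|
        .seq (.op (.pop .main)) <| .seq (.op (.push .copy (·.getD .mark))) <|
          .ite (· = some .node)
            (.seq (.op (.push .count fun _ => .mark)) (.op (.push .count fun _ => .mark)))
            (.op .clear)) ⟨r, inp, ma, sv, ct, t.code.reverse ++ cp, out⟩ s' n) →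
      ∀ r, Runs (.loop (.op (.pop .count)) (· = some .mark) <|
        .seq (.op (.pop .main)) <| .seq (.op (.push .copy (·.getD .mark))) <|
          .ite (· = some .node)
            (.seq (.op (.push .count fun _ => .mark)) (.op (.push .count fun _ => .mark)))
            (.op .clear)) ⟨r, inp, t.code ++ ma, sv, .mark :: ct, cp, out⟩ s'
            (n + 7 * t.code.length) := by
    intro t
    induction t with
    | atom x =>
      intro ma ct cp s' n h r
      refine Runs.loop_next (.op _ rfl le_rfl) (by simp [Instr.run]) (.cons _ rfl (.cons _ rfl
        (.ite_false (by simp [Instr.run, Sexp.code]) (.op _ rfl le_rfl) le_rfl) le_rfl) le_rfl)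
        (h none) (by simp [Sexp.code]; omega)
    | cons a b iha ihb =>
      intro ma ct cp s' n h r
      refine Runs.loop_next (.op _ rfl le_rfl) (by simp [Instr.run]) (.cons _ rfl (.cons _ rfl
        (.ite_true (by simp [Instr.run, Sexp.code])
          (.cons _ rfl (.op _ rfl le_rfl) le_rfl) le_rfl) le_rfl) le_rfl)
        (l := n + 7 * b.code.length + 7 * a.code.length) ?_ ?_
      · have := iha (b.code ++ ma) (.mark :: ct) (.node :: cp) s' _
          (ihb ma ct (a.code.reverse ++ .node :: cp) s' n (by simpa [Sexp.code] using h))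
        simpa [Sexp.code, Instr.run] using this (some .node)
      · simp [Sexp.code]; omega
  have := t.length_code
  exact (key t ma [] cp _ 2
    (fun r => .loop_done (.op _ rfl le_rfl) (by simp) le_rfl) none).mono (by omega)

/-- One statement for dropping, copying and moving: `f` and `g` say what each symbol contributes to
the stacks `main` and `save`. Draining reverses the order and so undoes the reversal on `copy`. -/
theorem runs_drain {e : Prog O} {f g : Cell → List Cell} {k : ℕ}
    (he : ∀ (x : Cell) (ma sv cp : List Cell), ∃ r, Runs e ⟨some x, inp, ma, sv, ct, cp, out⟩
      ⟨r, inp, f x ++ ma, g x ++ sv, ct, cp, out⟩ k) (l : List Cell) :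
    ∀ (r : Option Cell) (ma sv : List Cell),
      Runs (Prog.drain e) ⟨r, inp, ma, sv, ct, l, out⟩
        ⟨none, inp, l.reverse.flatMap f ++ ma, l.reverse.flatMap g ++ sv, ct, [], out⟩
        ((k + 2) * (l.length + 1)) := by
  induction l with
  | nil =>
    intro r ma sv
    exact .loop_done (.op _ rfl le_rfl) (by simp) (by simp)
  | cons x l ih =>
    intro r ma sv
    obtain ⟨r', h⟩ := he x ma sv l
    refine .loop_next (.op _ rfl le_rfl) (by simp [Instr.run]) h (l := (k + 2) * (l.length + 1)) ?_
      (by simp only [List.length_cons]; ring_nf; omega)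
    simpa [Prog.drain] using ih r' (f x ++ ma) (g x ++ sv)

theorem flatMap_empty (l : List Cell) : l.flatMap (fun _ => ([] : List Cell)) = [] := by simp

theorem runs_drop (t : Sexp) :
    Runs Prog.drop ⟨none, inp, t.code ++ ma, sv, [], [], out⟩
      ⟨none, inp, ma, sv, [], [], out⟩ (12 * t.size) := by
  have := t.length_code
  refine (runs_take t).seq (n := 3 * t.size) ?_ (by have := t.two_le_size; omega)
  have h := runs_drain (inp := inp) (ct := []) (out := out) (e := .op .clear)
    (f := fun _ => []) (g := fun _ => []) (k := 1)
    (fun x ma sv cp => ⟨none, .op _ rfl le_rfl⟩) t.code.reverse none ma sv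
  exact Runs.mono (by simpa [flatMap_empty] using h) (by simp; omega)

theorem runs_dup (t : Sexp) :
    Runs Prog.dup ⟨none, inp, t.code ++ ma, sv, [], [], out⟩
      ⟨none, inp, t.code ++ ma, t.code ++ .mark :: sv, [], [], out⟩ (13 * t.size) := by
  have := t.length_code
  refine (runs_take t).seq (n := 4 * t.size + 1) ?_ (by have := t.two_le_size; omega)
  refine Runs.cons _ rfl (n := 4 * t.size) ?_ (by omega)
  have h := runs_drain (inp := inp) (ct := []) (out := out)
    (e := .seq (.op (.push .save (·.getD .mark))) (.op (.push .main (·.getD .mark))))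
    (f := fun x => [x]) (g := fun x => [x]) (k := 2)
    (fun x ma sv cp => ⟨some x, .cons _ rfl (.op _ rfl le_rfl) le_rfl⟩)
    t.code.reverse none ma (.mark :: sv)
  exact Runs.mono (by simpa [Instr.run, flatMap_empty] using h) (by simp; omega)

theorem runs_store (t : Sexp) :
    Runs Prog.store ⟨none, inp, t.code ++ ma, sv, [], [], out⟩
      ⟨none, inp, ma, t.code ++ .mark :: sv, [], [], out⟩ (12 * t.size) := by
  have := t.length_code
  refine (runs_take t).seq (n := 3 * t.size + 1) ?_ (by have := t.two_le_size; omega)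
  refine Runs.cons _ rfl (n := 3 * t.size) ?_ (by omega)
  have h := runs_drain (inp := inp) (ct := []) (out := out)
    (e := .op (.push .save (·.getD .mark))) (f := fun _ => []) (g := fun x => [x]) (k := 1)
    (fun x ma sv cp => ⟨some x, .op _ rfl le_rfl⟩) t.code.reverse none ma (.mark :: sv)
  exact Runs.mono (by simpa [Instr.run, flatMap_empty] using h) (by simp; omega)

/-- This is why a mark can delimit the trees on the stack `save`. -/
theorem Sexp.mark_notMem_code (t : Sexp) : Cell.mark ∉ t.code := by
  induction t <;> simp_all [code]

theorem runs_restore (t : Sexp) :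
    Runs Prog.restore ⟨none, inp, ma, t.code ++ .mark :: sv, [], [], out⟩
      ⟨none, inp, t.code ++ ma, sv, [], [], out⟩ (7 * t.size) := by
  have hlen := t.length_code
  have key : ∀ (l cp : List Cell) (r : Option Cell), .mark ∉ l →
      Runs (.loop (.op (.pop .save)) (· ≠ some .mark) (.op (.push .copy (·.getD .mark))))
      ⟨r, inp, ma, l ++ .mark :: sv, [], cp, out⟩
      ⟨some .mark, inp, ma, sv, [], l.reverse ++ cp, out⟩ (3 * l.length + 2) := by
    intro l
    induction l with
    | nil =>
      intro cp r _
      exact .loop_done (.op _ rfl le_rfl) (by simp) le_rfl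
    | cons x l ih =>
      intro cp r hl
      simp only [List.mem_cons, not_or] at hl
      refine .loop_next (.op _ rfl le_rfl) ?_ (.op _ rfl le_rfl) (l := 3 * l.length + 2) ?_
        (by simp; omega)
      · simpa [Instr.run] using fun h => hl.1 h.symm
      · simpa [Instr.run] using ih (x :: cp) (some x) hl.2
  refine (key t.code [] none t.mark_notMem_code).seq (n := 3 * t.size) ?_ (by omega)
  have h := runs_drain (inp := inp) (ct := []) (out := out)
    (e := .op (.push .main (·.getD .mark))) (f := fun x => [x]) (g := fun _ => []) (k := 1)
    (fun x ma sv cp => ⟨some x, .op _ rfl le_rfl⟩) t.code.reverse (some .mark) ma sv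
  exact Runs.mono (by simpa [flatMap_empty] using h) (by simp; omega)

end

/-! ### Programs that transform the tree on top of the main stack -/

/-- The program `p` replaces the tree `x` at the top of the main stack by the tree `y`, in at most
`n` steps. -/
def Maps {O : Type} (p : Prog O) (x y : Sexp) (n : ℕ) : Prop :=
  ∀ (inp : List Letter) (ma sv : List Cell) (out : List O),
    Runs p ⟨none, inp, x.code ++ ma, sv, [], [], out⟩ ⟨none, inp, y.code ++ ma, sv, [], [], out⟩ n

namespace Prog

variable {O : Type}

/-- Adds a leaf to the main stack. -/
def pushLeaf (x : Letter) : Prog O := .op (.push .main fun _ => .leaf x)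

/-- Replaces a tree by a leaf. -/
def const (x : Letter) : Prog O := seq drop (pushLeaf x)

/-- Replaces a tree by the pair of the results of two programs. -/
def pair (p q : Prog O) : Prog O :=
  -- The second component is computed first, so that the first one ends up on top, as in the
  -- preorder code of a pair.
  seq dup <| seq q <| seq restore <| seq p <| .op (.push .main fun _ => .node)

/-- Replaces a pair by its second component. -/
def tl : Prog O := seq (.op (.pop .main)) <| seq (.op .clear) drop

/-- Replaces a pair by its first component. -/
def hd : Prog O :=
  seq (.op (.pop .main)) <| seq (.op .clear) <| seq store <| seq drop restore

/-- Loads the first symbol of the first component of a pair into the register. -/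
def peekHd : Prog O :=
  seq (.op (.pop .main)) <| seq (.op (.pop .main)) <| seq (.op (.push .main (·.getD .mark)))
    (.op (.push .main fun _ => .node))

/-- Branching on the first symbol of the first component of a pair. -/
def iteHd (c : Cell → Bool) (p q : Prog O) : Prog O :=
  seq peekHd (.ite (·.any c) (seq (.op .clear) p) (seq (.op .clear) q))

/-- Repeats a program as long as the first component of the pair is not a leaf. -/
def loopHd (p : Prog O) : Prog O :=
  seq (.loop peekHd (· = some .node) (seq (.op .clear) p)) (.op .clear)

end Prog

namespace Maps

variable {O : Type} {p q : Prog O} {x y z a b : Sexp} {l m n t : ℕ}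

theorem mono (h : Maps p x y m) (hn : m ≤ n) : Maps p x y n :=
  fun inp ma sv out => (h inp ma sv out).mono hn

theorem skip : Maps (O := O) (.op .clear) x x 1 := fun _ _ _ _ => .op _ rfl le_rfl

theorem seq (h₁ : Maps p x y m) (h₂ : Maps q y z n) : Maps (.seq p q) x z (m + n) :=
  fun inp ma sv out => (h₁ inp ma sv out).seq (h₂ inp ma sv out) le_rfl

theorem const (u : Letter) : Maps (O := O) (.const u) x (.atom u) (12 * x.size + 1) :=
  fun _ _ _ _ => (runs_drop x).seq (.op _ rfl le_rfl) le_rfl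

theorem pair (h₁ : Maps p x y m) (h₂ : Maps q x z n) :
    Maps (.pair p q) x (.cons y z) (m + n + 20 * x.size + 1) := by
  intro inp ma sv out
  -- The constant `20` is `13` for copying plus `7` for restoring.
  refine (runs_dup x).seq ((h₂ _ _ _ _).seq ((runs_restore x).seq ((h₁ _ _ _ _).seq
    (.op _ ?_ le_rfl) le_rfl) le_rfl) le_rfl) (by omega)
  simp [Instr.run, Sexp.code]

theorem tl : Maps (O := O) .tl (.cons a b) b (12 * a.size + 2) := by
  intro inp ma sv out
  refine .cons _ rfl (.cons _ rfl ?_ le_rfl) le_rfl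
  simpa [Instr.run, Sexp.code] using runs_drop a

theorem hd : Maps (O := O) .hd (.cons a b) a (19 * a.size + 12 * b.size + 2) := by
  intro inp ma sv out
  refine .cons _ rfl (.cons _ rfl (n := 19 * a.size + 12 * b.size) ?_ le_rfl) le_rfl
  refine Runs.seq (by simpa [Instr.run, Sexp.code] using runs_store a)
    ((runs_drop b).seq (runs_restore a) le_rfl) (by omega)

theorem runs_peekHd {inp : List Letter} {ma sv : List Cell} {out : List O} (r : Option Cell) :
    Runs Prog.peekHd ⟨r, inp, (Sexp.cons a b).code ++ ma, sv, [], [], out⟩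
      ⟨some a.top, inp, (Sexp.cons a b).code ++ ma, sv, [], [], out⟩ 4 := by
  obtain ⟨l, hl⟩ := a.code_eq_top_cons
  refine .cons _ rfl (.cons _ rfl (.cons _ rfl (.op _ ?_ le_rfl) le_rfl) le_rfl) le_rfl
  simp [Instr.run, Sexp.code, hl]

theorem iteHd_true {c : Cell → Bool} (hc : c a.top = true) (h : Maps p (.cons a b) y m) :
    Maps (.iteHd c p q) (.cons a b) y (m + 6) := fun _ _ _ _ =>
  (runs_peekHd none).seq (.ite_true (by simpa using hc) (.cons _ rfl (h _ _ _ _) le_rfl) le_rfl)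
    (by omega)

theorem iteHd_false {c : Cell → Bool} (hc : c a.top = false) (h : Maps q (.cons a b) y m) :
    Maps (.iteHd c p q) (.cons a b) y (m + 6) := fun _ _ _ _ =>
  (runs_peekHd none).seq (.ite_false (by simpa using hc) (.cons _ rfl (h _ _ _ _) le_rfl) le_rfl)
    (by omega)

/-- Iterating a program along a sequence of trees. -/
theorem loopHd {k : ℕ} (x : ℕ → Sexp) (t : ℕ) (hp : ∀ i < k, Maps p (x i) (x (i + 1)) t)
    (hx : ∀ i < k, ∃ a b c, x i = .cons (.cons a b) c) (hk : ∃ u b, x k = .cons (.atom u) b) :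
    Maps (.loopHd p) (x 0) (x k) (k * (t + 6) + 6) := by
  intro inp ma sv out
  -- Induction on the number `i` of rounds that remain. The register keeps the last symbol
  -- inspected, which is the second symbol of the code of `x k`.
  have key : ∀ i ≤ k, Runs (.loop .peekHd (· = some .node) (.seq (.op .clear) p))
      ⟨none, inp, (x (k - i)).code ++ ma, sv, [], [], out⟩
      ⟨(x k).code.tail.head?, inp, (x k).code ++ ma, sv, [], [], out⟩ (i * (t + 6) + 5) := by
    intro i
    induction i with
    | zero =>
      intro _
      obtain ⟨u, b, h⟩ := hk
      simp only [Nat.sub_zero, h]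
      exact .loop_done (runs_peekHd none) (by simp [Sexp.code]) (by simp)
    | succ i ih =>
      intro hi
      obtain ⟨a, b, c, h⟩ := hx (k - (i + 1)) (by omega)
      have hp' := hp (k - (i + 1)) (by omega)
      rw [show k - (i + 1) + 1 = k - i by omega] at hp'
      rw [h] at hp' ⊢
      exact .loop_next (runs_peekHd none) (by simp [Sexp.top])
        (.cons _ rfl (hp' _ _ _ _) le_rfl) (ih (by omega)) (by ring_nf; omega)
  have := key k le_rfl
  rw [Nat.sub_self] at this
  exact this.seq (.op _ rfl le_rfl) le_rfl

end Maps

/-! ### Input and output -/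

/-- The list of letters as a tree. -/
def Sexp.ofList : List Letter → Sexp
  | [] => .atom (.inr false)
  | x :: l => .cons (.atom x) (ofList l)

namespace Prog

variable {O : Type}

/-- A program on trees between the conversion of the input into a tree and of a tree into the
output. -/
def main (g : Letter → O) (p : Prog O) : Prog O :=
  seq (pushLeaf (.inr false)) <|
  seq (.loop (.op .read) (·.isSome) (seq (.op (.push .main (·.getD .mark)))
    (.op (.push .main fun _ => .node)))) <|
  seq p <|
  seq (.loop (.op (.pop .main)) (· = some .node) (seq (.op (.pop .main))
    (.op (.write fun r => match r with | some (.leaf x) => g x | _ => g (.inr false)))))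
  (.op .clear)

end Prog

/-- Moving a string from one stack to another reverses it. Hence the program on trees sees the
reversed input and has to deliver the reversed output. -/
theorem Maps.runsInTime_main {O : Type} {g : Letter → O} {p : Prog O} {x y : List Letter} {n : ℕ}
    (h : Maps p (.ofList x.reverse) (.ofList y.reverse) n) {t : ℕ}
    (ht : n + 4 * x.length + 4 * y.length + 10 ≤ t) :
    RunsInTime (Prog.main g p).machine x (y.map g) t := by
  have hin : ∀ (l m : List Letter) (r : Option Cell), Runs (O := O)
      (.loop (.op .read) (·.isSome) (.seq (.op (.push .main (·.getD .mark)))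
        (.op (.push .main fun _ => .node))))
      ⟨r, l, (Sexp.ofList m).code, [], [], [], []⟩
      ⟨none, [], (Sexp.ofList (l.reverse ++ m)).code, [], [], [], []⟩ (4 * l.length + 2) := by
    intro l
    induction l with
    | nil =>
      intro m r
      exact .loop_done (.op _ rfl le_rfl) (by simp) le_rfl
    | cons u l ih =>
      intro m r
      refine .loop_next (.op _ rfl le_rfl) (by simp [Instr.run])
        (.cons _ rfl (.op _ rfl le_rfl) le_rfl) (l := 4 * l.length + 2) ?_ (by simp; omega)
      simpa [Instr.run, Sexp.ofList, Sexp.code] using ih (u :: m) (some (.leaf u))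
  have hout : ∀ (l : List Letter) (m : List O) (r : Option Cell), Runs (O := O)
      (.loop (.op (.pop .main)) (· = some .node) (.seq (.op (.pop .main))
        (.op (.write fun r => match r with | some (.leaf x) => g x | _ => g (.inr false)))))
      ⟨r, [], (Sexp.ofList l).code, [], [], [], m⟩
      ⟨some (.leaf (.inr false)), [], [], [], [], [], l.reverse.map g ++ m⟩
      (4 * l.length + 2) := by
    intro l
    induction l with
    | nil =>
      intro m r
      exact .loop_done (.op _ rfl le_rfl) (by simp) le_rfl
    | cons u l ih =>
      intro m r
      refine .loop_next (.op _ rfl le_rfl) (by simp [Instr.run, Sexp.code, Sexp.ofList])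
        (.cons _ rfl (.op _ rfl le_rfl) le_rfl) (l := 4 * l.length + 2) ?_ (by simp; omega)
      simpa [Instr.run, Sexp.ofList, Sexp.code] using ih (g u :: m) (some (.leaf u))
  have h₁ := hin x [] none
  have h₂ := h [] [] [] []
  have h₃ := hout y.reverse [] none
  simp only [List.append_nil, List.reverse_reverse, List.length_reverse] at h₁ h₂ h₃
  have : Runs (Prog.main g p) (.start x) (.finish (y.map g)) (n + 4 * x.length + 4 * y.length + 9) :=
    .cons _ rfl (h₁.seq (h₂.seq (h₃.seq (.op _ rfl le_rfl) le_rfl) le_rfl) le_rfl) (by omega)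
  obtain ⟨k, hk, h⟩ := this
  exact h.runsInTime (by omega)

/-! ### Polynomial time functions between types of trees -/

/-- Types whose elements are represented by trees. -/
class TreeEnc (α : Type) where
  tree : α → Sexp

open TreeEnc (tree)

instance : TreeEnc Letter := ⟨.atom⟩

instance : TreeEnc Γ' := ⟨fun g => .atom (.inl g)⟩

instance : TreeEnc Bool := ⟨fun b => .atom (.inr b)⟩

instance {α β : Type} [TreeEnc α] [TreeEnc β] : TreeEnc (α × β) := ⟨fun x => .cons (tree x.1) (tree x.2)⟩

/-- The tree of a list. -/
def listTree {α : Type} [TreeEnc α] : List α → Sexp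
  | [] => .atom (.inr false)
  | a :: l => .cons (tree a) (listTree l)

instance {α : Type} [TreeEnc α] : TreeEnc (List α) := ⟨listTree⟩

/-- The size of the tree of an element. -/
def sz {α : Type} [TreeEnc α] (a : α) : ℕ := (tree a).size

section Size

variable {α β : Type} [TreeEnc α] [TreeEnc β]

theorem two_le_sz (a : α) : 2 ≤ sz a := (tree a).two_le_size

@[simp] theorem sz_prod (a : α) (b : β) : sz (a, b) = sz a + sz b := rfl

@[simp] theorem sz_nil : sz ([] : List α) = 2 := rfl

@[simp] theorem sz_cons (a : α) (l : List α) : sz (a :: l) = sz a + sz l := rfl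

@[simp] theorem sz_bool (b : Bool) : sz b = 2 := rfl

@[simp] theorem sz_symbol (g : Γ') : sz g = 2 := rfl

@[simp] theorem sz_letter (x : Letter) : sz x = 2 := rfl

theorem sz_list (l : List α) : sz l = (l.map sz).sum + 2 := by
  induction l with
  | nil => rfl
  | cons a l ih => simp [ih, add_assoc]

@[simp] theorem sz_append (l l' : List α) : sz (l ++ l') + 2 = sz l + sz l' := by
  simp [sz_list]; omega

@[simp] theorem sz_reverse (l : List α) : sz l.reverse = sz l := by
  simp [sz_list, List.sum_reverse]

theorem sz_le_of_sublist {l l' : List α} (h : l.Sublist l') : sz l ≤ sz l' := by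
  simp only [sz_list]
  exact Nat.add_le_add_right ((h.map sz).sum_le_sum (by simp)) 2

theorem two_mul_length_le_sz (l : List α) : 2 * l.length + 2 ≤ sz l := by
  induction l with
  | nil => simp
  | cons a l ih => have := two_le_sz a; simp; omega

theorem sz_le_of_mem {a : α} {l : List α} (h : a ∈ l) : sz a ≤ sz l := by
  rw [sz_list]
  exact (List.single_le_sum (by simp) _ (List.mem_map_of_mem h)).trans (by omega)

theorem sz_list_le {l : List α} {m : ℕ} (h : ∀ a ∈ l, sz a ≤ m) : sz l ≤ l.length * m + 2 := by
  rw [sz_list]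
  have := List.sum_le_card_nsmul (l.map sz) m (by simpa using h)
  simpa using this

end Size

/-! ### Polynomial bounds -/

/-- The function `g` is bounded by a power of the size. -/
def PolyBound {α : Type} [TreeEnc α] (g : α → ℕ) : Prop := ∃ c, ∀ a, g a ≤ sz a ^ c

namespace PolyBound

variable {α β : Type} [TreeEnc α] [TreeEnc β] {f g : α → ℕ}

theorem mono (hg : PolyBound g) (h : ∀ a, f a ≤ g a) : PolyBound f :=
  hg.imp fun _ hc a => (h a).trans (hc a)

theorem size : PolyBound (sz : α → ℕ) := ⟨1, fun a => by simp⟩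

/-- Sizes are at least `2`, so `n ≤ 2 ^ n` bounds a constant by a pure power; in the same way a sum
costs only one more factor. -/
theorem const (n : ℕ) : PolyBound fun _ : α => n :=
  ⟨n, fun a => Nat.lt_two_pow_self.le.trans (Nat.pow_le_pow_left (two_le_sz a) n)⟩

theorem mul (hf : PolyBound f) (hg : PolyBound g) : PolyBound fun a => f a * g a := by
  obtain ⟨c, hc⟩ := hf
  obtain ⟨d, hd⟩ := hg
  exact ⟨c + d, fun a => (Nat.mul_le_mul (hc a) (hd a)).trans_eq (pow_add _ _ _).symm⟩

theorem add (hf : PolyBound f) (hg : PolyBound g) : PolyBound fun a => f a + g a := by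
  obtain ⟨c, hc⟩ := hf
  obtain ⟨d, hd⟩ := hg
  refine ⟨c + d + 1, fun a => ?_⟩
  have h₁ := Nat.pow_le_pow_right (n := sz a) (by have := two_le_sz a; omega)
    (Nat.le_add_right c d)
  have h₂ := Nat.pow_le_pow_right (n := sz a) (by have := two_le_sz a; omega)
    (Nat.le_add_left d c)
  calc f a + g a ≤ sz a ^ (c + d) * 2 := by have := hc a; have := hd a; omega
    _ ≤ sz a ^ (c + d) * sz a := Nat.mul_le_mul_left _ (two_le_sz a)

theorem comp {g : β → ℕ} {f : α → β} (hg : PolyBound g) (hf : PolyBound fun a => sz (f a)) :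
    PolyBound fun a => g (f a) := by
  obtain ⟨c, hc⟩ := hf
  obtain ⟨d, hd⟩ := hg
  exact ⟨c * d, fun a => (hd _).trans ((Nat.pow_le_pow_left (hc a) d).trans_eq (pow_mul _ _ _).symm)⟩

/-- A monotone bound of a polynomially bounded function. -/
theorem exists_monotone (hg : PolyBound g) :
    ∃ G : ℕ → ℕ, Monotone G ∧ (∀ a, g a ≤ G (sz a)) ∧
      ∀ {γ : Type} [TreeEnc γ] (h : γ → ℕ), PolyBound h → PolyBound fun x => G (h x) := by
  obtain ⟨c, hc⟩ := hg
  refine ⟨(· ^ c), fun _ _ h => Nat.pow_le_pow_left h c, hc, fun h hh => ?_⟩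
  obtain ⟨d, hd⟩ := hh
  exact ⟨d * c, fun x => (Nat.pow_le_pow_left (hd x) c).trans_eq (pow_mul _ _ _).symm⟩

end PolyBound

/-- The function `f` is computed by a stack program in polynomial time. -/
@[fun_prop]
def PolyTime {α β : Type} [TreeEnc α] [TreeEnc β] (f : α → β) : Prop :=
  (PolyBound fun a => sz (f a)) ∧
    ∃ t : α → ℕ, PolyBound t ∧
      ∀ O : Type, ∃ p : Prog O, ∀ a, Maps p (tree a) (tree (f a)) (t a)

namespace PolyTime

variable {α β γ δ σ : Type} [TreeEnc α] [TreeEnc β] [TreeEnc γ] [TreeEnc δ] [TreeEnc σ]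

theorem bound {f : α → β} (hf : PolyTime f) : PolyBound fun a => sz (f a) := hf.1

/-- A function that does not change the tree. -/
theorem of_tree_eq {f : α → β} (h : ∀ a, tree (f a) = tree a) : PolyTime f :=
  ⟨PolyBound.size.mono fun a => by rw [sz, h, sz],
    fun _ => 1, .const 1, fun _ => ⟨_, fun a => by rw [h]; exact .skip⟩⟩

@[fun_prop]
theorem id : PolyTime (fun a : α => a) := of_tree_eq fun _ => rfl

@[fun_prop]
theorem comp {g : β → γ} {f : α → β} (hg : PolyTime g) (hf : PolyTime f) : PolyTime fun a => g (f a) := by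
  obtain ⟨hfb, s, hs, hf⟩ := hf
  obtain ⟨hgb, t, ht, hg⟩ := hg
  refine ⟨hgb.comp hfb, _, hs.add (ht.comp hfb), fun O => ?_⟩
  obtain ⟨p, hp⟩ := hf O
  obtain ⟨q, hq⟩ := hg O
  exact ⟨_, fun a => (hp a).seq (hq _)⟩

@[fun_prop]
theorem prodMk {f : α → β} {g : α → γ} (hf : PolyTime f) (hg : PolyTime g) : PolyTime fun a => (f a, g a) := by
  obtain ⟨hfb, s, hs, hf⟩ := hf
  obtain ⟨hgb, t, ht, hg⟩ := hg
  refine ⟨hfb.add hgb, _, ((hs.add ht).add ((PolyBound.const 20).mul .size)).add (.const 1),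
    fun O => ?_⟩
  obtain ⟨p, hp⟩ := hf O
  obtain ⟨q, hq⟩ := hg O
  exact ⟨_, fun a => (hp a).pair (hq a)⟩

theorem fst_prod : PolyTime (Prod.fst : α × β → α) := by
  refine ⟨PolyBound.size.mono ?_, _, ((PolyBound.const 19).mul .size).add (.const 2),
    fun O => ⟨.hd, fun a => Maps.hd.mono ?_⟩⟩
  · rintro ⟨a, b⟩; simp
  · obtain ⟨a, b⟩ := a
    change 19 * sz a + 12 * sz b + 2 ≤ _
    simp; omega

theorem snd_prod : PolyTime (Prod.snd : α × β → β) := by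
  refine ⟨PolyBound.size.mono ?_, _, ((PolyBound.const 12).mul .size).add (.const 2),
    fun O => ⟨.tl, fun a => Maps.tl.mono ?_⟩⟩
  · rintro ⟨a, b⟩; simp
  · obtain ⟨a, b⟩ := a
    change 12 * sz a + 2 ≤ _
    simp

@[fun_prop]
theorem fst {f : α → β × γ} (hf : PolyTime f) : PolyTime fun a => (f a).1 := fst_prod.comp hf

@[fun_prop]
theorem snd {f : α → β × γ} (hf : PolyTime f) : PolyTime fun a => (f a).2 := snd_prod.comp hf

@[fun_prop]
theorem const (b : β) : PolyTime fun _ : α => b := by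
  refine ⟨.const _, ?_⟩
  change ∃ t : α → ℕ, PolyBound t ∧ ∀ O : Type, ∃ p : Prog O, ∀ a, Maps p (tree a) (tree b) (t a)
  -- Only the tree of `b` matters, and it is built up leaf by leaf.
  generalize tree b = y
  induction y with
  | atom u =>
    exact ⟨_, ((PolyBound.const 12).mul .size).add (.const 1), fun O => ⟨_, fun a => Maps.const u⟩⟩
  | cons y z ihy ihz =>
    obtain ⟨s, hs, hy⟩ := ihy
    obtain ⟨t, ht, hz⟩ := ihz
    refine ⟨_, ((hs.add ht).add ((PolyBound.const 20).mul .size)).add (.const 1), fun O => ?_⟩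
    obtain ⟨p, hp⟩ := hy O
    obtain ⟨q, hq⟩ := hz O
    exact ⟨_, fun a => (hp a).pair (hq a)⟩

/-- Branching on an element whose tree is a leaf. -/
theorem cases_of_atom {ι : α → Letter} (hι : Function.Injective ι)
    (htree : ∀ a, tree a = .atom (ι a)) {h : α → γ → β} (hh : ∀ a, PolyTime (h a)) (l : List α) :
    ∃ (b : α × γ → ℕ) (t : α × γ → ℕ), PolyBound b ∧ PolyBound t ∧
      (∀ a ∈ l, ∀ x, sz (h a x) ≤ b (a, x)) ∧ ∀ O : Type, ∃ p : Prog O, ∀ a ∈ l, ∀ x,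
      Maps p (tree (a, x)) (tree (h a x)) (t (a, x)) := by
  -- A chain of tests, one for each element of `l`; membership in `l` makes the empty chain vacuous.
  induction l with
  | nil => exact ⟨_, _, .const 0, .const 0, by simp, fun O => ⟨.op .clear, by simp⟩⟩
  | cons a l ih =>
    obtain ⟨b, t, hb, ht, hl, ih⟩ := ih
    obtain ⟨hb', t', ht', hp⟩ := (hh a).comp (snd_prod (α := α))
    refine ⟨_, _, hb.add hb', (ht.add ht').add (.const 6), ?_, fun O => ?_⟩
    · rintro a' ha' x
      rcases List.mem_cons.1 ha' with rfl | ha'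
      · simp
      · exact (hl a' ha' x).trans (by simp)
    · obtain ⟨p, hp⟩ := hp O
      obtain ⟨q, hq⟩ := ih O
      refine ⟨.iteHd (· = .leaf (ι a)) p q, fun a' ha' x => ?_⟩
      by_cases h' : a' = a
      · subst h'
        exact (Maps.iteHd_true (by simp [htree, Sexp.top]) (hp (a', x))).mono (by simp)
      · have := hq a' (by simpa [h'] using ha') x
        exact (Maps.iteHd_false (by simpa [htree, Sexp.top] using hι.ne h') this).mono (by simp)

theorem cases_fintype [Fintype α] {ι : α → Letter} (hι : Function.Injective ι)
    (htree : ∀ a, tree a = .atom (ι a)) {h : α → γ → β} (hh : ∀ a, PolyTime (h a)) :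
    PolyTime fun x : α × γ => h x.1 x.2 := by
  obtain ⟨b, t, hb, ht, hl, ih⟩ := cases_of_atom hι htree hh Finset.univ.toList
  refine ⟨hb.mono fun x => hl x.1 (by simp) x.2, t, ht, fun O => ?_⟩
  obtain ⟨p, hp⟩ := ih O
  exact ⟨p, fun x => hp x.1 (by simp) x.2⟩

theorem letter_cases {h : Letter → γ → β} (hh : ∀ u, PolyTime (h u)) {c : γ → Letter} (hc : PolyTime c) :
    PolyTime fun x => h (c x) x :=
  (cases_fintype Function.injective_id (fun _ => rfl) hh).comp (hc.prodMk .id)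

theorem symbol_cases {h : Γ' → γ → β} (hh : ∀ u, PolyTime (h u)) {c : γ → Γ'} (hc : PolyTime c) :
    PolyTime fun x => h (c x) x :=
  (cases_fintype Sum.inl_injective (fun _ => rfl) hh).comp (hc.prodMk .id)

@[fun_prop]
theorem cond {c : γ → Bool} {f g : γ → β} (hc : PolyTime c) (hf : PolyTime f) (hg : PolyTime g) :
    PolyTime fun x => bif c x then f x else g x :=
  (cases_fintype (h := fun b x => bif b then f x else g x) Sum.inr_injective (fun _ => rfl)
    (by rintro (_ | _) <;> assumption)).comp (hc.prodMk .id)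

@[fun_prop]
theorem and {f g : γ → Bool} (hf : PolyTime f) (hg : PolyTime g) : PolyTime fun x => f x && g x := by
  simpa [Bool.cond_false_right] using hf.cond hg (const false)

@[fun_prop]
theorem or {f g : γ → Bool} (hf : PolyTime f) (hg : PolyTime g) : PolyTime fun x => f x || g x := by
  simpa [Bool.cond_true_left] using hf.cond (const true) hg

@[fun_prop]
theorem not {f : γ → Bool} (hf : PolyTime f) : PolyTime fun x => !f x := by
  have : (fun x => !f x) = fun x => bif f x then false else true := by
    funext x; cases f x <;> rfl
  rw [this]
  exact hf.cond (const false) (const true)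

/-! ### Lists -/

@[fun_prop]
theorem cons {f : γ → α} {g : γ → List α} (hf : PolyTime f) (hg : PolyTime g) :
    PolyTime fun x => f x :: g x :=
  (of_tree_eq (f := fun x : α × List α => x.1 :: x.2) fun _ => rfl).comp (hf.prodMk hg)

/-- Case distinction on a list. -/
theorem list_cases {f : γ → List α} {g : γ → β} {h : γ → α → List α → β} (hf : PolyTime f)
    (hg : PolyTime g) (hh : PolyTime fun x : γ × α × List α => h x.1 x.2.1 x.2.2) :
    PolyTime fun x => (match f x with
      | [] => g x
      | a :: l => h x a l : β) := by
  let F : List α × γ → β := fun x => match x.1 with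
    | [] => g x.2
    | a :: l => h x.2 a l
  -- The empty list has the tree of the letter `inr false`, and `a :: l` has the tree of the pair
  -- `(a, l)`. So each branch runs on the unchanged tree, seen as a letter or as a pair in front of
  -- the parameter.
  obtain ⟨hgb, s, hs, hg⟩ := hg.comp (snd_prod (α := Letter))
  obtain ⟨hhb, t, ht, hh⟩ := hh.comp
    (snd_prod.prodMk fst_prod : PolyTime fun x : (α × List α) × γ => (x.2, x.1))
  have size {g : Letter × γ → ℕ} (hg : PolyBound g) :
      PolyBound fun x : List α × γ => g (.inr false, x.2) :=
    hg.comp (PolyBound.size.mono fun x => by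
      obtain ⟨l, x⟩ := x; have := two_le_sz l; simp; omega)
  have size' {g : (α × List α) × γ → ℕ} (hg : PolyBound g) : PolyBound fun x : List α × γ =>
      match x.1 with
      | [] => 0
      | a :: l => g ((a, l), x.2) := by
    obtain ⟨c, hc⟩ := hg
    refine ⟨c, ?_⟩
    rintro ⟨_ | ⟨a, l⟩, x⟩
    · simp
    · exact hc ((a, l), x)
  have key : PolyTime F := by
    refine ⟨((size hgb).add (size' hhb)).mono ?_, _, ((size hs).add (size' ht)).add (.const 6),
      fun O => ?_⟩
    · rintro ⟨_ | ⟨a, l⟩, x⟩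
      · simp [F]
      · simp [F]
    · obtain ⟨p, hp⟩ := hg O
      obtain ⟨q, hq⟩ := hh O
      refine ⟨.iteHd (· = .node) q p, ?_⟩
      rintro ⟨_ | ⟨a, l⟩, x⟩
      · exact (Maps.iteHd_false (by rfl) (hp (.inr false, x))).mono (by simp)
      · exact (Maps.iteHd_true (by rfl) (hq ((a, l), x))).mono (by simp)
  exact key.comp (hf.prodMk .id)

/-- A fold whose intermediate results are of polynomial size. -/
theorem foldl {f : γ → List α} {i : γ → σ} {g : γ → σ → α → σ} (hf : PolyTime f) (hi : PolyTime i)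
    (hg : PolyTime fun x : γ × σ × α => g x.1 x.2.1 x.2.2) {b : γ → ℕ} (hb : PolyBound b)
    (h : ∀ x l, l <+: f x → sz (l.foldl (g x) (i x)) ≤ b x) :
    PolyTime fun x => (f x).foldl (g x) (i x) := by
  have start : PolyTime fun x => (f x, x, i x) := hf.prodMk (id.prodMk hi)
  have step : PolyTime fun x : (α × List α) × γ × σ => (x.1.2, x.2.1, g x.2.1 x.2.2 x.1.1) :=
    fst_prod.snd.prodMk (snd_prod.fst.prodMk
      (hg.comp (snd_prod.fst.prodMk (snd_prod.snd.prodMk fst_prod.fst))))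
  obtain ⟨s, hs, hstart⟩ := start.2
  obtain ⟨t, ht, hstep⟩ := step.2
  -- A monotone bound turns the bound on the sizes of the intermediate states into one time bound
  -- that holds for every round.
  obtain ⟨T, hT, htT, hT'⟩ := ht.exists_monotone
  have hfinal : PolyTime fun x : List α × γ × σ => x.2.2 := snd_prod.snd
  obtain ⟨u, hu, hfinal⟩ := hfinal.2
  have hsize : PolyBound fun x => sz (f x) + (sz x + b x) := hf.bound.add (PolyBound.size.add hb)
  have hstate : PolyBound fun x => sz (([] : List α), x, (f x).foldl (g x) (i x)) :=
    ((PolyBound.const 2).add (PolyBound.size.add hb)).mono fun x => by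
      have := h x (f x) List.prefix_rfl
      simp; omega
  refine ⟨hb.mono fun x => h x _ List.prefix_rfl, _,
    (hs.add ((hf.bound.mul ((hT' _ hsize).add (.const 6))).add (.const 6))).add
      (hu.comp hstate), fun O => ?_⟩
  obtain ⟨p, hp⟩ := hstart O
  obtain ⟨q, hq⟩ := hstep O
  obtain ⟨r, hr⟩ := hfinal O
  refine ⟨.seq (.seq p (.loopHd q)) r, fun x => ?_⟩
  -- The loop state is the remaining list, the parameter and the accumulator. The loop stops by
  -- itself when the remaining list has become a leaf.
  let X (j : ℕ) : Sexp := tree ((f x).drop j, x, ((f x).take j).foldl (g x) (i x))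
  have hX : Maps (.loopHd q) (X 0) (X (f x).length)
      ((f x).length * (T (sz (f x) + (sz x + b x)) + 6) + 6) := by
    refine Maps.loopHd X _ (fun j hj => ?_) (fun j hj => ?_) ?_
    · have hd := List.drop_eq_getElem_cons hj
      have key := hq (((f x)[j], (f x).drop (j + 1)), x, ((f x).take j).foldl (g x) (i x))
      have e₁ : X j = tree (((f x)[j], (f x).drop (j + 1)), x,
          ((f x).take j).foldl (g x) (i x)) := by
        simp only [X, hd]; rfl
      have e₂ : X (j + 1) = tree ((f x).drop (j + 1), x,
          g x (((f x).take j).foldl (g x) (i x)) (f x)[j]) := by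
        simp only [X, List.take_add_one, List.foldl_append, List.getElem?_eq_getElem hj]; rfl
      rw [e₁, e₂]
      refine key.mono ((htT _).trans (hT ?_))
      have h₁ : sz ((f x)[j], (f x).drop (j + 1)) = sz ((f x).drop j) := by rw [hd]; rfl
      have h₂ := sz_le_of_sublist (List.drop_sublist j (f x))
      have h₃ := h x _ (List.take_prefix j (f x))
      rw [sz_prod, h₁, sz_prod]
      omega
    · exact ⟨_, _, _, by simp only [X, List.drop_eq_getElem_cons hj]; rfl⟩
    · exact ⟨.inr false, _, by simp only [X, List.drop_length]; rfl⟩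
  have hX' : X (f x).length = tree (([] : List α), x, (f x).foldl (g x) (i x)) := by
    simp [X]
  rw [hX'] at hX
  refine ((((hp x).seq hX).seq (hr _))).mono ?_
  have := two_mul_length_le_sz (f x)
  gcongr
  omega

end PolyTime

namespace PolyTime

variable {α β γ δ σ : Type} [TreeEnc α] [TreeEnc β] [TreeEnc γ] [TreeEnc δ] [TreeEnc σ]

@[fun_prop]
theorem reverse {f : γ → List α} (hf : PolyTime f) : PolyTime fun x => (f x).reverse := by
  have key : ∀ l m : List α, l.foldl (fun s a => a :: s) m = l.reverse ++ m := by
    intro l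
    induction l with
    | nil => simp
    | cons a l ih => simp [ih]
  have : (fun x => (f x).reverse) = fun x => (f x).foldl (fun s a => a :: s) [] := by
    funext x
    simp [key]
  rw [this]
  refine foldl hf (const _) (g := fun _ s a => a :: s) (by fun_prop) hf.bound fun x l hl => ?_
  simpa [key] using sz_le_of_sublist hl.sublist

/-- A fold from the right whose intermediate results are of polynomial size. -/
theorem foldr {f : γ → List α} {i : γ → σ} {g : γ → α → σ → σ} (hf : PolyTime f)
    (hi : PolyTime i) (hg : PolyTime fun x : γ × α × σ => g x.1 x.2.1 x.2.2) {b : γ → ℕ}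
    (hb : PolyBound b) (h : ∀ x l, l <:+ f x → sz (l.foldr (g x) (i x)) ≤ b x) :
    PolyTime fun x => (f x).foldr (g x) (i x) := by
  have : (fun x => (f x).foldr (g x) (i x)) =
      fun x => (f x).reverse.foldl (fun s a => g x a s) (i x) := by
    funext x
    simp
  rw [this]
  refine foldl hf.reverse hi (g := fun x s a => g x a s)
    (hg.comp (by fun_prop : PolyTime fun x : γ × σ × α => (x.1, x.2.2, x.2.1))) hb fun x l hl => ?_
  have := h x l.reverse (by simpa using List.reverse_suffix.2 hl)
  simpa using this

@[fun_prop]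
theorem any {f : γ → List α} {g : γ → α → Bool} (hf : PolyTime f)
    (hg : PolyTime fun x : γ × α => g x.1 x.2) : PolyTime fun x => (f x).any (g x) := by
  have : (fun x => (f x).any (g x)) = fun x => (f x).foldr (fun a s => g x a || s) false := by
    funext x
    induction f x with
    | nil => rfl
    | cons a l ih => simp [ih]
  rw [this]
  exact foldr hf (const false) (g := fun x a s => g x a || s)
    ((hg.comp (by fun_prop : PolyTime fun x : γ × α × Bool => (x.1, x.2.1))).or (by fun_prop))
    (.const 2) fun x l _ => le_rfl

@[fun_prop]
theorem all {f : γ → List α} {g : γ → α → Bool} (hf : PolyTime f)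
    (hg : PolyTime fun x : γ × α => g x.1 x.2) : PolyTime fun x => (f x).all (g x) := by
  have : (fun x => (f x).all (g x)) = fun x => !(f x).any fun a => !g x a := by
    funext x
    simp [List.all_eq_not_any_not]
  rw [this]
  exact (any hf hg.not).not

@[fun_prop]
theorem append {f g : γ → List α} (hf : PolyTime f) (hg : PolyTime g) :
    PolyTime fun x => f x ++ g x := by
  have key : ∀ l m : List α, l.foldr List.cons m = l ++ m := fun l m => by simp
  simp only [← key]
  refine foldr hf hg (g := fun _ a s => a :: s) (by fun_prop) (hf.bound.add hg.bound)
    fun x l hl => ?_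
  have := sz_le_of_sublist hl.sublist
  have := sz_append l (g x)
  rw [key]
  omega

@[fun_prop]
theorem flatMap {f : γ → List α} {g : γ → α → List β} (hf : PolyTime f)
    (hg : PolyTime fun x : γ × α => g x.1 x.2) : PolyTime fun x => (f x).flatMap (g x) := by
  have key : ∀ x, (f x).flatMap (g x) = (f x).foldr (fun a s => g x a ++ s) [] := by
    intro x
    induction f x with
    | nil => rfl
    | cons a l ih => simp [ih]
  simp only [key]
  obtain ⟨G, hG, hgG, hG'⟩ := hg.bound.exists_monotone
  refine foldr hf (const []) (g := fun x a s => g x a ++ s)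
    ((hg.comp (by fun_prop : PolyTime fun x : γ × α × List β => (x.1, x.2.1))).append
      (by fun_prop)) (b := fun x => sz (f x) * G (sz x + sz (f x)) + 2)
    ((hf.bound.mul (hG' _ (PolyBound.size.add hf.bound))).add (.const 2)) fun x l hl => ?_
  have hlen := two_mul_length_le_sz (f x)
  have hll := hl.length_le
  have : sz (l.foldr (fun a s => g x a ++ s) []) ≤ l.length * G (sz x + sz (f x)) + 2 := by
    clear hll
    induction l with
    | nil => simp
    | cons a l ih =>
      have h₁ := ih ((List.suffix_cons a l).trans hl)
      have h₂ : sz (g x a) ≤ G (sz x + sz (f x)) :=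
        (hgG (x, a)).trans (hG (by
          have := sz_le_of_mem (hl.subset List.mem_cons_self)
          simp; omega))
      have h₃ := sz_append (g x a) (l.foldr (fun a s => g x a ++ s) [])
      simp only [List.foldr_cons, List.length_cons]
      ring_nf at *
      omega
  exact this.trans (Nat.add_le_add_right (Nat.mul_le_mul_right _ (by omega)) 2)

@[fun_prop]
theorem map {f : γ → List α} {g : γ → α → β} (hf : PolyTime f)
    (hg : PolyTime fun x : γ × α => g x.1 x.2) : PolyTime fun x => (f x).map (g x) := by
  simp only [List.map_eq_flatMap]
  exact flatMap hf (g := fun x a => [g x a]) (hg.cons (const []))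

@[fun_prop]
theorem filter {f : γ → List α} {g : γ → α → Bool} (hf : PolyTime f)
    (hg : PolyTime fun x : γ × α => g x.1 x.2) : PolyTime fun x => (f x).filter (g x) := by
  have key : ∀ x, (f x).filter (g x) = (f x).flatMap fun a => bif g x a then [a] else [] := by
    intro x
    induction f x with
    | nil => rfl
    | cons a l ih => cases h : g x a <;> simp [ih, h]
  simp only [key]
  exact flatMap hf (g := fun x a => bif g x a then [a] else []) (hg.cond (by fun_prop) (const []))

@[fun_prop]
theorem tail {f : γ → List α} (hf : PolyTime f) : PolyTime fun x => (f x).tail := by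
  have key : ∀ x, (f x).tail = match f x with
    | [] => []
    | _ :: l => l := by
    intro x
    cases f x <;> rfl
  simp only [key]
  exact list_cases hf (const []) (h := fun _ _ l => l) (by fun_prop)

@[fun_prop]
theorem isEmpty {f : γ → List α} (hf : PolyTime f) : PolyTime fun x => (f x).isEmpty := by
  have key : ∀ x, (f x).isEmpty = match f x with
    | [] => true
    | _ :: _ => false := by
    intro x
    cases f x <;> rfl
  simp only [key]
  exact list_cases hf (const true) (h := fun _ _ _ => false) (by fun_prop)

@[fun_prop]
theorem headD {f : γ → List α} {g : γ → α} (hf : PolyTime f) (hg : PolyTime g) :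
    PolyTime fun x => (f x).headD (g x) := by
  have key : ∀ x, (f x).headD (g x) = match f x with
    | [] => g x
    | a :: _ => a := by
    intro x
    cases f x <;> rfl
  simp only [key]
  exact list_cases hf hg (h := fun _ a _ => a) (by fun_prop)

/-- Dropping as many elements as another list has. -/
@[fun_prop]
theorem drop_length {f : γ → List α} {g : γ → List β} (hf : PolyTime f) (hg : PolyTime g) :
    PolyTime fun x => (f x).drop (g x).length := by
  have key : ∀ (l : List β) (m : List α), l.foldl (fun s _ => s.tail) m = m.drop l.length := by
    intro l
    induction l with
    | nil => simp
    | cons a l ih => rintro (_ | ⟨b, m⟩) <;> simp [ih]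
  simp only [← key]
  refine foldl hg hf (g := fun _ s _ => s.tail) (by fun_prop) hf.bound fun x l _ => ?_
  rw [key]
  exact sz_le_of_sublist (List.drop_sublist _ _)

@[fun_prop]
theorem zip {f : γ → List α} {g : γ → List β} (hf : PolyTime f) (hg : PolyTime g) :
    PolyTime fun x => (f x).zip (g x) := by
  let step : List β × List (α × β) → α → List β × List (α × β) := fun s a =>
    (s.1.tail, (s.1.map fun b => (a, b)).take 1 ++ s.2)
  have hstep : ∀ s a, step s a = match s.1 with
    | [] => ([], s.2)
    | b :: l => (l, (a, b) :: s.2) := by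
    rintro ⟨_ | ⟨b, l⟩, s⟩ a <;> rfl
  have key : ∀ (l : List α) (m : List β) (s : List (α × β)),
      l.foldl step (m, s) = (m.drop l.length, (l.zip m).reverse ++ s) := by
    intro l
    induction l with
    | nil => simp
    | cons a l ih =>
      rintro (_ | ⟨b, m⟩) s
      · simp [step, ih]
      · simp [step, ih]
  have : (fun x => (f x).zip (g x)) = fun x => ((f x).foldl step (g x, [])).2.reverse := by
    funext x
    simp [key]
  rw [this]
  refine (foldl hf (by fun_prop) (g := fun _ => step) ?_ (b := fun x => sz (g x) + (sz (f x) *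
    (sz (f x) + sz (g x)) + 2)) (hg.bound.add ((hf.bound.mul (hf.bound.add hg.bound)).add
    (.const 2))) fun x l hl => ?_).snd.reverse
  · simp only [hstep]
    exact list_cases (f := fun x : γ × (List β × List (α × β)) × α => x.2.1.1) (by fun_prop)
      (by fun_prop) (h := fun x b l => (l, (x.2.2, b) :: x.2.1.2)) (by fun_prop)
  · rw [key]
    have h₁ := sz_le_of_sublist (List.drop_sublist l.length (g x))
    have h₂ : sz (l.zip (g x)) ≤ (l.zip (g x)).length * (sz (f x) + sz (g x)) + 2 :=
      sz_list_le fun p hp => by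
        have := sz_le_of_mem (hl.subset (List.of_mem_zip hp).1)
        have := sz_le_of_mem (List.of_mem_zip hp).2
        obtain ⟨a, b⟩ := p
        simp_all; omega
    have h₃ : (l.zip (g x)).length ≤ sz (f x) := by
      have := two_mul_length_le_sz (f x)
      have := hl.length_le
      simp; omega
    have h₄ := Nat.mul_le_mul_right (sz (f x) + sz (g x)) h₃
    simp only [sz_prod, List.append_nil, sz_reverse]
    omega

/-- Equal length is tested without counting: each list is exhausted by dropping as many elements as
the other one has. The elements are then compared along the zip. -/
theorem list_beq [BEq α] [LawfulBEq α] (h : PolyTime fun x : α × α => x.1 == x.2)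
    {f g : γ → List α} (hf : PolyTime f) (hg : PolyTime g) : PolyTime fun x => f x == g x := by
  have key : ∀ l m : List α, (l == m) = ((l.drop m.length).isEmpty && (m.drop l.length).isEmpty &&
      (l.zip m).all fun p => p.1 == p.2) := by
    intro l
    induction l with
    | nil => rintro (_ | ⟨b, m⟩) <;> simp
    | cons a l ih =>
      rintro (_ | ⟨b, m⟩)
      · simp
      · simp only [List.cons_beq_cons, ih, List.length_cons, List.drop_succ_cons, List.zip_cons_cons,
          List.all_cons]
        cases a == b <;> simp
  simp only [key]
  exact and (by fun_prop) (all (by fun_prop) (g := fun (_ : γ) (p : α × α) => p.1 == p.2)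
    (h.comp (by fun_prop : PolyTime fun x : γ × α × α => x.2)))

@[fun_prop]
theorem symbol_beq {f g : γ → Γ'} (hf : PolyTime f) (hg : PolyTime g) :
    PolyTime fun x => f x == g x :=
  symbol_cases (h := fun u x => u == g x)
    (fun u => symbol_cases (h := fun v _ => u == v) (fun _ => const _) hg) hf

@[fun_prop]
theorem symbols_beq {f g : γ → List Γ'} (hf : PolyTime f) (hg : PolyTime g) :
    PolyTime fun x => f x == g x :=
  list_beq (by fun_prop) hf hg

end PolyTime

/-! ### The search for plans, on strings -/

/-- The string of a value without the closing comma. -/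
abbrev Token : Type := List Γ'

/-- The token of the undefined value. -/
def undef : Token := [Γ'.blank]

/-- A name, a precondition and an effect. -/
abbrev RawAction : Type := Token × List Token × List Token

/-- An initial state, a goal and a list of actions. -/
abbrev RawInstance : Type := List Token × List Token × List RawAction

/-- The part of a partial state that does not hold in a total state. -/
def needs (p s : List Token) : List Token :=
  (p.zip s).map fun x => bif x.1 == undef || x.1 == x.2 then undef else x.1

/-- Some value is defined. -/
def unmet (n : List Token) : Bool := n.any fun t => !(t == undef)

/-- The result of an effect in a total state. -/
def update (e s : List Token) : List Token :=
  (e.zip s).map fun x => bif x.1 == undef then x.2 else x.1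

/-- The execution of an action, in a total state and with the needs of the previous action, which
stops if these are not met. -/
def advance (x : List Token × List Token) (a : RawAction) : List Token × List Token :=
  bif unmet x.2 then x else (update a.2.2 x.1, needs a.2.1 x.1)

/-- The needs at the first point where an action sequence fails to be a plan. -/
def missing (R : RawInstance) (ω : List RawAction) : List Token :=
  bif unmet (ω.foldl advance (R.1, [])).2 then (ω.foldl advance (R.1, [])).2
  else needs R.2.1 (ω.foldl advance (R.1, [])).1

/-- The action achieves one of the needs. -/
def supplies (n : List Token) (a : RawAction) : Bool :=
  (n.zip a.2.2).any fun x => !(x.1 == undef) && x.1 == x.2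

/-- All ways to insert an element into a list. -/
def insertions {α : Type} (a : α) : List α → List (List α)
  | [] => [[a]]
  | b :: l => (a :: b :: l) :: (insertions a l).map (b :: ·)

/-- The insertions of the first action that achieves one of the needs. -/
def children (R : RawInstance) (n : List Token) (ω : List RawAction) : List (List RawAction) :=
  match R.2.2.filter (supplies n) with
  | [] => []
  | c :: _ => insertions c ω

namespace PolyTime

variable {γ : Type} [TreeEnc γ]

@[fun_prop]
theorem needs {f g : γ → List Token} (hf : PolyTime f) (hg : PolyTime g) :
    PolyTime fun x => needs (f x) (g x) := by
  unfold _root_.needs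
  fun_prop

@[fun_prop]
theorem unmet {f : γ → List Token} (hf : PolyTime f) : PolyTime fun x => unmet (f x) := by
  unfold _root_.unmet
  fun_prop

@[fun_prop]
theorem update {f g : γ → List Token} (hf : PolyTime f) (hg : PolyTime g) :
    PolyTime fun x => update (f x) (g x) := by
  unfold _root_.update
  fun_prop

@[fun_prop]
theorem advance {f : γ → List Token × List Token} {g : γ → RawAction} (hf : PolyTime f)
    (hg : PolyTime g) : PolyTime fun x => advance (f x) (g x) := by
  unfold _root_.advance
  fun_prop

@[fun_prop]
theorem supplies {f : γ → List Token} {g : γ → RawAction} (hf : PolyTime f)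
    (hg : PolyTime g) : PolyTime fun x => supplies (f x) (g x) := by
  unfold _root_.supplies
  fun_prop

end PolyTime

theorem sz_le_of_mem_needs {p s : List Token} {t : Token} (h : t ∈ needs p s) :
    sz t ≤ sz p + 4 := by
  simp only [needs, List.mem_map, Prod.exists] at h
  obtain ⟨u, v, huv, rfl⟩ := h
  have := sz_le_of_mem (List.of_mem_zip huv).1
  cases u == undef || u == v
  · simp; omega
  · simp [undef]

theorem sz_le_of_mem_update {e s : List Token} {t : Token} {m : ℕ} (h : t ∈ update e s)
    (he : sz e ≤ m) (hs : ∀ t ∈ s, sz t ≤ m) : sz t ≤ m := by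
  simp only [update, List.mem_map, Prod.exists] at h
  obtain ⟨u, v, huv, rfl⟩ := h
  have := sz_le_of_mem (List.of_mem_zip huv).1
  have := hs v (List.of_mem_zip huv).2
  cases u == undef <;> simp <;> omega

/-- Zipping never makes a state longer than it was, and every token comes from the start, from an
action of `ω`, or is the undefined token of size `4`. So both the number and the size of the tokens
stay bounded. -/
theorem foldl_advance_bound {ω : List RawAction} {n m : ℕ} (hω : sz ω + 4 ≤ m) :
    ∀ {x : List Token × List Token}, (x.1.length ≤ n ∧ ∀ t ∈ x.1, sz t ≤ m) →
      (x.2.length ≤ n ∧ ∀ t ∈ x.2, sz t ≤ m) →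
      sz (ω.foldl advance x) ≤ (n * m + 2) + (n * m + 2) := by
  induction ω with
  | nil =>
    intro x h₁ h₂
    have h₃ := (sz_list_le h₁.2).trans (Nat.add_le_add_right (Nat.mul_le_mul_right m h₁.1) 2)
    have h₄ := (sz_list_le h₂.2).trans (Nat.add_le_add_right (Nat.mul_le_mul_right m h₂.1) 2)
    exact Nat.add_le_add h₃ h₄
  | cons a ω ih =>
    intro x h₁ h₂
    obtain ⟨name, p, e⟩ := a
    simp only [sz_cons, sz_prod] at hω
    have := two_le_sz name
    have := two_le_sz p
    have := two_le_sz e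
    rw [List.foldl_cons]
    unfold advance
    cases unmet x.2
    · refine ih (by omega) ⟨?_, fun t ht => ?_⟩ ⟨?_, fun t ht => ?_⟩
      · simp [update, h₁.1]
      · exact sz_le_of_mem_update ht (by simp; omega) h₁.2
      · simp [needs, h₁.1]
      · exact (sz_le_of_mem_needs ht).trans (by simp; omega)
    · exact ih (by omega) h₁ h₂

namespace PolyTime

variable {γ : Type} [TreeEnc γ]

@[fun_prop]
theorem missing {f : γ → RawInstance} {g : γ → List RawAction} (hf : PolyTime f)
    (hg : PolyTime g) : PolyTime fun x => missing (f x) (g x) := by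
  have hfold : PolyTime fun x => (g x).foldl _root_.advance ((f x).1, []) := by
    refine foldl hg (by fun_prop) (g := fun _ s a => _root_.advance s a) (by fun_prop)
      (b := fun x => (sz (f x) * (sz (f x) + sz (g x) + 4) + 2) +
        (sz (f x) * (sz (f x) + sz (g x) + 4) + 2)) ?_ fun x l hl => ?_
    · have := (hf.bound.mul ((hf.bound.add hg.bound).add (.const 4))).add (.const 2)
      exact this.add this
    · have h₁ := sz_le_of_sublist hl.sublist
      have h₂ : sz (f x).1 ≤ sz (f x) := Nat.le_add_right _ _
      have h₃ := two_mul_length_le_sz (f x).1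
      refine foldl_advance_bound (by omega) ⟨by simp; omega, fun t ht => ?_⟩ (by simp)
      have := sz_le_of_mem ht
      simp at this
      omega
  unfold _root_.missing
  fun_prop

end PolyTime

/-! ### Insertions into lists -/

section Insertions

variable {α : Type}

/-- The recursion uses the tail `l` besides the recursive value. It can be recovered from the first
insertion, which is `a :: l`, and this makes the function a plain fold. -/
theorem insertions_eq_foldr (a : α) (l : List α) : insertions a l =
    l.foldr (fun b s => (a :: b :: (s.headD []).tail) :: s.map (b :: ·)) [[a]] := by
  have key : ∀ l : List α, (insertions a l).headD [] = a :: l := by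
    rintro (_ | ⟨b, l⟩) <;> rfl
  induction l with
  | nil => rfl
  | cons b l ih => rw [List.foldr_cons, ← ih, key]; rfl

theorem length_insertions (a : α) (l : List α) : (insertions a l).length = l.length + 1 := by
  induction l with
  | nil => rfl
  | cons b l ih => simp [insertions, ih]

theorem mem_insertions {a : α} {l m : List α} :
    m ∈ insertions a l ↔ ∃ l₁ l₂, l = l₁ ++ l₂ ∧ m = l₁ ++ a :: l₂ := by
  induction l generalizing m with
  | nil => simp [insertions]
  | cons b l ih =>
    simp only [insertions, List.mem_cons, List.mem_map, ih]
    constructor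
    · rintro (rfl | ⟨_, ⟨l₁, l₂, rfl, rfl⟩, rfl⟩)
      · exact ⟨[], _, rfl, rfl⟩
      · exact ⟨b :: l₁, l₂, rfl, rfl⟩
    · rintro ⟨_ | ⟨c, l₁⟩, l₂, h, rfl⟩
      · exact .inl (by simp at h; simp [h])
      · simp only [List.cons_append, List.cons.injEq] at h
        obtain ⟨rfl, rfl⟩ := h
        exact .inr ⟨_, ⟨l₁, l₂, rfl, rfl⟩, rfl⟩

theorem length_of_mem_insertions {a : α} {l m : List α} (h : m ∈ insertions a l) :
    m.length = l.length + 1 := by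
  obtain ⟨l₁, l₂, rfl, rfl⟩ := mem_insertions.1 h
  simp; omega

theorem subset_of_mem_insertions {a : α} {l m : List α} (h : m ∈ insertions a l) :
    ∀ b ∈ m, b = a ∨ b ∈ l := by
  obtain ⟨l₁, l₂, rfl, rfl⟩ := mem_insertions.1 h
  intro b
  simp
  tauto

theorem sz_of_mem_insertions [TreeEnc α] {a : α} {l m : List α} (h : m ∈ insertions a l) :
    sz m = sz a + sz l := by
  obtain ⟨l₁, l₂, rfl, rfl⟩ := mem_insertions.1 h
  have := sz_append l₁ l₂
  have := sz_append l₁ (a :: l₂)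
  rw [sz_cons] at this
  omega

@[fun_prop]
theorem PolyTime.insertions {γ : Type} [TreeEnc γ] [TreeEnc α] {f : γ → α} {g : γ → List α}
    (hf : PolyTime f) (hg : PolyTime g) : PolyTime fun x => insertions (f x) (g x) := by
  simp only [insertions_eq_foldr]
  refine foldr hg (i := fun x => [[f x]]) (by fun_prop) (g := fun x b s =>
    (f x :: b :: (s.headD []).tail) :: s.map (b :: ·)) (by fun_prop)
    (b := fun x => sz (g x) * (sz (f x) + sz (g x)) + 2)
    ((hg.bound.mul (hf.bound.add hg.bound)).add (.const 2)) fun x l hl => ?_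
  rw [← insertions_eq_foldr]
  have h₁ := sz_le_of_sublist hl.sublist
  have h₂ := two_mul_length_le_sz l
  refine (sz_list_le (m := sz (f x) + sz (g x)) fun m hm => ?_).trans
    (Nat.add_le_add_right (Nat.mul_le_mul_right _ ?_) 2)
  · rw [sz_of_mem_insertions hm]; omega
  · rw [length_insertions]; omega

end Insertions

@[fun_prop]
theorem PolyTime.children {γ : Type} [TreeEnc γ] {f : γ → RawInstance} {g : γ → List Token}
    {h : γ → List RawAction} (hf : PolyTime f) (hg : PolyTime g) (hh : PolyTime h) :
    PolyTime fun x => children (f x) (g x) (h x) := by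
  have hs : PolyTime fun x => (f x).2.2.filter (_root_.supplies (g x)) := by fun_prop
  have key := list_cases hs (const []) (h := fun x c _ => _root_.insertions c (h x)) (by fun_prop)
  convert key using 2 with x
  unfold _root_.children
  cases (f x).2.2.filter (_root_.supplies (g x)) <;> rfl

/-! ### Depth-first search -/

/-- The pending action sequences, the plans found so far, the instance, and the maximal length in
unary. -/
abbrev SearchState : Type :=
  List (List RawAction) × List (List RawAction) × RawInstance × List Bool

/-- A step of the search. All plans are kept if `b` is true, and only the last one otherwise. -/
def searchStep (b : Bool) (ω : List RawAction) (x : SearchState) : SearchState :=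
  bif unmet (missing x.2.2.1 ω) then
    -- The dropped list is empty once `ω` has reached the maximal length; a failing sequence then
    -- gets no children.
    ((bif (x.2.2.2.drop ω.length).isEmpty then [] else
      children x.2.2.1 (missing x.2.2.1 ω) ω) ++ x.1, x.2)
  else (x.1, ω :: (bif b then x.2.1 else []), x.2.2)

theorem PolyTime.searchStep (b : Bool) :
    PolyTime fun x : List RawAction × SearchState => searchStep b x.1 x.2 := by
  unfold _root_.searchStep
  fun_prop

/-- The plans in the subtree of depth `r` of an action sequence. -/
def found (R : RawInstance) : ℕ → List RawAction → List (List RawAction)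
  | 0, ω => bif unmet (missing R ω) then [] else [ω]
  | r + 1, ω => bif unmet (missing R ω) then
      (children R (missing R ω) ω).flatMap (found R r) else [ω]

/-- The number of nodes of the subtree of depth `r` of an action sequence. -/
def nodes (R : RawInstance) : ℕ → List RawAction → ℕ
  | 0, _ => 1
  | r + 1, ω => 1 + bif unmet (missing R ω) then
      ((children R (missing R ω) ω).map (nodes R r)).sum else 0

theorem length_of_mem_children {R : RawInstance} {n : List Token} {ω ω' : List RawAction}
    (h : ω' ∈ children R n ω) : ω'.length = ω.length + 1 := by
  unfold children at h
  split at h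
  · simp at h
  · exact length_of_mem_insertions h

theorem length_children_le (R : RawInstance) (n : List Token) (ω : List RawAction) :
    (children R n ω).length ≤ ω.length + 1 := by
  unfold children
  split
  · simp
  · exact (length_insertions _ _).le

theorem subset_of_mem_children {R : RawInstance} {n : List Token} {ω ω' : List RawAction}
    (h : ω' ∈ children R n ω) (hω : ∀ a ∈ ω, a ∈ R.2.2) : ∀ a ∈ ω', a ∈ R.2.2 := by
  unfold children at h
  split at h
  · simp at h
  · rename_i c l hc
    intro a ha
    rcases subset_of_mem_insertions h a ha with rfl | ha
    · exact (List.mem_filter.1 (hc ▸ List.mem_cons_self : a ∈ R.2.2.filter (supplies n))).1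
    · exact hω a ha

/-- A sequence shorter than `k` has at most `k` children. So each of the `r + 1` levels of the
subtree has at most `k ^ r` nodes. -/
theorem nodes_le {R : RawInstance} {k : ℕ} (r : ℕ) :
    ∀ ω : List RawAction, ω.length + r = k → nodes R r ω ≤ (r + 1) * k ^ r := by
  induction r with
  | zero => intro ω _; simp [nodes]
  | succ r ih =>
    intro ω hω
    have hk : 0 < k ^ (r + 1) := Nat.pow_pos (by omega)
    have h₁ : ((children R (missing R ω) ω).map (nodes R r)).sum ≤
        (children R (missing R ω) ω).length * ((r + 1) * k ^ r) := by
      have := List.sum_le_card_nsmul ((children R (missing R ω) ω).map (nodes R r))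
        ((r + 1) * k ^ r) (by
          simp only [List.mem_map, forall_exists_index, and_imp, forall_apply_eq_imp_iff₂]
          intro ω' h
          exact ih ω' (by rw [length_of_mem_children h]; omega))
      simpa using this
    have h₂ : (children R (missing R ω) ω).length * ((r + 1) * k ^ r) ≤
        k * ((r + 1) * k ^ r) :=
      Nat.mul_le_mul_right _ ((length_children_le _ _ _).trans (by omega))
    have h₃ : (r + 1 + 1) * k ^ (r + 1) = k * ((r + 1) * k ^ r) + k ^ (r + 1) := by ring
    rw [h₃]
    unfold nodes
    cases unmet (missing R ω)
    · simp only [cond_false]; omega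
    · simp only [cond_true]; omega

theorem nodes_pos (R : RawInstance) (r : ℕ) (ω : List RawAction) : 0 < nodes R r ω := by
  cases r <;> simp [nodes]

/-- The plans that are kept. -/
def keep (b : Bool) (F : List (List RawAction)) (ω : List RawAction) : List (List RawAction) :=
  ω :: bif b then F else []

/-- A step of the search, which has no effect at the end. -/
def searchNext (b : Bool) (x : SearchState) : SearchState :=
  match x.1 with
  | [] => x
  | ω :: W => searchStep b ω (W, x.2)

/-- Depth-first search deals with the whole subtree of the first pending sequence before it touches
the rest `W`, one step for each node. The condition on the lengths makes the depth `r` agree with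
the cutoff by `K`; the inner `key` treats a list of siblings. -/
theorem iterate_searchNext (b : Bool) (R : RawInstance) (K : List Bool) (r : ℕ) :
    ∀ (ω : List RawAction) (W F : List (List RawAction)), ω.length + r = K.length →
      (searchNext b)^[nodes R r ω] (ω :: W, F, R, K) =
        (W, (found R r ω).foldl (keep b) F, R, K) := by
  induction r with
  | zero =>
    intro ω W F h
    have hK : (K.drop ω.length).isEmpty = true := by
      simp; omega
    simp only [nodes, found, Function.iterate_one, searchNext, searchStep]
    cases unmet (missing R ω) <;> simp [keep, hK]
  | succ r ih =>
    intro ω W F h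
    have hK : (K.drop ω.length).isEmpty = false := by
      simp; omega
    have key : ∀ (L : List (List RawAction)) (F : List (List RawAction)),
        (∀ ω' ∈ L, ω'.length = ω.length + 1) →
        (searchNext b)^[(L.map (nodes R r)).sum] (L ++ W, F, R, K) =
          (W, (L.flatMap (found R r)).foldl (keep b) F, R, K) := by
      intro L
      induction L with
      | nil => intro F _; rfl
      | cons ω' L ihL =>
        intro F hL
        simp only [List.mem_cons, forall_eq_or_imp] at hL
        rw [List.map_cons, List.sum_cons, add_comm, Function.iterate_add_apply, List.cons_append,
          ih ω' _ _ (by omega), ihL _ hL.2, List.flatMap_cons, List.foldl_append]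
    unfold nodes found
    rw [add_comm, Function.iterate_add_apply, Function.iterate_one]
    simp only [searchNext, searchStep, hK]
    cases unmet (missing R ω)
    · simp [keep]
    · exact key _ _ fun ω' h' => length_of_mem_children h'

/-! ### Invariants and sizes during the search -/

/-- The pending action sequences are bounded in number and length. -/
def Pending (R : RawInstance) (k : ℕ) : List (List RawAction) → Prop
  | [] => True
  | ω :: W => (W.length ≤ ω.length * k ∧ ω.length ≤ k ∧ ∀ a ∈ ω, a ∈ R.2.2) ∧ Pending R k W

/-- Every level contributes at most `k` siblings: below a sequence of length `i` lie at most `i * k`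
others, and replacing it by at most `k` children leaves at most `(i + 1) * k` below each child. -/
theorem Pending.append {R : RawInstance} {k i : ℕ} {W : List (List RawAction)}
    (hW : Pending R k W) (hi : W.length ≤ i * k) (hik : i + 1 ≤ k) :
    ∀ L : List (List RawAction), L.length ≤ k →
      (∀ ω ∈ L, ω.length = i + 1 ∧ ∀ a ∈ ω, a ∈ R.2.2) → Pending R k (L ++ W)
  | [], _, _ => hW
  | ω :: L, hL, h => by
    simp only [List.mem_cons, forall_eq_or_imp, List.length_cons] at hL h
    refine ⟨⟨?_, by omega, h.1.2⟩, Pending.append hW hi hik L (by omega) h.2⟩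
    change (L ++ W).length ≤ _
    rw [h.1.1, List.length_append, add_mul]
    omega

theorem Pending.length_le {R : RawInstance} {k : ℕ} {W : List (List RawAction)}
    (hW : Pending R k W) : W.length ≤ k * k + 1 := by
  cases W with
  | nil => simp
  | cons ω W =>
    have := hW.1.1.trans (Nat.mul_le_mul_right k hW.1.2.1)
    simpa using this

theorem Pending.mem {R : RawInstance} {k : ℕ} {W : List (List RawAction)} (hW : Pending R k W) :
    ∀ ω ∈ W, ω.length ≤ k ∧ ∀ a ∈ ω, a ∈ R.2.2 := by
  induction W with
  | nil => simp
  | cons ω W ih =>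
    rintro ω' (_ | ⟨_, h⟩)
    · exact hW.1.2
    · exact ih hW.2 ω' h

/-- What holds after `j` steps of the search. -/
structure SearchInv (b : Bool) (R : RawInstance) (K : List Bool) (j : ℕ) (x : SearchState) :
    Prop where
  data : x.2.2 = (R, K)
  pending : Pending R K.length x.1
  length_le : x.2.1.length ≤ bif b then j else 1
  mem : ∀ ω ∈ x.2.1, ω.length ≤ K.length ∧ ∀ a ∈ ω, a ∈ R.2.2

theorem SearchInv.next {b : Bool} {R : RawInstance} {K : List Bool} {j : ℕ} {x : SearchState}
    (h : SearchInv b R K j x) : SearchInv b R K (j + 1) (searchNext b x) := by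
  obtain ⟨W, F, R', K'⟩ := x
  obtain ⟨⟨⟩, hW, hlen, hmem⟩ := h
  have hlen' : F.length ≤ bif b then j + 1 else 1 :=
    hlen.trans (by cases b <;> simp)
  cases W with
  | nil => exact ⟨rfl, trivial, hlen', hmem⟩
  | cons ω W =>
    simp only [searchNext, searchStep]
    cases unmet (missing R ω)
    · refine ⟨rfl, hW.2, ?_, ?_⟩
      · cases b
        · simp
        · simpa using hlen
      · rintro ω' (_ | ⟨_, h⟩)
        · exact hW.1.2
        · cases b
          · nomatch h
          · exact hmem ω' h
    · refine ⟨rfl, ?_, hlen', hmem⟩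
      simp only [cond_true]
      cases hK : (K.drop ω.length).isEmpty
      · have hlt : ω.length < K.length := by simpa using hK
        exact hW.2.append hW.1.1 hlt _ ((length_children_le _ _ _).trans hlt) fun ω' h =>
          ⟨length_of_mem_children h, subset_of_mem_children h hW.1.2.2⟩
      · exact hW.2

/-- The number of plans that are kept at most. -/
def keptBound (b : Bool) (R : RawInstance) (K : List Bool) : ℕ :=
  bif b then nodes R K.length [] else 1

theorem sz_sequences_le {R : RawInstance} {K : List Bool} {W : List (List RawAction)}
    (h : ∀ ω ∈ W, ω.length ≤ K.length ∧ ∀ a ∈ ω, a ∈ R.2.2) :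
    sz W ≤ W.length * (sz K * sz R + 2) + 2 := by
  refine sz_list_le fun ω hω => (sz_list_le (m := sz R) fun a ha => ?_).trans ?_
  · obtain ⟨I, G, A⟩ := R
    have := sz_le_of_mem ((h ω hω).2 a ha)
    simp at this ⊢
    omega
  · have := two_mul_length_le_sz K
    have := (h ω hω).1
    exact Nat.add_le_add_right (Nat.mul_le_mul_right _ (by omega)) 2

/-- There are at most `k ^ 2 + 1` pending sequences and at most `keptBound` plans, each made of at
most `k` actions of `R`. The constant `20` and the exponent `5` are generous. -/
theorem SearchInv.sz_le {b : Bool} {R : RawInstance} {K : List Bool} {j : ℕ} {x : SearchState}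
    (h : SearchInv b R K j x) (hj : j ≤ nodes R K.length []) :
    sz x ≤ 20 * sz (R, K) ^ 5 * keptBound b R K := by
  obtain ⟨W, F, R', K'⟩ := x
  obtain ⟨⟨⟩, hW, hlen, hmem⟩ := h
  have hM : 1 ≤ keptBound b R K := by
    cases b
    · exact le_rfl
    · exact nodes_pos _ _ _
  have hF : F.length ≤ keptBound b R K := hlen.trans (by cases b <;> simp [keptBound, hj])
  have h₁ := sz_sequences_le hW.mem
  have h₂ := sz_sequences_le hmem
  have h₃ := hW.length_le
  have h₄ := two_mul_length_le_sz K
  simp only [sz_prod] at *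
  generalize keptBound b R K = M at *
  have hR := two_le_sz R
  have hK := two_le_sz K
  generalize sz R = r at *
  generalize sz K = k at *
  have hs : K.length ≤ r + k := by omega
  set s := r + k with hs'
  have hs4 : 4 ≤ s := by omega
  have hA : k * r + 2 ≤ 2 * s ^ 2 := by nlinarith
  have hB : W.length ≤ 2 * s ^ 2 := by nlinarith
  have hW' : W.length * (k * r + 2) ≤ 2 * s ^ 2 * (2 * s ^ 2) := Nat.mul_le_mul hB hA
  have hF' : F.length * (k * r + 2) ≤ M * (2 * s ^ 2) := Nat.mul_le_mul hF hA
  have e5 : s ^ 4 ≤ s ^ 5 := Nat.pow_le_pow_right (by omega) (by omega)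
  have e2 : s ^ 2 ≤ s ^ 5 := Nat.pow_le_pow_right (by omega) (by omega)
  have e1 : s ≤ s ^ 5 := Nat.le_self_pow (by omega) _
  have hP : 2 * s ^ 2 * (2 * s ^ 2) = 4 * s ^ 4 := by ring
  have hQ : s ^ 5 ≤ s ^ 5 * M := Nat.le_mul_of_pos_right _ hM
  have hF'' : M * (2 * s ^ 2) ≤ 2 * (s ^ 5 * M) := by nlinarith
  have : 20 * s ^ 5 * M = 20 * (s ^ 5 * M) := by ring
  rw [this]
  omega

theorem searchInv_iterate (b : Bool) (R : RawInstance) (K : List Bool) (j : ℕ) :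
    SearchInv b R K j ((searchNext b)^[j] ([[]], [], R, K)) := by
  induction j with
  | zero => exact ⟨rfl, ⟨by simp, trivial⟩, by simp, by simp⟩
  | succ j ih => rw [Function.iterate_succ_apply']; exact ih.next

theorem sz_search_result_le (b : Bool) (R : RawInstance) (K : List Bool) :
    sz (([], (found R K.length []).foldl (keep b) [], R, K) : SearchState) ≤
      20 * sz (R, K) ^ 5 * keptBound b R K := by
  have h := (searchInv_iterate b R K (nodes R K.length [])).sz_le le_rfl
  rwa [iterate_searchNext b R K K.length [] [] [] (by simp)] at h

/-- The search as a stack program. -/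
theorem exists_search_prog (b : Bool) : ∃ c : ℕ, ∀ O : Type, ∃ p : Prog O,
    ∀ (R : RawInstance) (K : List Bool),
      Maps p (tree (([], [], R, K) : SearchState)) (tree (([], [], R, K) : SearchState)) 6 ∧
      Maps p (tree (([[]], [], R, K) : SearchState))
        (tree (([], (found R K.length []).foldl (keep b) [], R, K) : SearchState))
        (nodes R K.length [] * ((20 * sz (R, K) ^ 5 * keptBound b R K) ^ c + 6) + 6) := by
  obtain ⟨-, t, ⟨c, hc⟩, hp⟩ := (PolyTime.searchStep b).comp (by fun_prop :
    PolyTime fun y : (List RawAction × List (List RawAction)) × List (List RawAction) ×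
      RawInstance × List Bool => (y.1.1, y.1.2, y.2))
  refine ⟨c, fun O => ?_⟩
  obtain ⟨p, hp⟩ := hp O
  refine ⟨.loopHd p, fun R K => ⟨?_, ?_⟩⟩
  · have := Maps.loopHd (p := p) (k := 0) (fun _ => tree (([], [], R, K) : SearchState)) 0
      (by simp) (by simp) ⟨_, _, rfl⟩
    exact this.mono (by simp)
  let X (j : ℕ) : SearchState := (searchNext b)^[j] ([[]], [], R, K)
  have hX : X (nodes R K.length []) = ([], (found R K.length []).foldl (keep b) [], R, K) :=
    iterate_searchNext b R K K.length [] [] [] (by simp)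
  have hsucc : ∀ j, X (j + 1) = searchNext b (X j) := fun j => Function.iterate_succ_apply' _ _ _
  -- The program stops at the first time when nothing is pending. From then on `searchNext` is idle,
  -- so this state is also the one after as many steps as there are nodes.
  have hex : ∃ j, (X j).1 = [] := ⟨_, by rw [hX]⟩
  have hN : Nat.find hex ≤ nodes R K.length [] := Nat.find_min' hex (by rw [hX])
  have hfix : X (nodes R K.length []) = X (Nat.find hex) := by
    have : ∀ i, X (Nat.find hex + i) = X (Nat.find hex) := by
      intro i
      induction i with
      | zero => rfl
      | succ i ih =>
        rw [← add_assoc, hsucc, ih]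
        unfold searchNext
        rw [Nat.find_spec hex]
    rw [← this (nodes R K.length [] - Nat.find hex)]
    congr 1
    omega
  have hinv : ∀ j, SearchInv b R K j (X j) := searchInv_iterate b R K
  rw [← hX, hfix]
  refine (Maps.loopHd (fun j => tree (X j)) _ (fun j hj => ?_) (fun j hj => ?_) ?_).mono
    (Nat.add_le_add_right (Nat.mul_le_mul_right _ hN) 6)
  · have hne := Nat.find_min hex hj
    have hsz := (hinv j).sz_le (hj.le.trans hN)
    rw [hsucc]
    generalize X j = x at *
    obtain ⟨_ | ⟨ω, W⟩, x⟩ := x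
    · simp at hne
    · refine (hp ((ω, W), x)).mono ((hc _).trans (Nat.pow_le_pow_left (le_trans ?_ hsz) c))
      simp only [sz_prod, sz_cons]
      omega
  · have hne := Nat.find_min hex hj
    generalize X j = x at *
    obtain ⟨_ | ⟨ω, W⟩, x⟩ := x
    · simp at hne
    · exact ⟨_, _, _, rfl⟩
  · have := Nat.find_spec hex
    generalize X (Nat.find hex) = x at *
    obtain ⟨W, x⟩ := x
    simp only at this
    subst this
    exact ⟨_, _, rfl⟩

/-! ### Reading, checking and writing strings -/

/-- The string and the parameter (in unary) of a reversed input. -/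
def splitInput (l : List Letter) : List Γ' × List Bool :=
  l.foldl (fun s u => match u with
    | .inl g => (g :: s.1, s.2)
    | .inr true => (s.1, true :: s.2)
    | .inr false => s) ([], [])

/-- The tokenizer, which works from the right: the tokens of the current tuple, and the tuples
that have been read. -/
def tokenStep (g : Γ') (s : List Token × List (List Token)) : List Token × List (List Token) :=
  match g with
  | .comma => ([] :: s.1, s.2)
  | .ket => ([], s.2)
  | .bra => ([], s.1 :: s.2)
  | g => match s.1 with
    | [] => s
    | t :: r => ((g :: t) :: r, s.2)

/-- The tokens before the first tuple, and the tuples of tokens. -/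
def tokenize (x : List Γ') : List Token × List (List Token) := x.foldr tokenStep ([], [])

/-- The consecutive pairs of a list of even length. -/
def pairUp {α : Type} (l : List α) : List (α × α) :=
  (l.foldr (fun t s => match s.1 with
    | [] => ([t], s.2)
    | e :: _ => (([] : List α), (t, e) :: s.2)) ([], [])).2

/-- The successor of a binary numeral. -/
def succToken (t : Token) : Token :=
  let s := t.foldl (fun s g => (s.1 && g == Γ'.bit true,
    (bif s.1 then (bif g == Γ'.bit true then Γ'.bit false else Γ'.bit true) else g) :: s.2))
    (true, ([] : Token))
  (bif s.1 then Γ'.bit true :: s.2 else s.2).reverse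

/-- The actions with given preconditions and effects, named by their indices. -/
def number (l : List (List Token × List Token)) : List RawAction :=
  (l.foldl (fun s p => (succToken s.1, (s.1, p.1, p.2) :: s.2))
    (([] : Token), ([] : List RawAction))).2.reverse

/-- The size of the domain and the instance that a string encodes. -/
def parse (x : List Γ') : Token × RawInstance :=
  ((tokenize x).1.headD [], (tokenize x).2.headD [], (tokenize x).2.tail.headD [],
    number (pairUp (tokenize x).2.tail.tail))

/-- The string of a state. -/
def renderState (s : List Token) : List Γ' :=
  Γ'.bra :: s.flatMap (fun t => t ++ [Γ'.comma]) ++ [Γ'.ket]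

/-- The string of an instance. -/
def render (Q : Token × RawInstance) : List Γ' :=
  Q.1 ++ [Γ'.comma] ++ renderState Q.2.1 ++ renderState Q.2.2.1
    ++ Q.2.2.2.flatMap fun a => renderState a.2.1 ++ renderState a.2.2

/-- The token is a binary numeral without leading zeros. -/
def isNumeral (t : Token) : Bool :=
  t.all (fun g => g == Γ'.bit false || g == Γ'.bit true) &&
    -- The last symbol is the most significant bit; the default lets the empty numeral of `0` pass.
    !(t.reverse.headD (Γ'.bit true) == Γ'.bit false)

/-- Comparison of binary numerals. -/
def lessToken (t d : Token) : Bool :=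
  -- Padding with zeros gives both numerals the same length. Read from the least significant bit,
  -- the last difference decides.
  ((t ++ d.map fun _ => Γ'.bit false).zip (d ++ t.map fun _ => Γ'.bit false)).foldl
    (fun r x => bif x.1 == x.2 then r else x.2 == Γ'.bit true) false

/-- The token is a numeral less than `d`. -/
def isValue (d t : Token) : Bool := isNumeral t && lessToken t d

/-- The tuple `s` is a partial state for the variables of the tuple `I`. -/
def isPartialState (d : Token) (I s : List Token) : Bool :=
  (I.drop s.length).isEmpty && (s.drop I.length).isEmpty &&
    s.all fun t => t == undef || isValue d t

/-- Post-uniqueness of a list of actions. -/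
def isPostUnique (A : List RawAction) : Bool :=
  A.all fun a => A.all fun b => a.1 == b.1 ||
    (a.2.2.zip b.2.2).all fun x => x.1 == undef || !(x.1 == x.2)

/-- The string `x` is the encoding of the post-unique instance `Q`. -/
def wellFormed (x : List Γ') (Q : Token × RawInstance) : Bool :=
  -- The parser accepts every string; comparing the rendered result with `x` exposes whatever it
  -- ignored.
  render Q == x && isNumeral Q.1 && Q.2.1.all (isValue Q.1) &&
    isPartialState Q.1 Q.2.1 Q.2.2.1 &&
    (Q.2.2.2.all fun a => isPartialState Q.1 Q.2.1 a.2.1 && isPartialState Q.1 Q.2.1 a.2.2) &&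
    isPostUnique Q.2.2.2

/-- The list `l` is a subsequence of `m`. -/
def isSubsequence {α : Type} [BEq α] (l m : List α) : Bool :=
  (m.foldl (fun s b => match s with
    | [] => []
    | a :: r => bif a == b then r else s) l).isEmpty

/-- The names in those action sequences that have no other sequence as a subsequence. -/
def minimalNames (F : List (List RawAction)) : List (List Token) :=
  (F.map (·.map (·.1))).filter fun ω =>
    !(F.map (·.map (·.1))).any fun ω' => isSubsequence ω' ω && !(ω' == ω)

/-! ### Polynomial time of reading, checking and writing -/

theorem sz_token (t : Token) : sz t = 2 * t.length + 2 := by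
  induction t with
  | nil => rfl
  | cons g t ih => simp [ih]; omega

namespace PolyTime

variable {α γ : Type} [TreeEnc α] [TreeEnc γ]

@[fun_prop]
theorem splitInput {f : γ → List Letter} (hf : PolyTime f) :
    PolyTime fun x => splitInput (f x) := by
  refine foldl hf (const ([], [])) (g := fun _ s u => match u with
    | .inl g => (g :: s.1, s.2)
    | .inr true => (s.1, true :: s.2)
    | .inr false => s) ?_ (b := fun x => sz (f x) + 2) (hf.bound.add (.const 2)) fun x l hl => ?_
  · refine letter_cases (h := fun (u : Letter)
      (y : γ × (List Γ' × List Bool) × Letter) => match u with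
      | .inl g => (g :: y.2.1.1, y.2.1.2)
      | .inr true => (y.2.1.1, true :: y.2.1.2)
      | .inr false => y.2.1) ?_ (c := fun y => y.2.2) (by fun_prop)
    rintro (g | _ | _) <;> simp only <;> fun_prop
  · have key : ∀ (l : List Letter) (s : List Γ' × List Bool),
        sz (l.foldl (fun s u => match u with
          | .inl g => (g :: s.1, s.2)
          | .inr true => (s.1, true :: s.2)
          | .inr false => s) s) + 2 ≤ sz l + sz s := by
      intro l
      induction l with
      | nil => intro s; simp; omega
      | cons u l ih =>
        rintro ⟨s, s'⟩
        rw [List.foldl_cons]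
        refine (ih _).trans ?_
        rcases u with g | _ | _ <;> simp <;> omega
    have := key l ([], [])
    have := sz_le_of_sublist hl.sublist
    simp at *
    omega

@[fun_prop]
theorem tokenize {f : γ → List Γ'} (hf : PolyTime f) : PolyTime fun x => tokenize (f x) := by
  refine foldr hf (const ([], [])) (g := fun _ g s => tokenStep g s) ?_
    (b := fun x => sz (f x) + 2) (hf.bound.add (.const 2)) fun x l hl => ?_
  · have hs : PolyTime fun y : γ × Γ' × (List Token × List (List Token)) => y.2.2.1 := by fun_prop
    have hc (g : Γ') := list_cases hs (g := fun y => y.2.2)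
      (h := fun y t r => ((g :: t) :: r, y.2.2.2)) (by fun_prop) (by fun_prop)
    refine symbol_cases (h := fun g (y : γ × Γ' × (List Token × List (List Token))) =>
      tokenStep g y.2.2) ?_ (c := fun y => y.2.1) (by fun_prop)
    rintro (_ | b | _ | _ | _)
    · convert hc .blank using 2 with y
      unfold tokenStep
      rcases y.2.2 with ⟨_ | ⟨t, r⟩, s⟩ <;> rfl
    · convert hc (.bit b) using 2 with y
      unfold tokenStep
      rcases y.2.2 with ⟨_ | ⟨t, r⟩, s⟩ <;> rfl
    all_goals
      unfold tokenStep
      fun_prop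
  · have key : ∀ l : List Γ', sz (l.foldr tokenStep ([], [])) ≤ sz l + 2 := by
      intro l
      induction l with
      | nil => simp
      | cons g l ih =>
        rw [List.foldr_cons]
        revert ih
        generalize l.foldr tokenStep ([], []) = s
        obtain ⟨_ | ⟨t, r⟩, s⟩ := s <;> intro ih <;> rcases g with _ | b | _ | _ | _ <;>
          simp [tokenStep] at * <;> omega
    have := sz_le_of_sublist hl.sublist
    exact (key l).trans (by omega)

@[fun_prop]
theorem pairUp {f : γ → List α} (hf : PolyTime f) : PolyTime fun x => pairUp (f x) := by
  refine snd (foldr hf (const ([], [])) (g := fun _ t s => match s.1 with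
    | [] => ([t], s.2)
    | e :: _ => (([] : List α), (t, e) :: s.2)) ?_
    (b := fun x => sz (f x) + 2) (hf.bound.add (.const 2)) fun x l hl => ?_)
  · have hs : PolyTime fun y : γ × α × (List α × List (α × α)) => y.2.2.1 := by fun_prop
    have hc := list_cases hs (g := fun y => ([y.2.1], y.2.2.2))
      (h := fun y e _ => (([] : List α), (y.2.1, e) :: y.2.2.2)) (by fun_prop) (by fun_prop)
    refine (congrArg PolyTime (funext fun y => ?_)).mpr hc
    obtain ⟨_, _, _ | ⟨t, r⟩, s⟩ := y <;> rfl
  · have key : ∀ l : List α, sz (l.foldr (fun t s => match s.1 with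
        | [] => ([t], s.2)
        | e :: _ => (([] : List α), (t, e) :: s.2)) ([], [])) ≤ sz l + 2 := by
      intro l
      induction l with
      | nil => simp
      | cons g l ih =>
        rw [List.foldr_cons]
        revert ih
        generalize l.foldr _ ([], []) = s
        obtain ⟨_ | ⟨t, r⟩, s⟩ := s <;> intro ih
        · simp at *; omega
        · have := two_le_sz r
          simp at *; omega
    have := sz_le_of_sublist hl.sublist
    exact (key l).trans (by omega)

@[fun_prop]
theorem succToken {f : γ → Token} (hf : PolyTime f) : PolyTime fun x => succToken (f x) := by
  have h : PolyTime fun x => (f x).foldl (fun s g => (s.1 && g == Γ'.bit true,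
      (bif s.1 then (bif g == Γ'.bit true then Γ'.bit false else Γ'.bit true) else g) :: s.2))
      (true, ([] : Token)) := by
    refine foldl hf (const _) (g := fun _ s g => (s.1 && g == Γ'.bit true,
      (bif s.1 then (bif g == Γ'.bit true then Γ'.bit false else Γ'.bit true) else g) :: s.2))
      (by fun_prop) (b := fun x => sz (f x) + 2) (hf.bound.add (.const 2)) fun x l hl => ?_
    have key : ∀ (l : Token) (s : Bool × Token), sz (l.foldl (fun s g => (s.1 && g == Γ'.bit true,
        (bif s.1 then (bif g == Γ'.bit true then Γ'.bit false else Γ'.bit true) else g) :: s.2))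
        s) + 2 = sz l + sz s := by
      intro l
      induction l with
      | nil => intro s; simp; omega
      | cons g l ih =>
        intro s
        rw [List.foldl_cons, ih]
        obtain ⟨b, s⟩ := s
        simp
        omega
    have := key l (true, [])
    have := sz_le_of_sublist hl.sublist
    simp at *
    omega
  unfold _root_.succToken
  fun_prop

end PolyTime

/-- A carry adds at most one digit, so the name of an action is never longer than the number of
actions before it. This crude bound suffices for polynomial size. -/
theorem length_succToken_le (t : Token) : (succToken t).length ≤ t.length + 1 := by
  have key : ∀ (l : Token) (s : Bool × Token), (l.foldl (fun s g => (s.1 && g == Γ'.bit true,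
      (bif s.1 then (bif g == Γ'.bit true then Γ'.bit false else Γ'.bit true) else g) :: s.2))
      s).2.length = l.length + s.2.length := by
    intro l
    induction l with
    | nil => intro s; simp
    | cons g l ih => intro s; rw [List.foldl_cons, ih]; simp; omega
  have := key t (true, [])
  unfold succToken
  generalize t.foldl _ _ = s at *
  obtain ⟨_ | _, s⟩ := s <;> simp at * <;> omega

namespace PolyTime

variable {α γ : Type} [TreeEnc α] [TreeEnc γ]

@[fun_prop]
theorem number {f : γ → List (List Token × List Token)} (hf : PolyTime f) :
    PolyTime fun x => number (f x) := by
  refine reverse (snd (foldl hf (const _) (g := fun _ s p =>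
    (_root_.succToken s.1, (s.1, p.1, p.2) :: s.2)) (by fun_prop)
    (b := fun x => sz (f x) * (sz (f x) + 4) + 4)
    ((hf.bound.mul (hf.bound.add (.const 4))).add (.const 4)) fun x l hl => ?_))
  have key : ∀ (l : List (List Token × List Token)) (s : Token × List RawAction) (m : ℕ),
      s.1.length + l.length ≤ m →
      (l.foldl (fun s p => (_root_.succToken s.1, (s.1, p.1, p.2) :: s.2)) s).1.length ≤ m ∧
      sz (l.foldl (fun s p => (_root_.succToken s.1, (s.1, p.1, p.2) :: s.2)) s).2 ≤
        sz s.2 + (2 * m + 2) * l.length + sz l := by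
    intro l
    induction l with
    | nil => intro s m hm; simp at *; omega
    | cons p l ih =>
      intro s m hm
      obtain ⟨t, A⟩ := s
      obtain ⟨q, e⟩ := p
      have ht := length_succToken_le t
      simp only [List.length_cons] at hm
      obtain ⟨h₁, h₂⟩ := ih (_root_.succToken t, (t, q, e) :: A) m (by simp only; omega)
      refine ⟨h₁, h₂.trans ?_⟩
      simp only [sz_cons, sz_prod, sz_token, List.length_cons]
      ring_nf
      omega
  obtain ⟨h₁, h₂⟩ := key l ([], []) l.length (by simp)
  have h₃ := sz_le_of_sublist hl.sublist
  have h₄ := two_mul_length_le_sz l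
  generalize l.foldl (fun s p => (_root_.succToken s.1, (s.1, p.1, p.2) :: s.2))
    (([] : Token), ([] : List RawAction)) = s at *
  obtain ⟨t, A⟩ := s
  simp only [sz_prod, sz_token, sz_nil] at *
  generalize sz l = a at *
  generalize sz (f x) = b at *
  have : (2 * l.length + 2) * l.length ≤ b * b :=
    Nat.mul_le_mul (by omega) (by omega)
  have : b * (b + 4) = b * b + 4 * b := by ring
  omega

@[fun_prop]
theorem parse {f : γ → List Γ'} (hf : PolyTime f) : PolyTime fun x => parse (f x) := by
  unfold _root_.parse
  fun_prop

@[fun_prop]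
theorem renderState {f : γ → List Token} (hf : PolyTime f) :
    PolyTime fun x => renderState (f x) := by
  unfold _root_.renderState
  fun_prop

@[fun_prop]
theorem render {f : γ → Token × RawInstance} (hf : PolyTime f) :
    PolyTime fun x => render (f x) := by
  unfold _root_.render
  fun_prop

@[fun_prop]
theorem isNumeral {f : γ → Token} (hf : PolyTime f) : PolyTime fun x => isNumeral (f x) := by
  unfold _root_.isNumeral
  fun_prop

@[fun_prop]
theorem lessToken {f g : γ → Token} (hf : PolyTime f) (hg : PolyTime g) :
    PolyTime fun x => lessToken (f x) (g x) :=
  foldl (f := fun x => ((f x) ++ (g x).map fun _ => Γ'.bit false).zip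
      ((g x) ++ (f x).map fun _ => Γ'.bit false)) (by fun_prop) (const false)
    (g := fun _ r x => bif x.1 == x.2 then r else x.2 == Γ'.bit true) (by fun_prop) (.const 2)
    fun _ _ _ => le_rfl

@[fun_prop]
theorem isValue {f g : γ → Token} (hf : PolyTime f) (hg : PolyTime g) :
    PolyTime fun x => isValue (f x) (g x) := by
  unfold _root_.isValue
  fun_prop

@[fun_prop]
theorem isPartialState {f : γ → Token} {g h : γ → List Token} (hf : PolyTime f)
    (hg : PolyTime g) (hh : PolyTime h) :
    PolyTime fun x => isPartialState (f x) (g x) (h x) := by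
  unfold _root_.isPartialState
  fun_prop

@[fun_prop]
theorem isPostUnique {f : γ → List RawAction} (hf : PolyTime f) :
    PolyTime fun x => isPostUnique (f x) := by
  unfold _root_.isPostUnique
  fun_prop

@[fun_prop]
theorem wellFormed {f : γ → List Γ'} {g : γ → Token × RawInstance} (hf : PolyTime f)
    (hg : PolyTime g) : PolyTime fun x => wellFormed (f x) (g x) := by
  unfold _root_.wellFormed
  fun_prop

theorem isSubsequence [BEq α] (h : PolyTime fun x : α × α => x.1 == x.2) {f g : γ → List α}
    (hf : PolyTime f) (hg : PolyTime g) : PolyTime fun x => isSubsequence (f x) (g x) := by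
  refine isEmpty (foldl hg hf (g := fun _ s b => match s with
    | [] => []
    | a :: r => bif a == b then r else s) ?_ hf.bound fun x l hl => ?_)
  · have hs : PolyTime fun y : γ × List α × α => y.2.1 := by fun_prop
    have hc := list_cases hs (const ([] : List α)) (h := fun y a r => bif a == y.2.2 then r else y.2.1)
      (cond (h.comp (by fun_prop : PolyTime fun y : (γ × List α × α) × α × List α =>
        (y.2.1, y.1.2.2))) (by fun_prop) (by fun_prop))
    refine (congrArg PolyTime (funext fun y => ?_)).mpr hc
    obtain ⟨_, _ | ⟨t, r⟩, _⟩ := y <;> rfl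
  · refine sz_le_of_sublist ?_
    clear hl
    generalize f x = m
    induction l generalizing m with
    | nil => exact List.Sublist.refl _
    | cons b l ih =>
      refine (ih _).trans ?_
      rcases m with _ | ⟨a, m⟩
      · simp
      · simp only
        cases a == b <;> simp

@[fun_prop]
theorem minimalNames {f : γ → List (List RawAction)} (hf : PolyTime f) :
    PolyTime fun x => minimalNames (f x) := by
  have h₁ : PolyTime fun x : Token × Token => x.1 == x.2 := by fun_prop
  unfold _root_.minimalNames
  refine filter (by fun_prop) (not (any (by fun_prop) (and (isSubsequence h₁ ?_ ?_)
    (not (list_beq h₁ ?_ ?_))))) <;> fun_prop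

end PolyTime

/-! ### Correctness of the search -/

/-- The token of a number. -/
def numeral (n : ℕ) : Token := n.bits.map Γ'.bit

/-- The token of a value. -/
def valueToken {d : ℕ} : Option (Fin d) → Token
  | none => undef
  | some x => numeral x

/-- The tokens of a partial state. -/
def stateTokens {n d : ℕ} (s : Fin n → Option (Fin d)) : List Token :=
  (List.finRange n).map fun v => valueToken (s v)

theorem numeral_injective : Function.Injective numeral := by
  intro m n h
  have hbit : Function.Injective Γ'.bit := fun a b h => by simpa using h
  have h' : m.bits = n.bits := List.map_injective_iff.2 hbit h
  have key : ∀ n : ℕ, n.bits.foldr Nat.bit 0 = n := by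
    intro n
    induction n using Nat.binaryRec' with
    | zero => simp
    | bit b n hb ih => rw [Nat.bits_append_bit _ _ hb, List.foldr_cons, ih]
  rw [← key m, h', key]

theorem numeral_ne_undef (n : ℕ) : numeral n ≠ undef := by
  unfold numeral undef
  cases n.bits <;> simp

theorem valueToken_injective {d : ℕ} : Function.Injective (valueToken (d := d)) := by
  rintro (_ | x) (_ | y) h
  · rfl
  · exact (numeral_ne_undef _ h.symm).elim
  · exact (numeral_ne_undef _ h).elim
  · exact congrArg some (Fin.ext (numeral_injective h))

@[simp] theorem valueToken_eq_undef {d : ℕ} {x : Option (Fin d)} :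
    valueToken x = undef ↔ x = none :=
  valueToken_injective.eq_iff' rfl

namespace SASInstance

variable (P : SASInstance)

/-- The tokens of a total state. -/
def totalTokens (s : P.State) : List Token := stateTokens fun v => some (s v)

/-- An action with its name. -/
def rawAction (a : P.Action) : RawAction :=
  (numeral a, stateTokens (P.pre a), stateTokens (P.eff a))

/-- The instance in terms of tokens. -/
def raw : RawInstance :=
  (P.totalTokens P.init, stateTokens P.goal, (List.finRange P.numActs).map P.rawAction)

/-- The part of a partial state that does not hold in a total state. -/
def lacking (p : Fin P.numVars → Option (Fin P.numVals)) (s : P.State) :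
    Fin P.numVars → Option (Fin P.numVals) :=
  fun v => if p v = some (s v) then none else p v

theorem lacking_eq_some {p : Fin P.numVars → Option (Fin P.numVals)} {s : P.State}
    {v : Fin P.numVars} {x : Fin P.numVals} :
    P.lacking p s v = some x ↔ p v = some x ∧ s v ≠ x := by
  unfold lacking
  split
  · simp_all
  · rename_i h
    exact ⟨fun hp => ⟨hp, fun hs => h (hs ▸ hp)⟩, fun hp => hp.1⟩

theorem lacking_eq_none {p : Fin P.numVars → Option (Fin P.numVals)} {s : P.State}
    {v : Fin P.numVars} : P.lacking p s v = none ↔ p v = some (s v) ∨ p v = none := by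
  unfold lacking
  split <;> simp_all

theorem needs_stateTokens (p : Fin P.numVars → Option (Fin P.numVals)) (s : P.State) :
    needs (stateTokens p) (P.totalTokens s) = stateTokens (P.lacking p s) := by
  simp only [needs, totalTokens, stateTokens, List.zip_map', List.map_map]
  refine List.map_congr_left fun v _ => ?_
  simp only [Function.comp_apply, lacking]
  by_cases h : p v = some (s v)
  · simp [h, valueToken]
  · have hne : valueToken (p v) ≠ valueToken (some (s v)) := valueToken_injective.ne h
    by_cases h' : p v = none
    · simp [h', valueToken]
    · have : valueToken (p v) ≠ undef := by simpa using h'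
      rw [beq_eq_false_iff_ne.2 this, beq_eq_false_iff_ne.2 hne]
      simp [h]

theorem unmet_stateTokens {p : Fin P.numVars → Option (Fin P.numVals)} :
    unmet (stateTokens p) = false ↔ ∀ v, p v = none := by
  simp [unmet, stateTokens]

theorem unmet_lacking_pre {a : P.Action} {s : P.State} :
    unmet (stateTokens (P.lacking (P.pre a) s)) = false ↔ P.Valid a s := by
  simp only [unmet_stateTokens, lacking_eq_none, Valid]

theorem unmet_lacking_goal {s : P.State} :
    unmet (stateTokens (P.lacking P.goal s)) = false ↔ P.IsGoalState s := by
  simp only [unmet_stateTokens, lacking_eq_none, IsGoalState]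

theorem update_stateTokens (a : P.Action) (s : P.State) :
    update (stateTokens (P.eff a)) (P.totalTokens s) = P.totalTokens (P.result a s) := by
  simp only [update, totalTokens, stateTokens, List.zip_map', List.map_map]
  refine List.map_congr_left fun v _ => ?_
  simp only [Function.comp_apply, result]
  rcases h : P.eff a v with _ | x
  · simp [valueToken]
  · have : valueToken (some x) ≠ undef := by simp
    simp [beq_eq_false_iff_ne.2 this]

/-- The state after an action sequence, whether the actions are valid or not. -/
def run (s : P.State) (ω : List P.Action) : P.State := ω.foldl (fun s a => P.result a s) s

variable {P}

theorem IsPlanFromTo.run_eq {ω : List P.Action} : ∀ {s t : P.State},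
    P.IsPlanFromTo s ω t → P.run s ω = t := by
  induction ω with
  | nil => exact fun h => h
  | cons a ω ih => exact fun h => ih h.2

theorem IsPlanFromTo.valid {ω₁ ω₂ : List P.Action} {a : P.Action} : ∀ {s t : P.State},
    P.IsPlanFromTo s (ω₁ ++ a :: ω₂) t → P.Valid a (P.run s ω₁) := by
  induction ω₁ with
  | nil => exact fun h => h.1
  | cons b ω₁ ih => exact fun h => ih h.2

/-- Once a precondition has failed, the fold is stuck, so the needs of the first failure survive to
the end. -/
theorem foldl_advance_of_unmet {x : List Token × List Token} (h : unmet x.2 = true)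
    (ω : List RawAction) : ω.foldl advance x = x := by
  induction ω with
  | nil => rfl
  | cons a ω ih => rw [List.foldl_cons, advance, h, cond_true, ih]

/-- The test lags one action behind: `advance` applies an action and records its needs in the state
before it, and only the next step looks at them. At the end either all actions were valid and the
needs of the last one are met, or the recorded needs are those of the first invalid action. -/
theorem foldl_advance (ω : List P.Action) : ∀ (s : P.State) (N : List Token), unmet N = false →
    (∃ N', P.IsPlanFromTo s ω (P.run s ω) ∧ unmet N' = false ∧
      (ω.map P.rawAction).foldl advance (P.totalTokens s, N) =
        (P.totalTokens (P.run s ω), N')) ∨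
    ∃ ω₁ a ω₂, ω = ω₁ ++ a :: ω₂ ∧
      unmet ((ω.map P.rawAction).foldl advance (P.totalTokens s, N)).2 = true ∧
      ((ω.map P.rawAction).foldl advance (P.totalTokens s, N)).2 =
        stateTokens (P.lacking (P.pre a) (P.run s ω₁)) := by
  induction ω with
  | nil => exact fun s N hN => .inl ⟨N, rfl, hN, rfl⟩
  | cons a ω ih =>
    intro s N hN
    have hadv : advance (P.totalTokens s, N) (P.rawAction a) =
        (P.totalTokens (P.result a s), stateTokens (P.lacking (P.pre a) s)) := by
      simp [advance, hN, rawAction, update_stateTokens, needs_stateTokens]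
    rw [List.map_cons, List.foldl_cons, hadv]
    cases h : unmet (stateTokens (P.lacking (P.pre a) s))
    · rcases ih (P.result a s) _ h with ⟨N', h₁, h₂, h₃⟩ | ⟨ω₁, b, ω₂, rfl, h₂, h₃⟩
      · exact .inl ⟨N', ⟨P.unmet_lacking_pre.1 h, h₁⟩, h₂, h₃⟩
      · exact .inr ⟨a :: ω₁, b, ω₂, rfl, h₂, h₃⟩
    · rw [foldl_advance_of_unmet h]
      exact .inr ⟨[], a, ω, rfl, h, rfl⟩

/-- The goal plays the role of the precondition of a last action: the failure lies after a prefix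
`ω₁`, at a condition `p` that is either the goal or the precondition of the next action. -/
theorem missing_cases (ω : List P.Action) :
    (P.IsPlan ω ∧ unmet (missing P.raw (ω.map P.rawAction)) = false) ∨
    (unmet (missing P.raw (ω.map P.rawAction)) = true ∧ ∃ ω₁ ω₂ p, ω = ω₁ ++ ω₂ ∧
      missing P.raw (ω.map P.rawAction) = stateTokens (P.lacking p (P.run P.init ω₁)) ∧
      ((ω₂ = [] ∧ p = P.goal) ∨ ∃ a ω₃, ω₂ = a :: ω₃ ∧ p = P.pre a)) := by
  unfold missing
  rcases foldl_advance ω P.init [] rfl with ⟨N', h₁, h₂, h₃⟩ | ⟨ω₁, a, ω₂, h₁, h₂, h₃⟩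
  · simp only [raw] at *
    rw [h₃, h₂, cond_false, needs_stateTokens]
    cases h : unmet (stateTokens (P.lacking P.goal (P.run P.init ω)))
    · exact .inl ⟨⟨_, P.unmet_lacking_goal.1 h, h₁⟩, rfl⟩
    · exact .inr ⟨rfl, ω, [], _, by simp, rfl, .inl ⟨rfl, rfl⟩⟩
  · simp only [raw] at *
    rw [h₂, cond_true]
    exact .inr ⟨h₂, ω₁, _, _, h₁, h₃, .inr ⟨a, ω₂, rfl, rfl⟩⟩

theorem isPlan_iff_missing {ω : List P.Action} :
    P.IsPlan ω ↔ unmet (missing P.raw (ω.map P.rawAction)) = false := by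
  rcases missing_cases ω with ⟨h₁, h₂⟩ | ⟨h, ω₁, ω₂, p, rfl, h₁, h₂⟩
  · exact ⟨fun _ => h₂, fun _ => h₁⟩
  · rw [h]
    refine ⟨fun ⟨t, ht, hω⟩ => ?_, by simp⟩
    rw [h₁] at h
    refine (Bool.eq_false_iff.1 ?_ h).elim
    rcases h₂ with ⟨rfl, rfl⟩ | ⟨a, ω₃, rfl, rfl⟩
    · rw [List.append_nil] at hω
      rwa [unmet_lacking_goal, hω.run_eq]
    · exact P.unmet_lacking_pre.2 hω.valid

/-- If an action sequence and a subsequence of it differ in the final value of a variable, then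
an action that sets the variable to this value can be added to the subsequence. -/
theorem exists_insertion {v : Fin P.numVars} {x : Fin P.numVals} {ω σ : List P.Action}
    (h : ω.Sublist σ) : ∀ {s s' : P.State}, P.run s σ v = x → P.run s' ω v ≠ x →
      (∃ c ω₁ ω₂, P.eff c v = some x ∧ ω = ω₁ ++ ω₂ ∧ (ω₁ ++ c :: ω₂).Sublist σ) ∨
      (s v = x ∧ s' v ≠ x) := by
  induction h with
  | slnil => exact fun h₁ h₂ => .inr ⟨h₁, h₂⟩
  -- If the extra action of `σ` sets `v`, then it sets it to `x` and can be added in front of `ω`;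
  -- otherwise the two states differed on `v` already before it.
  | @cons ω σ a h ih =>
    intro s s' h₁ h₂
    rcases ih (s := P.result a s) h₁ h₂ with ⟨c, ω₁, ω₂, hc, rfl, hs⟩ | ⟨h₃, h₄⟩
    · exact .inl ⟨c, ω₁, ω₂, hc, rfl, hs.cons a⟩
    · unfold result at h₃
      rcases he : P.eff a v with _ | y
      · exact .inr ⟨by simpa [he] using h₃, h₄⟩
      · obtain rfl : y = x := by simpa [he] using h₃
        exact .inl ⟨a, [], ω, he, rfl, h.cons_cons a⟩
  | @cons_cons ω σ a h ih =>
    intro s s' h₁ h₂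
    rcases ih (s := P.result a s) (s' := P.result a s') h₁ h₂ with
      ⟨c, ω₁, ω₂, hc, rfl, hs⟩ | ⟨h₃, h₄⟩
    · exact .inl ⟨c, a :: ω₁, ω₂, hc, rfl, hs.cons_cons a⟩
    · unfold result at h₃ h₄
      rcases he : P.eff a v with _ | y
      · exact .inr ⟨by simpa [he] using h₃, by simpa [he] using h₄⟩
      · simp only [he, Option.getD_some] at h₃ h₄
        exact (h₄ h₃).elim

theorem supplies_iff {p : Fin P.numVars → Option (Fin P.numVals)} {a : P.Action} :
    supplies (stateTokens p) (P.rawAction a) = true ↔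
      ∃ v x, p v = some x ∧ P.eff a v = some x := by
  simp only [supplies, rawAction, stateTokens, List.zip_map', List.any_map, List.any_eq_true,
    List.mem_finRange, true_and, Function.comp_apply, Bool.and_eq_true, Bool.not_eq_true',
    beq_eq_false_iff_ne, beq_iff_eq, valueToken_injective.eq_iff, ne_eq, valueToken_eq_undef]
  refine exists_congr fun v => ⟨fun ⟨h₁, h₂⟩ => ?_, ?_⟩
  · obtain ⟨x, hx⟩ := Option.ne_none_iff_exists'.1 h₁
    exact ⟨x, hx, h₂ ▸ hx⟩
  · rintro ⟨x, h₁, h₂⟩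
    simp [h₁, h₂]

/-- In a post-unique instance, an action sequence that is contained in a plan but is not a plan
has a child that is contained in the plan. -/
theorem exists_child (hP : P.PostUnique) {ω σ : List P.Action} (hσ : P.IsPlan σ)
    (h : ω.Sublist σ) (hω : unmet (missing P.raw (ω.map P.rawAction)) = true) :
    ∃ ω' : List P.Action, ω'.Sublist σ ∧ ω'.length = ω.length + 1 ∧
      ω'.map P.rawAction ∈ children P.raw (missing P.raw (ω.map P.rawAction))
        (ω.map P.rawAction) := by
  rcases missing_cases ω with ⟨-, h₂⟩ | ⟨-, ω₁, ω₂, p, rfl, h₁, h₂⟩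
  · simp [h₂] at hω
  rw [h₁] at hω ⊢
  set q := P.lacking p (P.run P.init ω₁) with hq
  -- Each need at the failure is met at the matching point of the plan `σ`. So an action that
  -- supplies it can be inserted before the failure, within `σ`.
  have key : ∀ v x, q v = some x → ∃ c ω₃ ω₄, P.eff c v = some x ∧ ω₁ = ω₃ ++ ω₄ ∧
      (ω₃ ++ c :: ω₄ ++ ω₂).Sublist σ := by
    intro v x hv
    obtain ⟨hp, hne⟩ := P.lacking_eq_some.1 hv
    obtain ⟨t, ht, hplan⟩ := hσ
    rcases h₂ with ⟨rfl, rfl⟩ | ⟨a, ω₂, rfl, rfl⟩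
    · rw [List.append_nil] at h
      have hx : P.run P.init σ v = x := by
        rw [hplan.run_eq]
        have := ht v
        simp_all
      rcases exists_insertion h hx hne with ⟨c, ω₃, ω₄, hc, h₃, h₄⟩ | ⟨h₃, h₄⟩
      · exact ⟨c, ω₃, ω₄, hc, h₃, by simpa using h₄⟩
      · exact (h₄ h₃).elim
    · obtain ⟨σ₁, σ₂, rfl, hs₁, hs₂⟩ := List.append_sublist_iff.1 h
      obtain ⟨τ₁, τ₂, rfl, hmem, hs₃⟩ := List.cons_sublist_iff.1 hs₂
      obtain ⟨τ₃, τ₄, rfl⟩ := List.append_of_mem hmem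
      have hplan' : P.IsPlanFromTo P.init ((σ₁ ++ τ₃) ++ a :: (τ₄ ++ τ₂)) t := by
        simpa using hplan
      have hx : P.run P.init (σ₁ ++ τ₃) v = x := by
        have := hplan'.valid v
        simp_all
      rcases exists_insertion (hs₁.trans (List.sublist_append_left σ₁ τ₃)) hx hne with
        ⟨c, ω₃, ω₄, hc, h₃, h₄⟩ | ⟨h₃, h₄⟩
      · refine ⟨c, ω₃, ω₄, hc, h₃, ?_⟩
        have := h₄.append ((hs₃.trans (List.sublist_append_right τ₄ τ₂)).cons_cons a)
        simpa using this
      · exact (h₄ h₃).elim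
  have hex : ∃ v x, q v = some x := by
    by_contra hno
    refine Bool.eq_false_iff.1 (P.unmet_stateTokens.2 fun v => ?_) hω
    rcases hv : q v with _ | x
    · rfl
    · exact (hno ⟨v, x, hv⟩).elim
  obtain ⟨v, x, hv⟩ := hex
  obtain ⟨c, -, -, hc, -⟩ := key v x hv
  have hmem : P.rawAction c ∈ P.raw.2.2.filter (supplies (stateTokens q)) :=
    List.mem_filter.2 ⟨List.mem_map_of_mem (List.mem_finRange c),
      supplies_iff.2 ⟨v, x, hv, hc⟩⟩
  unfold children
  rcases hf : P.raw.2.2.filter (supplies (stateTokens q)) with _ | ⟨d, l⟩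
  · simp [hf] at hmem
  · obtain ⟨hd₁, hd₂⟩ := List.mem_filter.1 (hf ▸ List.mem_cons_self :
      d ∈ P.raw.2.2.filter (supplies (stateTokens q)))
    obtain ⟨a, -, rfl⟩ := List.mem_map.1 hd₁
    obtain ⟨w, y, hw, ha⟩ := supplies_iff.1 hd₂
    obtain ⟨b, ω₃, ω₄, hb, rfl, hs⟩ := key w y hw
    -- The search takes the first action in the list that supplies some need. By post-uniqueness it
    -- is the very action that `key` inserts for this need; its position does not matter, since all
    -- insertions are children.
    obtain rfl := hP w y a b ha hb
    refine ⟨_, hs, by simp; omega, mem_insertions.2 ⟨ω₃.map P.rawAction,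
      (ω₄ ++ ω₂).map P.rawAction, by simp, by simp⟩⟩

/-- Descend through the subsequences of `σ`: as long as they are not plans, `exists_child` provides
a child inside `σ`, and by minimality the first plan reached is `σ`. At depth `0` the length is `k`,
which leaves no room in `σ` for a child. -/
theorem mem_found (hP : P.PostUnique) {k : ℕ} {σ : List P.Action} (hσ : P.IsMinimalPlan σ)
    (hk : σ.length ≤ k) (r : ℕ) : ∀ ω : List P.Action, ω.Sublist σ → ω.length + r = k →
      σ.map P.rawAction ∈ found P.raw r (ω.map P.rawAction) := by
  have hplan : ∀ ω : List P.Action, ω.Sublist σ →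
      unmet (missing P.raw (ω.map P.rawAction)) = false → σ = ω := by
    intro ω h hω
    by_contra hne
    exact hσ.2 ω h (Ne.symm hne) (isPlan_iff_missing.2 hω)
  induction r with
  | zero =>
    intro ω h hlen
    unfold found
    cases hω : unmet (missing P.raw (ω.map P.rawAction))
    · simp [hplan ω h hω]
    · obtain ⟨ω', h₁, h₂, -⟩ := exists_child hP hσ.1 h hω
      have := h₁.length_le
      omega
  | succ r ih =>
    intro ω h hlen
    unfold found
    cases hω : unmet (missing P.raw (ω.map P.rawAction))
    · simp [hplan ω h hω]
    · obtain ⟨ω', h₁, h₂, h₃⟩ := exists_child hP hσ.1 h hω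
      exact List.mem_flatMap.2 ⟨_, h₃, ih ω' h₁ (by omega)⟩

theorem exists_minimal_plan (ω : List P.Action) (hω : P.IsPlan ω) :
    ∃ ω' : List P.Action, ω'.Sublist ω ∧ P.IsMinimalPlan ω' := by
  by_cases h : ∃ ω' : List P.Action, ω'.Sublist ω ∧ ω' ≠ ω ∧ P.IsPlan ω'
  · obtain ⟨ω', h₁, h₂, h₃⟩ := h
    have : ω'.length < ω.length :=
      lt_of_le_of_ne h₁.length_le fun h => h₂ (h₁.eq_of_length h)
    obtain ⟨ω'', h₄, h₅⟩ := exists_minimal_plan ω' h₃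
    exact ⟨ω'', h₄.trans h₁, h₅⟩
  · push Not at h
    exact ⟨ω, List.Sublist.refl _, hω, h⟩
termination_by ω.length

end SASInstance

theorem of_mem_found {R : RawInstance} {k : ℕ} (r : ℕ) : ∀ {ω ω' : List RawAction},
    ω' ∈ found R r ω → ω.length + r ≤ k → (∀ a ∈ ω, a ∈ R.2.2) →
      unmet (missing R ω') = false ∧ ω'.length ≤ k ∧ ∀ a ∈ ω', a ∈ R.2.2 := by
  induction r with
  | zero =>
    intro ω ω' h hlen hω
    unfold found at h
    cases hu : unmet (missing R ω) <;> rw [hu] at h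
    · obtain rfl : ω' = ω := by simpa using h
      exact ⟨hu, hlen, hω⟩
    · simp at h
  | succ r ih =>
    intro ω ω' h hlen hω
    unfold found at h
    cases hu : unmet (missing R ω) <;> rw [hu] at h
    · obtain rfl : ω' = ω := by simpa using h
      exact ⟨hu, by omega, hω⟩
    · obtain ⟨σ, h₁, h₂⟩ := List.mem_flatMap.1 h
      exact ih h₂ (by rw [length_of_mem_children h₁]; omega) (subset_of_mem_children h₁ hω)

theorem mem_foldl_keep_true {F : List (List RawAction)} {ω : List RawAction} :
    ω ∈ F.foldl (keep true) [] ↔ ω ∈ F := by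
  have key : ∀ F A : List (List RawAction), F.foldl (keep true) A = F.reverse ++ A := by
    intro F
    induction F with
    | nil => simp
    | cons ω F ih => simp [ih, keep]
  simp [key]

/-- Keeping only the last plan loses nothing for the decision problem, which asks only whether there
is one. -/
theorem foldl_keep_false_isEmpty (F : List (List RawAction)) :
    (F.foldl (keep false) []).isEmpty = F.isEmpty := by
  have key : ∀ (F : List (List RawAction)) (ω : List RawAction),
      (F.foldl (keep false) [ω]).isEmpty = false := by
    intro F
    induction F with
    | nil => simp
    | cons ω F ih => intro ω'; exact ih ω
  cases F with
  | nil => rfl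
  | cons ω F => exact key F ω

/-- Greedy matching suffices: if the next element of `l` equals the current one of `m`, then it can
be matched there without loss. -/
theorem isSubsequence_iff {α : Type} [BEq α] [LawfulBEq α] {l m : List α} :
    isSubsequence l m = true ↔ l.Sublist m := by
  unfold isSubsequence
  induction m generalizing l with
  | nil => cases l <;> simp
  | cons b m ih =>
    rw [List.foldl_cons, ih]
    cases l with
    | nil => simp
    | cons a l =>
      by_cases h : a = b
      · subst h; simp
      · simp only [beq_eq_false_iff_ne.2 h, cond_false]
        exact ⟨fun h => h.cons b, fun h' => by
          cases h' with
          | cons _ h' => exact h'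
          | cons_cons _ h' => exact (h rfl).elim⟩

namespace SASInstance

variable {P : SASInstance}

theorem exists_map_rawAction {ω : List RawAction} (h : ∀ a ∈ ω, a ∈ P.raw.2.2) :
    ∃ ω' : List P.Action, ω'.map P.rawAction = ω := by
  have : ω ∈ Set.range (List.map P.rawAction) := by
    rw [Set.range_list_map]
    exact fun a ha => (List.mem_map.1 (h a ha)).imp fun _ h => h.2
  exact this

/-- The search aims at minimal plans only, but every plan contains a minimal one, which is not
longer. -/
theorem found_ne_nil_iff (hP : P.PostUnique) (k : ℕ) :
    found P.raw k [] ≠ [] ↔ ∃ ω : List P.Action, P.IsPlan ω ∧ ω.length ≤ k := by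
  constructor
  · intro h
    obtain ⟨ω, hω⟩ := List.exists_mem_of_ne_nil _ h
    obtain ⟨h₁, h₂, h₃⟩ := of_mem_found (k := k) k hω (by simp) (by simp)
    obtain ⟨ω, rfl⟩ := exists_map_rawAction h₃
    exact ⟨ω, isPlan_iff_missing.2 h₁, by simpa using h₂⟩
  · rintro ⟨ω, hω, hk⟩
    obtain ⟨σ, h₁, h₂⟩ := exists_minimal_plan ω hω
    exact List.ne_nil_of_mem (mem_found hP h₂ (h₁.length_le.trans hk) k [] (by simp) (by simp))

end SASInstance

/-! ### Correctness of reading, checking and writing -/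

theorem encodeNumeral_eq (n : ℕ) : encodeNumeral n = numeral n ++ [Γ'.comma] := rfl

theorem encodeValue_eq {d : ℕ} (x : Option (Fin d)) :
    encodeValue x = valueToken x ++ [Γ'.comma] := by
  cases x <;> rfl

theorem encodePartialState_eq {n d : ℕ} (s : Fin n → Option (Fin d)) :
    encodePartialState s = renderState (stateTokens s) := by
  have : (encodeValue (d := d)) = fun x => valueToken x ++ [Γ'.comma] := funext encodeValue_eq
  simp [encodePartialState, renderState, stateTokens, this, List.ofFn_eq_map, List.flatMap_map]

theorem SASInstance.encode_eq (P : SASInstance) :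
    P.encode = render (numeral P.numVals, P.raw) := by
  simp [SASInstance.encode, render, encodePartialState_eq, raw, encodeNumeral_eq, rawAction,
    totalTokens, List.flatMap_map]

/-! #### Numerals -/

theorem numeral_zero : numeral 0 = [] := by simp [numeral]

theorem numeral_bit {b : Bool} {n : ℕ} (h : n = 0 → b = true) :
    numeral (Nat.bit b n) = Γ'.bit b :: numeral n := by
  simp [numeral, Nat.bits_append_bit _ _ h]

theorem numeral_eq_nil {n : ℕ} : numeral n = [] ↔ n = 0 :=
  numeral_injective.eq_iff' numeral_zero

theorem mem_numeral {n : ℕ} {g : Γ'} (h : g ∈ numeral n) : ∃ b, g = Γ'.bit b := by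
  obtain ⟨b, -, rfl⟩ := List.mem_map.1 h
  exact ⟨b, rfl⟩

/-- The addition of a carry to a binary numeral. -/
def addCarry : Bool → Token → Token
  | c, [] => bif c then [Γ'.bit true] else []
  | c, g :: t => (bif c then (bif g == Γ'.bit true then Γ'.bit false else Γ'.bit true) else g) ::
      addCarry (c && g == Γ'.bit true) t

/-- This replaces the fold with a reversed accumulator by a recursion that follows the bits. -/
theorem succToken_eq (t : Token) : succToken t = addCarry true t := by
  have key : ∀ (t : Token) (c : Bool) (acc : Token),
      (bif (t.foldl (fun s g => (s.1 && g == Γ'.bit true,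
        (bif s.1 then (bif g == Γ'.bit true then Γ'.bit false else Γ'.bit true) else g) :: s.2))
        (c, acc)).1 then Γ'.bit true :: (t.foldl (fun s g => (s.1 && g == Γ'.bit true,
        (bif s.1 then (bif g == Γ'.bit true then Γ'.bit false else Γ'.bit true) else g) :: s.2))
        (c, acc)).2 else (t.foldl (fun s g => (s.1 && g == Γ'.bit true,
        (bif s.1 then (bif g == Γ'.bit true then Γ'.bit false else Γ'.bit true) else g) :: s.2))
        (c, acc)).2).reverse = acc.reverse ++ addCarry c t := by
    intro t
    induction t with
    | nil => intro c acc; cases c <;> simp [addCarry]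
    | cons g t ih =>
      intro c acc
      simp only [List.foldl_cons]
      rw [ih]
      simp [addCarry]
  exact key t true []

theorem addCarry_false (t : Token) : addCarry false t = t := by
  induction t with
  | nil => rfl
  | cons g t ih => simp [addCarry, ih]

theorem succToken_numeral (n : ℕ) : succToken (numeral n) = numeral (n + 1) := by
  rw [succToken_eq]
  induction n using Nat.binaryRec' with
  | zero => rw [numeral_zero, zero_add, show 1 = Nat.bit true 0 from rfl, numeral_bit (by simp)]; rfl
  | bit b n hb ih =>
    rw [numeral_bit hb]
    cases b
    · have : Nat.bit false n + 1 = Nat.bit true n := by simp [Nat.bit_val]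
      have hg : (Γ'.bit false == Γ'.bit true) = false := rfl
      rw [this, numeral_bit (by simp)]
      simp [addCarry, addCarry_false, hg]
    · have : Nat.bit true n + 1 = Nat.bit false (n + 1) := by simp [Nat.bit_val]; ring
      rw [this, numeral_bit (by simp)]
      simp [addCarry, ih]

/-- The value of a binary numeral. -/
def tokenVal (t : Token) : ℕ := t.foldr (fun g n => Nat.bit (g == Γ'.bit true) n) 0

theorem tokenVal_numeral (n : ℕ) : tokenVal (numeral n) = n := by
  induction n using Nat.binaryRec' with
  | zero => simp [numeral_zero, tokenVal]
  | bit b n hb ih =>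
    rw [numeral_bit hb]
    unfold tokenVal at *
    rw [List.foldr_cons, ih]
    cases b <;> rfl

theorem isNumeral_numeral (n : ℕ) : isNumeral (numeral n) = true := by
  have h₁ : ∀ g ∈ numeral n, g = Γ'.bit false ∨ g = Γ'.bit true := by
    intro g hg
    obtain ⟨_ | _, rfl⟩ := mem_numeral hg <;> simp
  have h₂ : (numeral n).reverse.headD (Γ'.bit true) ≠ Γ'.bit false := by
    induction n using Nat.binaryRec' with
    | zero => simp [numeral_zero]
    | bit b n hb ih =>
      rw [numeral_bit hb, List.reverse_cons]
      rcases h : (numeral n).reverse with _ | ⟨g, t⟩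
      · have : n = 0 := numeral_eq_nil.1 (by simpa using h)
        simp [hb this]
      · rw [h] at ih
        simpa using ih fun g hg => by
          obtain ⟨_ | _, rfl⟩ := mem_numeral hg <;> simp
  simp only [isNumeral, Bool.and_eq_true, List.all_eq_true, Bool.or_eq_true, beq_iff_eq,
    Bool.not_eq_true', beq_eq_false_iff_ne]
  exact ⟨h₁, h₂⟩

theorem isNumeral_iff {t : Token} : isNumeral t = true ↔ t = numeral (tokenVal t) := by
  refine ⟨fun h => ?_, fun h => h ▸ isNumeral_numeral _⟩
  simp only [isNumeral, Bool.and_eq_true, List.all_eq_true, Bool.or_eq_true, beq_iff_eq,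
    Bool.not_eq_true', beq_eq_false_iff_ne] at h
  obtain ⟨h₁, h₂⟩ := h
  induction t with
  | nil => simp [tokenVal, numeral_zero]
  | cons g t ih =>
    simp only [List.mem_cons, forall_eq_or_imp] at h₁
    have hg : g = Γ'.bit (g == Γ'.bit true) := by
      rcases h₁.1 with rfl | rfl <;> rfl
    have htail : t = numeral (tokenVal t) := by
      refine ih h₁.2 ?_
      rw [List.reverse_cons] at h₂
      rcases h : t.reverse with _ | ⟨g', t'⟩
      · simp
      · rw [h] at h₂
        simpa using h₂
    have : tokenVal (g :: t) = Nat.bit (g == Γ'.bit true) (tokenVal t) := rfl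
    rw [this, numeral_bit, ← htail, ← hg]
    -- If the tail has value `0`, then it is empty, so `g` is the most significant bit and must be
    -- `1`.
    intro h
    rw [h, numeral_zero] at htail
    subst htail
    simp only [List.reverse_cons, List.reverse_nil, List.nil_append, List.headD_cons] at h₂
    simpa [h₂] using h₁.1

/-- Higher bits override lower ones, so `r`, the verdict of the bits already read, counts only in
case of a tie. -/
theorem foldl_lessToken (l : List (Γ' × Γ'))
    (hl : ∀ x ∈ l, (∃ b, x.1 = Γ'.bit b) ∧ ∃ b, x.2 = Γ'.bit b) : ∀ r : Bool,
    l.foldl (fun r x => bif x.1 == x.2 then r else x.2 == Γ'.bit true) r =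
      decide (tokenVal (l.map (·.1)) < tokenVal (l.map (·.2)) ∨
        (tokenVal (l.map (·.1)) = tokenVal (l.map (·.2)) ∧ r = true)) := by
  induction l with
  | nil => intro r; simp [tokenVal]
  | cons x l ih =>
    intro r
    simp only [List.mem_cons, forall_eq_or_imp] at hl
    obtain ⟨⟨⟨a, ha⟩, b, hb⟩, hl⟩ := hl
    obtain ⟨x, y⟩ := x
    simp only at ha hb
    subst ha hb
    have hval : ∀ (b : Bool) (t : Token),
        tokenVal (Γ'.bit b :: t) = 2 * tokenVal t + b.toNat := by
      intro b t
      change Nat.bit _ (tokenVal t) = _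
      rw [Nat.bit_val]
      cases b <;> rfl
    rw [List.foldl_cons, ih hl]
    simp only [List.map_cons, hval, decide_eq_decide]
    generalize tokenVal (l.map (·.1)) = m
    generalize tokenVal (l.map (·.2)) = n
    cases a <;> cases b <;> simp <;> omega

theorem tokenVal_append_zeros (t : Token) {α : Type} (l : List α) :
    tokenVal (t ++ l.map fun _ => Γ'.bit false) = tokenVal t := by
  induction t with
  | nil =>
    induction l with
    | nil => rfl
    | cons a l ih =>
      unfold tokenVal at *
      simp only [List.nil_append, List.map_cons, List.foldr_cons] at *
      rw [ih]
      rfl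
  | cons g t ih =>
    unfold tokenVal at *
    rw [List.cons_append, List.foldr_cons, ih, List.foldr_cons]

theorem lessToken_numeral (m n : ℕ) : lessToken (numeral m) (numeral n) = decide (m < n) := by
  unfold lessToken
  have hbit : ∀ (k l : ℕ), ∀ g ∈ numeral k ++ (numeral l).map fun _ => Γ'.bit false,
      ∃ b, g = Γ'.bit b := by
    intro k l g hg
    rcases List.mem_append.1 hg with h | h
    · exact mem_numeral h
    · obtain ⟨-, -, rfl⟩ := List.mem_map.1 h
      exact ⟨_, rfl⟩
  rw [foldl_lessToken]
  · have e : ((numeral m ++ (numeral n).map fun _ => Γ'.bit false)).length =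
        (numeral n ++ (numeral m).map fun _ => Γ'.bit false).length := by
      simp [add_comm]
    rw [List.map_fst_zip e.le, List.map_snd_zip e.ge, tokenVal_append_zeros,
      tokenVal_append_zeros, tokenVal_numeral, tokenVal_numeral]
    simp
  · rintro ⟨g, g'⟩ h
    exact ⟨hbit _ _ _ (List.of_mem_zip h).1, hbit _ _ _ (List.of_mem_zip h).2⟩

theorem isValue_numeral_iff {d : ℕ} {t : Token} :
    isValue (numeral d) t = true ↔ ∃ x : Fin d, t = numeral x := by
  unfold isValue
  rw [Bool.and_eq_true]
  constructor
  · rintro ⟨h₁, h₂⟩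
    rw [isNumeral_iff] at h₁
    rw [h₁, lessToken_numeral, decide_eq_true_iff] at h₂
    exact ⟨⟨_, h₂⟩, h₁⟩
  · rintro ⟨x, rfl⟩
    simp [isNumeral_numeral, lessToken_numeral]

/-! #### Parsing -/

/-- The token has only bits and blanks. -/
def Clean (t : Token) : Prop := ∀ g ∈ t, g = Γ'.blank ∨ ∃ b, g = Γ'.bit b

theorem clean_numeral (n : ℕ) : Clean (numeral n) := fun _ hg => .inr (mem_numeral hg)

theorem clean_valueToken {d : ℕ} (x : Option (Fin d)) : Clean (valueToken x) := by
  cases x with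
  | none => simp [valueToken, undef, Clean]
  | some x => exact clean_numeral x

theorem foldr_tokenStep_token {t : Token} (ht : Clean t) (s : List Token × List (List Token)) :
    (t ++ [Γ'.comma]).foldr tokenStep s = (t :: s.1, s.2) := by
  induction t with
  | nil => rfl
  | cons g t ih =>
    simp only [Clean, List.mem_cons, forall_eq_or_imp] at ht
    rw [List.cons_append, List.foldr_cons, ih ht.2]
    rcases ht.1 with rfl | ⟨b, rfl⟩ <;> rfl

theorem foldr_tokenStep_tokens {l : List Token} (hl : ∀ t ∈ l, Clean t)
    (s : List Token × List (List Token)) :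
    (l.flatMap fun t => t ++ [Γ'.comma]).foldr tokenStep s = (l ++ s.1, s.2) := by
  induction l with
  | nil => rfl
  | cons t l ih =>
    simp only [List.mem_cons, forall_eq_or_imp] at hl
    rw [List.flatMap_cons, List.foldr_append, ih hl.2, foldr_tokenStep_token hl.1]
    rfl

theorem foldr_tokenStep_state {l : List Token} (hl : ∀ t ∈ l, Clean t)
    (s : List (List Token)) :
    (renderState l).foldr tokenStep ([], s) = ([], l :: s) := by
  unfold renderState
  rw [List.cons_append, List.foldr_cons, List.foldr_append, List.foldr_cons, List.foldr_nil]
  simp only [tokenStep]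
  rw [foldr_tokenStep_tokens hl]
  simp

theorem foldr_tokenStep_states {l : List (List Token)} (hl : ∀ s ∈ l, ∀ t ∈ s, Clean t) :
    (l.flatMap renderState).foldr tokenStep ([], []) = ([], l) := by
  induction l with
  | nil => rfl
  | cons s l ih =>
    simp only [List.mem_cons, forall_eq_or_imp] at hl
    rw [List.flatMap_cons, List.foldr_append, ih hl.2, foldr_tokenStep_state hl.1]

theorem pairUp_flatMap {α : Type} (l : List (α × α)) :
    pairUp (l.flatMap fun p => [p.1, p.2]) = l := by
  have key : (l.flatMap fun p => [p.1, p.2]).foldr (fun t s => match s.1 with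
      | [] => ([t], s.2)
      | e :: _ => (([] : List α), (t, e) :: s.2)) ([], []) = ([], l) := by
    induction l with
    | nil => rfl
    | cons p l ih => rw [List.flatMap_cons, List.foldr_append, ih]; rfl
  exact congrArg Prod.snd key

theorem number_eq (l : List (List Token × List Token)) :
    number l = l.mapIdx fun i p => (numeral i, p) := by
  have key : ∀ (l : List (List Token × List Token)) (n : ℕ) (A : List RawAction),
      (l.foldl (fun s p => (succToken s.1, (s.1, p.1, p.2) :: s.2)) (numeral n, A)).2.reverse =
        A.reverse ++ l.mapIdx fun i p => (numeral (i + n), p) := by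
    intro l
    induction l with
    | nil => simp
    | cons p l ih =>
      intro n A
      rw [List.foldl_cons, succToken_numeral, ih, List.mapIdx_cons]
      simp [add_comm, add_left_comm]
  have := key l 0 []
  rw [numeral_zero] at this
  simpa [number] using this

theorem number_map_finRange {n : ℕ} (f : Fin n → List Token × List Token) :
    number ((List.finRange n).map f) = (List.finRange n).map fun i : Fin n => (numeral i, f i) := by
  rw [number_eq]
  refine List.ext_getElem (by simp) fun i h₁ h₂ => ?_
  simp

theorem clean_of_mem_stateTokens {n d : ℕ} {s : Fin n → Option (Fin d)} {t : Token}
    (h : t ∈ stateTokens s) : Clean t := by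
  obtain ⟨v, -, rfl⟩ := List.mem_map.1 h
  exact clean_valueToken _

theorem SASInstance.parse_encode (P : SASInstance) :
    parse P.encode = (numeral P.numVals, P.raw) := by
  have h : tokenize P.encode = ([numeral P.numVals], P.totalTokens P.init ::
      stateTokens P.goal :: (P.raw.2.2.map (·.2)).flatMap fun p => [p.1, p.2]) := by
    -- After the domain size the encoding is a flat sequence of tuples, in which preconditions and
    -- effects alternate; `pairUp` undoes this.
    have e : P.encode = numeral P.numVals ++ [Γ'.comma] ++ (P.totalTokens P.init ::
        stateTokens P.goal ::
        (P.raw.2.2.map (·.2)).flatMap fun p => [p.1, p.2]).flatMap renderState := by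
      rw [P.encode_eq]
      simp [render, raw, List.flatMap_map, List.flatMap_assoc]
    rw [e, tokenize, List.foldr_append, foldr_tokenStep_states,
      foldr_tokenStep_token (clean_numeral _)]
    intro s hs t ht
    simp only [List.mem_cons, List.mem_flatMap, List.mem_map, raw] at hs
    rcases hs with rfl | rfl | ⟨-, ⟨-, ⟨a, -, rfl⟩, rfl⟩, rfl | rfl | h⟩
    iterate 4 exact clean_of_mem_stateTokens ht
    simp at h
  unfold parse
  rw [h]
  simp only [List.headD_cons, List.tail_cons, pairUp_flatMap]
  simp only [raw, List.map_map, Prod.mk.injEq, true_and]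
  exact number_map_finRange fun a => (P.rawAction a).2

/-! #### Checking -/

theorem isPartialState_stateTokens {n m d : ℕ} (f : Fin n → Option (Fin d))
    {I : List Token} (hI : I.length = m) (h : m = n) :
    isPartialState (numeral d) I (stateTokens f) = true := by
  unfold isPartialState
  have : ∀ v, f v = none ∨ isValue (numeral d) (valueToken (f v)) = true := by
    intro v
    rcases f v with _ | x
    · exact .inl rfl
    · exact .inr (isValue_numeral_iff.2 ⟨x, rfl⟩)
  simp [stateTokens, hI, h, this]

theorem exists_of_isPartialState {d : ℕ} {I s : List Token}
    (h : isPartialState (numeral d) I s = true) :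
    ∃ f : Fin I.length → Option (Fin d), s = stateTokens f := by
  simp only [isPartialState, Bool.and_eq_true, List.isEmpty_iff, List.drop_eq_nil_iff,
    List.all_eq_true, Bool.or_eq_true, beq_iff_eq] at h
  obtain ⟨⟨h₁, h₂⟩, h₃⟩ := h
  have hlen : s.length = I.length := by omega
  have key : ∀ i : Fin I.length, ∃ x : Option (Fin d), s[i.1] = valueToken x := by
    intro i
    rcases h₃ s[i.1] (List.getElem_mem _) with h | h
    · exact ⟨none, h⟩
    · obtain ⟨x, hx⟩ := isValue_numeral_iff.1 h
      exact ⟨some x, hx⟩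
  choose f hf using key
  refine ⟨f, List.ext_getElem (by simp [stateTokens, hlen]) fun i h₁ h₂ => ?_⟩
  simp [stateTokens, ← hf]

/-- Actions with equal preconditions and effects may still be different, so equality of actions is
read off from their names, which are injective. -/
theorem SASInstance.isPostUnique_raw (P : SASInstance) :
    isPostUnique P.raw.2.2 = true ↔ P.PostUnique := by
  have key : ∀ a b : P.Action, (P.rawAction a).1 = (P.rawAction b).1 ↔ a = b := fun a b =>
    (numeral_injective.comp Fin.val_injective).eq_iff
  have key' : ∀ a b : P.Action, (((P.rawAction a).2.2.zip (P.rawAction b).2.2).all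
      fun x => x.1 == undef || !(x.1 == x.2)) = true ↔
      ∀ v x, P.eff a v = some x → P.eff b v ≠ some x := by
    intro a b
    simp only [rawAction, stateTokens, List.zip_map', List.all_map, List.all_eq_true,
      List.mem_finRange, true_imp_iff, Function.comp_apply, Bool.or_eq_true, beq_iff_eq,
      Bool.not_eq_true', beq_eq_false_iff_ne, valueToken_eq_undef, ne_eq,
      valueToken_injective.eq_iff]
    refine forall_congr' fun v => ⟨fun h x hx hx' => ?_, fun h => ?_⟩
    · simp [hx, hx'] at h
    · rcases hv : P.eff a v with _ | x
      · exact .inl rfl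
      · exact .inr fun h' => h x hv h'.symm
  simp only [isPostUnique, raw, List.all_map, List.all_eq_true, List.mem_finRange, true_imp_iff,
    Function.comp_apply, Bool.or_eq_true, beq_iff_eq, key, key', PostUnique]
  constructor
  · intro h v x a b ha hb
    exact (h a b).resolve_right fun h => h v x ha hb
  · intro h a b
    by_cases hab : a = b
    · exact .inl hab
    · exact .inr fun v x ha hb => hab (h v x a b ha hb)

theorem SASInstance.wellFormed_encode (P : SASInstance) (hP : P.PostUnique) :
    wellFormed P.encode (numeral P.numVals, P.raw) = true := by
  have hlen : (P.totalTokens P.init).length = P.numVars := by simp [totalTokens, stateTokens]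
  have hI : ∀ v, isValue (numeral P.numVals) (valueToken (some (P.init v))) = true := fun v =>
    isValue_numeral_iff.2 ⟨_, rfl⟩
  have h := P.isPostUnique_raw.2 hP
  simp only [wellFormed, Bool.and_eq_true]
  refine ⟨⟨⟨⟨⟨by simp [P.encode_eq], isNumeral_numeral _⟩, ?_⟩,
    isPartialState_stateTokens _ hlen rfl⟩, ?_⟩, h⟩
  · simp [raw, totalTokens, stateTokens, hI]
  · simp only [raw, List.all_map, List.all_eq_true, Function.comp_apply, Bool.and_eq_true,
      rawAction]
    exact fun a _ => ⟨isPartialState_stateTokens _ hlen rfl, isPartialState_stateTokens _ hlen rfl⟩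

theorem exists_of_wellFormed {x : List Γ'} (h : wellFormed x (parse x) = true) :
    ∃ P : SASInstance, P.PostUnique ∧ P.encode = x ∧ parse x = (numeral P.numVals, P.raw) := by
  -- The only fact about the parser that is used is that it names the actions by their indices;
  -- everything else is guaranteed by the checks.
  have hA : ∃ l, (parse x).2.2.2 = number l := ⟨_, rfl⟩
  generalize parse x = Q at *
  obtain ⟨d, I, G, A⟩ := Q
  obtain ⟨l, rfl⟩ := hA
  simp only [wellFormed, Bool.and_eq_true, beq_iff_eq, List.all_eq_true] at h
  obtain ⟨⟨⟨⟨⟨h₁, h₂⟩, h₃⟩, h₄⟩, h₅⟩, h₆⟩ := h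
  rw [isNumeral_iff] at h₂
  generalize tokenVal d = D at h₂
  subst h₂
  obtain ⟨goal, rfl⟩ := exists_of_isPartialState h₄
  have hinit : ∀ i : Fin I.length, ∃ y : Fin D, I[i.1] = numeral y := fun i =>
    isValue_numeral_iff.1 (h₃ _ (List.getElem_mem _))
  choose init hinit using hinit
  have hl : ∀ i : Fin l.length, ∃ pe : (Fin I.length → Option (Fin D)) ×
      (Fin I.length → Option (Fin D)), l[i.1] = (stateTokens pe.1, stateTokens pe.2) := by
    intro i
    obtain ⟨hp, he⟩ := h₅ (numeral i, l[i.1]) (by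
      rw [number_eq, List.mem_mapIdx]
      exact ⟨i, i.2, rfl⟩)
    obtain ⟨p, hp⟩ := exists_of_isPartialState hp
    obtain ⟨e, he⟩ := exists_of_isPartialState he
    exact ⟨(p, e), Prod.ext hp he⟩
  choose pe hpe using hl
  let P : SASInstance := ⟨I.length, D, l.length, init, goal, fun a => (pe a).1, fun a => (pe a).2⟩
  have hraw : (I, stateTokens goal, number l) = P.raw := by
    refine Prod.ext ?_ (Prod.ext rfl ?_)
    · refine List.ext_getElem (by simp [SASInstance.raw, SASInstance.totalTokens,
        stateTokens, P]) fun i h₁ h₂ => ?_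
      simp [SASInstance.raw, SASInstance.totalTokens, stateTokens, P, valueToken, ← hinit]
    · refine List.ext_getElem (by simp [SASInstance.raw, number_eq, P]) fun i h₁ h₂ => ?_
      have hi : i < l.length := by simpa [number_eq] using h₁
      simp [SASInstance.raw, number_eq, SASInstance.rawAction, P, hpe ⟨i, hi⟩]
  refine ⟨P, P.isPostUnique_raw.1 ?_, ?_, ?_⟩
  · rw [← hraw]; exact h₆
  · rw [P.encode_eq, ← hraw]; exact h₁
  · rw [← hraw]

/-! #### Writing -/

/-- Minimality can be tested among the found sequences alone: a proper subsequence that is a plan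
contains a minimal plan, which is found as well. Comparing names instead of actions is harmless,
since naming is injective. -/
theorem SASInstance.exists_plans {P : SASInstance} (hP : P.PostUnique) (k : ℕ) :
    ∃ plans : List (List P.Action),
      (∀ ω, ω ∈ plans ↔ P.IsMinimalPlan ω ∧ ω.length ≤ k) ∧
      P.encodePlans plans =
        (minimalNames ((found P.raw k []).foldl (keep true) [])).flatMap renderState := by
  set F := (found P.raw k []).foldl (keep true) [] with hF
  have hmem : ∀ ω ∈ F, unmet (missing P.raw ω) = false ∧ ω.length ≤ k ∧
      ∀ a ∈ ω, a ∈ P.raw.2.2 := fun ω h =>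
    of_mem_found (k := k) k (mem_foldl_keep_true.1 h) (by simp) (by simp)
  obtain ⟨L, hL⟩ : ∃ L : List (List P.Action), L.map (List.map P.rawAction) = F := by
    have : F ∈ Set.range (List.map (List.map P.rawAction)) := by
      rw [Set.range_list_map]
      exact fun ω h => exists_map_rawAction (hmem ω h).2.2
    exact this
  let name : P.Action → Token := fun a => numeral a
  have hname : Function.Injective name := numeral_injective.comp Fin.val_injective
  have hLF : F.map (·.map (·.1)) = L.map (List.map name) := by
    rw [← hL, List.map_map]
    refine List.map_congr_left fun ω _ => ?_
    simp [name, rawAction]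
  have hsub : ∀ ω ω' : List P.Action,
      isSubsequence (ω'.map name) (ω.map name) = true ↔ ω'.Sublist ω := by
    intro ω ω'
    rw [isSubsequence_iff]
    refine ⟨fun h => ?_, fun h => h.map name⟩
    obtain ⟨σ, h₁, h₂⟩ := List.sublist_map_iff.1 h
    exact List.map_injective_iff.2 hname h₂ ▸ h₁
  have hLplan : ∀ ω ∈ L, P.IsPlan ω ∧ ω.length ≤ k := by
    intro ω h
    obtain ⟨h₁, h₂, -⟩ := hmem (ω.map P.rawAction) (hL ▸ List.mem_map_of_mem h)
    exact ⟨isPlan_iff_missing.2 h₁, by simpa using h₂⟩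
  have hraw : Function.Injective P.rawAction := fun a b h => hname (congrArg Prod.fst h)
  have hLmin : ∀ ω, P.IsMinimalPlan ω → ω.length ≤ k → ω ∈ L := by
    intro ω h hk
    have := mem_foldl_keep_true.2 (mem_found hP h hk k [] (by simp) (by simp))
    rw [List.map_nil, ← hF, ← hL] at this
    exact (List.mem_map_of_injective (List.map_injective_iff.2 hraw)).1 this
  refine ⟨L.filter fun ω => !L.any fun ω' =>
    isSubsequence (ω'.map name) (ω.map name) && !(ω'.map name == ω.map name), fun ω => ?_, ?_⟩
  · simp only [List.mem_filter, Bool.not_eq_true', List.any_eq_false, Bool.and_eq_true, hsub,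
      beq_eq_false_iff_ne, (List.map_injective_iff.2 hname).ne_iff, not_and, not_not]
    constructor
    · rintro ⟨h₁, h₂⟩
      refine ⟨⟨(hLplan ω h₁).1, fun ω' h hne hplan => ?_⟩, (hLplan ω h₁).2⟩
      obtain ⟨σ, h₃, h₄⟩ := exists_minimal_plan ω' hplan
      have h₅ := h₃.trans h
      have h₆ := h₂ σ (hLmin σ h₄ (h₅.length_le.trans (hLplan ω h₁).2)) h₅
      exact hne (h.antisymm (h₆ ▸ h₃))
    · rintro ⟨h₁, h₂⟩
      exact ⟨hLmin ω h₁ h₂, fun ω' h h' => by_contra fun hne => h₁.2 ω' h' hne (hLplan ω' h).1⟩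
  · unfold minimalNames encodePlans
    rw [hLF, List.filter_map, List.flatMap_map]
    simp only [List.any_map, Function.comp_def]
    refine List.flatMap_congr fun ω _ => ?_
    simp [renderState, List.flatMap_map, List.flatMap_assoc, encodeNumeral_eq, name]

/-! ### Running times -/

/-- The function `g` is bounded by a polynomial on the positive numbers. -/
def NatPoly (g : ℕ → ℕ) : Prop := ∃ C c : ℕ, ∀ n, 1 ≤ n → g n ≤ C * n ^ c

namespace NatPoly

variable {f g : ℕ → ℕ}

theorem id : NatPoly fun n => n := ⟨1, 1, fun n _ => by simp⟩

theorem const (a : ℕ) : NatPoly fun _ => a := ⟨a, 0, fun n _ => by simp⟩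

theorem add (hf : NatPoly f) (hg : NatPoly g) : NatPoly fun n => f n + g n := by
  obtain ⟨C, c, hC⟩ := hf
  obtain ⟨D, d, hD⟩ := hg
  refine ⟨C + D, c + d, fun n hn => ?_⟩
  rw [add_mul]
  exact Nat.add_le_add
    ((hC n hn).trans (Nat.mul_le_mul_left C (Nat.pow_le_pow_right hn (by omega))))
    ((hD n hn).trans (Nat.mul_le_mul_left D (Nat.pow_le_pow_right hn (by omega))))

theorem mul (hf : NatPoly f) (hg : NatPoly g) : NatPoly fun n => f n * g n := by
  obtain ⟨C, c, hC⟩ := hf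
  obtain ⟨D, d, hD⟩ := hg
  exact ⟨C * D, c + d, fun n hn =>
    (Nat.mul_le_mul (hC n hn) (hD n hn)).trans_eq (by rw [pow_add]; ring)⟩

theorem pow (hf : NatPoly f) (d : ℕ) : NatPoly fun n => f n ^ d := by
  obtain ⟨C, c, hC⟩ := hf
  exact ⟨C ^ d, c * d, fun n hn =>
    (Nat.pow_le_pow_left (hC n hn) d).trans_eq (by rw [mul_pow, pow_mul])⟩

end NatPoly

theorem keptBound_pos (b : Bool) (R : RawInstance) (K : List Bool) : 0 < keptBound b R K := by
  cases b
  · exact one_pos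
  · exact nodes_pos _ _ _

/-- The search between a preparation and an evaluation in polynomial time. -/
theorem exists_pipeline (b : Bool) {start : List Letter → SearchState} (hs : PolyTime start)
    {β : Type} [TreeEnc β] {fin : SearchState → β} (hf : PolyTime fin) :
    ∃ C c : ℕ, ∀ O : Type, ∃ p : Prog O, ∀ (l : List Letter) (R : RawInstance) (K : List Bool)
      (F : List (List RawAction)), 1 ≤ l.length →
      (start l = ([], [], R, K) ∧ F = [] ∨
        start l = ([[]], [], R, K) ∧ F = (found R K.length []).foldl (keep b) []) →
      Maps p (tree l) (tree (fin ([], F, R, K)))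
        (C * nodes R K.length [] * (keptBound b R K * l.length) ^ c) ∧
      sz (fin ([], F, R, K)) ≤ C * nodes R K.length [] * (keptBound b R K * l.length) ^ c := by
  obtain ⟨⟨c₁, hc₁⟩, t₀, ⟨c₀, hc₀⟩, hs⟩ := hs
  obtain ⟨⟨c₃, hc₃⟩, t₂, ⟨c₂, hc₂⟩, hf⟩ := hf
  obtain ⟨c, hc⟩ := exists_search_prog b
  -- With `m` the number of kept plans times the input length, `4 * m` bounds the size of the input
  -- tree and `g m` the size of every search state. The function `h` also covers a start where
  -- nothing is pending.
  let g : ℕ → ℕ := fun m => 20 * ((4 * m) ^ c₁) ^ 5 * m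
  let h : ℕ → ℕ := fun m => (4 * m) ^ c₁ + g m
  have h4 : NatPoly fun m => 4 * m := (NatPoly.const 4).mul .id
  have hg : NatPoly g := ((NatPoly.const 20).mul ((h4.pow c₁).pow 5)).mul .id
  have hh : NatPoly h := (h4.pow c₁).add hg
  obtain ⟨C, d, hE⟩ := ((((h4.pow c₀).add (hg.pow c)).add (.const 12)).add (hh.pow c₂)).add
    (hh.pow c₃)
  refine ⟨C, d, fun O => ?_⟩
  obtain ⟨p, hp⟩ := hs O
  obtain ⟨q, hq⟩ := hc O
  obtain ⟨r, hr⟩ := hf O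
  refine ⟨.seq (.seq p q) r, fun l R K F hl hF => ?_⟩
  have hM := keptBound_pos b R K
  have hN := nodes_pos R K.length []
  have hfinal := sz_search_result_le b R K
  obtain ⟨hq₁, hq₂⟩ := hq R K
  generalize nodes R K.length [] = N at *
  generalize keptBound b R K = M at *
  have hm : 1 ≤ M * l.length := Nat.mul_pos hM hl
  have hln : l.length ≤ M * l.length := Nat.le_mul_of_pos_left _ hM
  have hMn : M ≤ M * l.length := Nat.le_mul_of_pos_right _ hl
  have hE := hE _ hm
  generalize M * l.length = m at *
  have hsl : sz l ≤ 4 * m := by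
    have : sz l = 2 * l.length + 2 := by
      rw [sz_list]
      have : (l.map sz).sum = l.length * 2 := by
        rw [List.map_congr_left (g := fun _ => 2) (fun u _ => sz_letter u)]
        simp
      omega
    omega
  have hstart : sz (start l) ≤ (4 * m) ^ c₁ := (hc₁ l).trans (Nat.pow_le_pow_left hsl _)
  have hRK : sz (R, K) ≤ (4 * m) ^ c₁ := by
    refine le_trans ?_ hstart
    rcases hF with ⟨h, -⟩ | ⟨h, -⟩ <;> rw [h] <;> simp <;> omega
  have hB : 20 * sz (R, K) ^ 5 * M ≤ g m :=
    Nat.mul_le_mul (Nat.mul_le_mul_left _ (Nat.pow_le_pow_left hRK _)) hMn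
  have hsz : sz (([], F, R, K) : SearchState) ≤ h m := by
    rcases hF with ⟨hF, rfl⟩ | ⟨-, rfl⟩
    · rw [← hF]
      exact hstart.trans (Nat.le_add_right _ _)
    · exact hfinal.trans (hB.trans (Nat.le_add_left _ _))
  have ht₀ : t₀ l ≤ (4 * m) ^ c₀ := (hc₀ l).trans (Nat.pow_le_pow_left hsl _)
  have ht₂ : t₂ ([], F, R, K) ≤ h m ^ c₂ := (hc₂ _).trans (Nat.pow_le_pow_left hsz _)
  have hsearch : Maps q (tree (start l)) (tree (([], F, R, K) : SearchState))
      (N * (g m ^ c + 6) + 6) := by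
    rcases hF with ⟨hF, rfl⟩ | ⟨hF, rfl⟩
    · rw [hF]
      exact hq₁.mono (by omega)
    · rw [hF]
      exact hq₂.mono (Nat.add_le_add_right (Nat.mul_le_mul_left _ (Nat.add_le_add_right
        (Nat.pow_le_pow_left hB _) _)) _)
  -- Preparation and evaluation happen only once, but since `N` is positive they may be charged `N`
  -- times as well. So a single bound `N * (C * m ^ d)` covers all parts.
  have hle : ∀ a, a ≤ N * a := fun a => Nat.le_mul_of_pos_left a hN
  have htotal := Nat.mul_le_mul_left N hE
  have e : N * (C * m ^ d) = C * N * m ^ d := by ring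
  simp only [mul_add, e] at htotal
  have i₁ := hle ((4 * m) ^ c₀)
  have i₂ := hle (h m ^ c₂)
  have i₃ := hle (h m ^ c₃)
  constructor
  · refine (((hp l).seq hsearch).seq (hr _)).mono ?_
    simp only [mul_add]
    omega
  · have : sz (fin ([], F, R, K)) ≤ h m ^ c₃ := (hc₃ _).trans (Nat.pow_le_pow_left hsz _)
    omega

/-! ### The two machines and the main theorem -/

theorem Sexp.ofList_eq (l : List Letter) : Sexp.ofList l = tree l := by
  induction l with
  | nil => rfl
  | cons u l ih => rw [Sexp.ofList, ih]; rfl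

theorem Sexp.ofList_map_inl (l : List Γ') : Sexp.ofList (l.map Sum.inl) = tree l := by
  induction l with
  | nil => rfl
  | cons g l ih => rw [List.map_cons, Sexp.ofList, ih]; rfl

theorem splitInput_append_inl (l : List Letter) (g : Γ') :
    splitInput (l ++ [.inl g]) = (g :: (splitInput l).1, (splitInput l).2) := by
  simp [splitInput]

theorem splitInput_append_true (l : List Letter) :
    splitInput (l ++ [.inr true]) = ((splitInput l).1, true :: (splitInput l).2) := by
  simp [splitInput]

theorem splitInput_append_false (l : List Letter) :
    splitInput (l ++ [.inr false]) = splitInput l := by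
  simp [splitInput]

theorem splitInput_encodePair (x : List Γ') (k : ℕ) :
    splitInput (encodePair x k).reverse = (x, List.replicate k true) := by
  have h : ∀ x : List Γ', splitInput (x.map Sum.inl).reverse = (x, []) := by
    intro x
    induction x with
    | nil => rfl
    | cons g x ih => rw [List.map_cons, List.reverse_cons, splitInput_append_inl, ih]
  unfold encodePair
  induction k with
  | zero =>
    rw [List.replicate_zero, List.nil_append, List.reverse_cons, splitInput_append_false, h]
    rfl
  | succ k ih =>
    rw [List.replicate_succ, List.cons_append, List.reverse_cons, splitInput_append_true, ih]
    rfl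

theorem length_encodePair (x : List Γ') (k : ℕ) : (encodePair x k).length = x.length + k + 1 := by
  simp [encodePair]; omega

/-- The start of the search, if the input is an instance with a positive parameter. -/
def decisionStart (l : List Letter) : SearchState :=
  (bif wellFormed (splitInput l).1 (parse (splitInput l).1) && !(splitInput l).2.isEmpty
    then [[]] else [], [], (parse (splitInput l).1).2, (splitInput l).2)

/-- Bounded planning for post-unique instances in time `k ^ k` times a polynomial. -/
theorem solvableInTime_postUnique : ∃ C c : ℕ,
    SolvableInTime (BoundedSASPlanning SASInstance.PostUnique) (fun k => C * k ^ k) c := by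
  have hs : PolyTime decisionStart := by
    unfold decisionStart
    fun_prop
  have hf : PolyTime fun x : SearchState => [!x.2.1.isEmpty] := by fun_prop
  obtain ⟨C, c, h⟩ := exists_pipeline false hs hf
  obtain ⟨p, hp⟩ := h Bool
  refine ⟨C + 18, c + 1, (Prog.main (Sum.elim (fun _ => false) id) p).machine, fun x k => ?_⟩
  set n := (encodePair x k).length with hn
  have hnk : n = x.length + k + 1 := length_encodePair x k
  have hsplit := splitInput_encodePair x k
  -- The factor `k + 1` of the node bound is at most the input length, so that only `k ^ k` is left
  -- in front of the polynomial.
  have hnodes : nodes (parse x).2 k [] ≤ n * k ^ k :=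
    (nodes_le k [] (by simp)).trans (Nat.mul_le_mul_right _ (by omega))
  -- This includes `0 ^ 0 = 1`: inputs with parameter `0` are rejected within the same time bound.
  have hkk : 0 < k ^ k := Nat.pow_self_pos
  obtain ⟨F, hF, hiff⟩ : ∃ F, (decisionStart (encodePair x k).reverse =
      ([], [], (parse x).2, List.replicate k true) ∧ F = [] ∨
      decisionStart (encodePair x k).reverse = ([[]], [], (parse x).2, List.replicate k true) ∧
        F = (found (parse x).2 (List.replicate k true).length []).foldl (keep false) []) ∧
      ((!F.isEmpty) = true ↔ (x, k) ∈ BoundedSASPlanning SASInstance.PostUnique) := by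
    unfold decisionStart
    rw [hsplit]
    cases hw : wellFormed x (parse x) && !(List.replicate k true).isEmpty
    · refine ⟨[], .inl ⟨rfl, rfl⟩, by simp, ?_⟩
      rintro ⟨P, hP, rfl, hk, -⟩
      have hk : k ≠ 0 := by simp only at hk; omega
      have := P.wellFormed_encode hP
      simp [P.parse_encode, this, hk] at hw
    · refine ⟨_, .inr ⟨rfl, rfl⟩, ?_⟩
      rw [foldl_keep_false_isEmpty, List.length_replicate]
      simp only [Bool.and_eq_true, Bool.not_eq_true', List.isEmpty_eq_false_iff] at hw
      obtain ⟨P, hP, rfl, hparse⟩ := exists_of_wellFormed hw.1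
      have hk : 0 < k := by
        rcases k with _ | k
        · simp at hw
        · omega
      rw [hparse, Bool.not_eq_true', List.isEmpty_eq_false_iff, P.found_ne_nil_iff hP]
      constructor
      · exact fun h => ⟨P, hP, rfl, hk, h⟩
      -- Another instance with the same encoding has the same token form, so the result of the
      -- search does not depend on the instance chosen.
      · rintro ⟨P', hP', hx, -, h⟩
        have e₁ := P'.parse_encode
        rw [hx, hparse] at e₁
        rw [← SASInstance.found_ne_nil_iff hP'] at h
        have e₂ : P'.raw = P.raw := (Prod.ext_iff.1 e₁).2.symm
        rw [← SASInstance.found_ne_nil_iff hP, ← e₂]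
        exact h
  refine ⟨!F.isEmpty, hiff, ?_⟩
  obtain ⟨hmaps, -⟩ := hp (encodePair x k).reverse _ _ F (by simp [← hn, hnk]) hF
  simp only [List.length_replicate, List.length_reverse, ← hn] at hmaps
  have htree : tree [!F.isEmpty] = Sexp.ofList [Sum.inr (!F.isEmpty)].reverse := rfl
  rw [← Sexp.ofList_eq] at hmaps
  change Maps p _ (tree [!F.isEmpty]) _ at hmaps
  rw [htree] at hmaps
  refine hmaps.runsInTime_main (g := Sum.elim (fun _ => false) id) (y := [Sum.inr (!F.isEmpty)]) ?_
  simp only [List.length_singleton, keptBound, cond_false, one_mul, ← hn]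
  have h₁ : C * nodes (parse x).2 k [] * n ^ c ≤ C * (n * k ^ k) * n ^ c :=
    Nat.mul_le_mul_right _ (Nat.mul_le_mul_left _ hnodes)
  -- Reading the input and writing one symbol take at most `4 * n + 14 ≤ 18 * n` steps; this is the
  -- source of the constant `18`.
  have h₂ : n ≤ k ^ k * n ^ (c + 1) :=
    (Nat.le_self_pow (by omega) n).trans (Nat.le_mul_of_pos_left _ hkk)
  have h₃ : (C + 18) * k ^ k * n ^ (c + 1) =
      C * (n * k ^ k) * n ^ c + 18 * (k ^ k * n ^ (c + 1)) := by ring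
  omega

/-- The start of the search for all plans. -/
def listingStart (l : List Letter) : SearchState :=
  ([[]], [], (parse (splitInput l).1).2, (splitInput l).2)

/-- The reversed output of the search for all plans. -/
def listingOutput (x : SearchState) : List Γ' :=
  ((minimalNames x.2.1).flatMap renderState).reverse

/-- Listing the minimal plans of post-unique instances. -/
theorem minimalPlansListableInTime_postUnique : ∃ C c : ℕ,
    MinimalPlansListableInTime SASInstance.PostUnique
      (fun k => C * ((k + 1) * k ^ k) ^ c) c := by
  have hs : PolyTime listingStart := by
    unfold listingStart
    fun_prop
  have hf : PolyTime listingOutput := by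
    unfold listingOutput
    fun_prop
  obtain ⟨C, c, h⟩ := exists_pipeline true hs hf
  obtain ⟨p, hp⟩ := h Γ'
  refine ⟨5 * C + 14, c + 1, (Prog.main (Sum.elim id fun _ => Γ'.blank) p).machine,
    fun P k hP hk => ?_⟩
  obtain ⟨plans, hplans, henc⟩ := SASInstance.exists_plans hP k
  refine ⟨plans, hplans, ?_⟩
  set n := (encodePair P.encode k).length with hn
  have hnk : n = P.encode.length + k + 1 := length_encodePair _ k
  have hstart : listingStart (encodePair P.encode k).reverse =
      ([[]], [], P.raw, List.replicate k true) := by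
    rw [listingStart, splitInput_encodePair, P.parse_encode]
  obtain ⟨hmaps, hsz⟩ := hp (encodePair P.encode k).reverse _ _ _ (by simp [← hn, hnk])
    (.inr ⟨hstart, rfl⟩)
  simp only [List.length_replicate, List.length_reverse, ← hn, keptBound, cond_true] at hmaps hsz
  have hout : listingOutput ([], (found P.raw k []).foldl (keep true) [], P.raw,
      List.replicate k true) = (P.encodePlans plans).reverse := by
    rw [henc]
    rfl
  rw [hout] at hmaps hsz
  rw [← Sexp.ofList_eq, ← Sexp.ofList_map_inl, List.map_reverse] at hmaps
  have hmap : P.encodePlans plans = ((P.encodePlans plans).map Sum.inl).map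
      (Sum.elim id fun _ : Bool => Γ'.blank) := by
    simp
  rw [hmap]
  refine hmaps.runsInTime_main ?_
  have hlen := two_mul_length_le_sz (P.encodePlans plans).reverse
  simp only [List.length_reverse, List.length_map, ← hn] at hlen ⊢
  have hN : nodes P.raw k [] ≤ (k + 1) * k ^ k := nodes_le k [] (by simp)
  have hN₀ := nodes_pos P.raw k []
  generalize nodes P.raw k [] = N at *
  generalize (k + 1) * k ^ k = f at *
  -- The number `N` of nodes enters twice: as the number of search steps, and as the bound on the
  -- kept plans, which determines the size of the state. Hence the exponent `c + 1`.
  have h₁ : C * N * (N * n) ^ c ≤ C * (f ^ (c + 1) * n ^ (c + 1)) := by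
    calc C * N * (N * n) ^ c ≤ C * f * (f * n) ^ c := by gcongr
      _ = C * (f ^ (c + 1) * n ^ c) := by ring
      _ ≤ C * (f ^ (c + 1) * n ^ (c + 1)) := by
        gcongr
        · omega
        · omega
  have h₂ : n ≤ f ^ (c + 1) * n ^ (c + 1) :=
    (Nat.le_self_pow (by omega) n).trans (Nat.le_mul_of_pos_left _ (Nat.pow_pos (by omega)))
  have h₃ : (5 * C + 14) * f ^ (c + 1) * n ^ (c + 1) =
      5 * (C * (f ^ (c + 1) * n ^ (c + 1))) + 14 * (f ^ (c + 1) * n ^ (c + 1)) := by ring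
  omega

theorem primrec_pow : Primrec₂ ((· ^ ·) : ℕ → ℕ → ℕ) := Primrec₂.unpaired'.1 Nat.Primrec.pow

theorem mainTheorem1 :
    IsFPT (BoundedSASPlanning SASInstance.PostUnique) ∧
    (∃ C c : ℕ, SolvableInTime (BoundedSASPlanning SASInstance.PostUnique)
      (fun k => C * k ^ k) c) ∧
    (∃ (f : ℕ → ℕ) (c : ℕ), Computable f ∧
      MinimalPlansListableInTime SASInstance.PostUnique f c) := by
  have hpow : Primrec fun k : ℕ => k ^ k := primrec_pow.comp .id .id
  obtain ⟨C, c, h⟩ := solvableInTime_postUnique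
  obtain ⟨D, d, h'⟩ := minimalPlansListableInTime_postUnique
  refine ⟨⟨_, c, ?_, h⟩, ⟨C, c, h⟩, _, d, ?_, h'⟩
  · exact (Primrec.nat_mul.comp (.const C) hpow).to_comp
  · exact (Primrec.nat_mul.comp (.const D) (primrec_pow.comp
      (Primrec.nat_mul.comp Primrec.succ hpow) (.const d))).to_comp
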